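/- Fix $N\in\mathbb N$ and $r>0$. Let $\mathscr L^{\pm}$ be the set of Lipschitz functions $g:\mathbb R^N\to\mathbb R$ with $\lim_{|x|\to\infty}g(x)=\pm\infty$, let $\mathrm{Lip}(g)$ be the best Lipschitz constant of $g$, and put $C_r=\overline{B_r}\times\overline{B_r}$. For a measurable set $A$ let $\operatorname{osc}_A v=\operatorname{ess\,sup}_A v-\operatorname{ess\,inf}_A v$, and for a Lebesgue measurable set $F\subset\mathbb R^N$ let $$\mathrm{Per}_r(F)=\frac1{2r}\int_{\mathbb R^N}\operatorname{osc}_{B_r(w)}\chi_F\,dw .$$ Let $L^\infty_{\mathbf w}(\mathbb R^N;\mathcal M^+(C_r))$ be the set of maps $w\mapsto z_w$ from $\mathbb R^N$ to the nonnegative Radon measures on $C_r$ such that $w\mapsto\int_{C_r}f\,dz_w$ is measurable for every $f\in C^0(C_r)$ and $w\mapsto z_w(C_r)$ is essentially bounded. For such $z$, the nonlocal divergence $\mathfrak{Div}^r z$ is the Radon measure on $\mathbb R^N$ with $$\int\varphi\,d(\mathfrak{Div}^r z)=-\frac1{2r}\int_{\mathbb R^N}\int_{C_r}\bigl(\varphi(w+x)-\varphi(w+y)\bigr)\,dz_w(x,y)\,dw\qquad\text{for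 all }\varphi\in C^0_c(\mathbb R^N).$$ Let $h>0$. **Theorem.** Let $g\in\mathscr L^+$ (respectively $g\in\mathscr L^-$). There is a unique function $u=u^g_h\in\mathscr L^+$ (respectively $\mathscr L^-$) for which there exists $z\in L^\infty_{\mathbf w}(\mathbb R^N;\mathcal M^+(C_r))$ such that (a) $z$ is a nonlocal Cahn–Hoffman field for $u$: for a.e. $w\in\mathbb R^N$ one has $z_w(C_r)\le1$ and $\displaystyle\int_{C_r}\bigl(u(w+x)-u(w+y)\bigr)\,dz_w(x,y)=\operatorname{osc}_{B_r(w)}u$; (b) $-h\,\mathfrak{Div}^r z+u=g$ as Radon measures on $\mathbb R^N$ (functions being identified with their products with Lebesgue measure). Moreover $\mathrm{Lip}(u^g_h)\le\mathrm{Lip}(g)$. For every $t\in\mathbb R$, if $g\in\mathscr L^+$, the sets $\{u^g_h<t\}$ and $\{u^g_h\le t\}$ are, up to null sets, the minimal and the maximal minimizer (with respect to inclusion up to null sets), respectively, of $$F\mapsto\mathrm{Per}_r(F)+\frac1h\int_F(g(w)-t)\,dw$$ among Lebesgue measurable sets $F\subset\mathbb R^N$; if $g\in\mathscr L^-$, the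 sets $\{u^g_h>t\}$ and $\{u^g_h\ge t\}$ are the minimal and the maximal minimizer, respectively, of $F\mapsto\mathrm{Per}_r(F)+\frac1h\int_F(t-g(w))\,dw$. Finally, if $g_1,g_2\in\mathscr L^+\cup\mathscr L^-$ and $g_1\le g_2$, then $u^{g_1}_h\le u^{g_2}_h$. -/

import Mathlib

open MeasureTheory Filter Topology
open scoped NNReal ENNReal

noncomputable section

namespace NonlocalROF

/-- The Euclidean space of dimension `N`. -/
abbrev Space (N : ℕ) : Type := EuclideanSpace ℝ (Fin N)

/-- Lipschitz functions that tend to `+∞` at infinity. -/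
def LipPlus (N : ℕ) : Set (Space N → ℝ) :=
  {g | (∃ K : ℝ≥0, LipschitzWith K g) ∧ Tendsto g (cocompact (Space N)) atTop}

/-- Lipschitz functions that tend to `-∞` at infinity. -/
def LipMinus (N : ℕ) : Set (Space N → ℝ) :=
  {g | (∃ K : ℝ≥0, LipschitzWith K g) ∧ Tendsto g (cocompact (Space N)) atBot}

/-- The best Lipschitz constant of `f` (`⊤` if `f` is not Lipschitz). -/
def lipConst {N : ℕ} (f : Space N → ℝ) : ℝ≥0∞ :=
  ⨅ (K : ℝ≥0) (_ : LipschitzWith K f), (K : ℝ≥0∞)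

/-- The essential oscillation of `v` over `A`: essential supremum minus essential infimum, both
taken in the extended reals with respect to Lebesgue measure. -/
def essOsc {N : ℕ} (A : Set (Space N)) (v : Space N → ℝ) : EReal :=
  essSup (fun x => (v x : EReal)) (volume.restrict A) -
    essInf (fun x => (v x : EReal)) (volume.restrict A)

/-- The nonlocal total variation `(1 / 2r) ∫ osc_{B_r(w)} v dw`, with values in `[0, ∞]`. -/
def nonlocalTV {N : ℕ} (r : ℝ) (v : Space N → ℝ) : ℝ≥0∞ :=
  ENNReal.ofReal (1 / (2 * r)) * ∫⁻ w, (essOsc (Metric.ball w r) v).toENNReal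

/-- The nonlocal perimeter: the nonlocal total variation of the characteristic function. -/
def nonlocalPer {N : ℕ} (r : ℝ) (F : Set (Space N)) : ℝ≥0∞ :=
  nonlocalTV r (F.indicator fun _ => (1 : ℝ))

/-- The integral of `f` over `F` in the extended reals: the integral of the positive part minus
that of the negative part. -/
def extIntegral {N : ℕ} (F : Set (Space N)) (f : Space N → ℝ) : EReal :=
  ((∫⁻ x in F, ENNReal.ofReal (f x) : ℝ≥0∞) : EReal) -
    ((∫⁻ x in F, ENNReal.ofReal (-f x) : ℝ≥0∞) : EReal)

/-- The geometric functional `Per_r(F) + (1/h) ∫_F f`. -/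
def geomEnergy {N : ℕ} (r h : ℝ) (f : Space N → ℝ) (F : Set (Space N)) : EReal :=
  (nonlocalPer r F : EReal) + ((1 / h : ℝ) : EReal) * extIntegral F f

/-- `F` minimizes `Per_r + (1/h) ∫ f` among all Lebesgue measurable sets. -/
def IsGeomMinimizer {N : ℕ} (r h : ℝ) (f : Space N → ℝ) (F : Set (Space N)) : Prop :=
  NullMeasurableSet F volume ∧
    ∀ G : Set (Space N), NullMeasurableSet G volume → geomEnergy r h f F ≤ geomEnergy r h f G

/-- `F` is the minimal minimizer: a minimizer contained, up to a null set, in every minimizer. -/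
def IsMinimalMinimizer {N : ℕ} (r h : ℝ) (f : Space N → ℝ) (F : Set (Space N)) : Prop :=
  IsGeomMinimizer r h f F ∧ ∀ G, IsGeomMinimizer r h f G → F ≤ᵐ[volume] G

/-- `F` is the maximal minimizer: a minimizer containing, up to a null set, every minimizer. -/
def IsMaximalMinimizer {N : ℕ} (r h : ℝ) (f : Space N → ℝ) (F : Set (Space N)) : Prop :=
  IsGeomMinimizer r h f F ∧ ∀ G, IsGeomMinimizer r h f G → G ≤ᵐ[volume] F

/-- The compact set `C_r`, the product of the closed ball of radius `r` at `0` with itself. -/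
def ballPair (N : ℕ) (r : ℝ) : Set (Space N × Space N) :=
  Metric.closedBall 0 r ×ˢ Metric.closedBall 0 r

/-- Nonnegative fields in `L^∞_w(ℝ^N; M(C_r))`. On the compact metric space `C_r` the nonnegative
Radon measures are the finite Borel measures. The field is weakly measurable (for the Lebesgue
`σ`-algebra) and its mass is essentially bounded. -/
def IsBoundedField {N : ℕ} (r : ℝ) (z : Space N → FiniteMeasure (ballPair N r)) : Prop :=
  (∀ f : C(ballPair N r, ℝ),
    AEMeasurable (fun w => ∫ p, f p ∂(z w : Measure (ballPair N r))) volume) ∧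
  MemLp (fun w => ((z w).mass : ℝ)) ∞ volume

/-- The integral over `C_r` of `φ(w + x) - φ(w + y)` against `z_w`. -/
def fieldAction {N : ℕ} (r : ℝ) (z : Space N → FiniteMeasure (ballPair N r))
    (φ : Space N → ℝ) (w : Space N) : ℝ :=
  ∫ p, (φ (w + p.1.1) - φ (w + p.1.2)) ∂(z w : Measure (ballPair N r))

/-- `z` is a generalised nonlocal Cahn–Hoffman field for `u`. -/
def IsCahnHoffmanField {N : ℕ} (r : ℝ) (u : Space N → ℝ)
    (z : Space N → FiniteMeasure (ballPair N r)) : Prop :=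
  IsBoundedField r z ∧
    ∀ᵐ w : Space N, (z w).mass ≤ 1 ∧
      (fieldAction r z u w : EReal) = essOsc (Metric.ball w r) u

/-- The nonlocal divergence of `z`, a Radon measure given by its action on continuous compactly
supported functions. -/
def nonlocalDiv {N : ℕ} (r : ℝ) (z : Space N → FiniteMeasure (ballPair N r))
    (φ : Space N → ℝ) : ℝ :=
  -(1 / (2 * r)) * ∫ w, fieldAction r z φ w

/-- The identity `-h Div^r z + u = g` between Radon measures on `ℝ^N`, where a function stands for
its product with Lebesgue measure: both sides have the same action on `C_c(ℝ^N)`. -/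
def SolvesEquation {N : ℕ} (r h : ℝ) (g u : Space N → ℝ)
    (z : Space N → FiniteMeasure (ballPair N r)) : Prop :=
  ∀ φ : Space N → ℝ, Continuous φ → HasCompactSupport φ →
    -h * nonlocalDiv r z φ + ∫ w, φ w * u w = ∫ w, φ w * g w

/-- `u` satisfies the Euler–Lagrange system with datum `g`: for some Cahn–Hoffman field `z` of `u`,
`-h Div^r z + u = g` as measures. -/
def IsSolution {N : ℕ} (r h : ℝ) (g u : Space N → ℝ) : Prop :=
  ∃ z : Space N → FiniteMeasure (ballPair N r),
    IsCahnHoffmanField r u z ∧ SolvesEquation r h g u z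

end NonlocalROF

end

/-! ### Suprema, infima and oscillation over closed balls. -/

noncomputable section

namespace NonlocalROF

open Metric Set

variable {N : ℕ} {r : ℝ}

/-! Write c = h/(2r). Tested with φ in C_c, the equation says c ∫ (action of z on φ) = ∫ φ (g - u).
The action of z_w on φ never exceeds the oscillation of φ over the closed r-ball at w, and for φ = u
it equals it. For increasing Lipschitz ψ this equality passes from u to ψ(u), because the
oscillations of ψ(u) and Cu - ψ(u) add up to that of Cu when both functions increase with u
(`fieldAction_comp`). So z calibrates all truncations of u, and uniqueness, order and the geometric
statements follow from this.

Comparison (`comp_le_comp_of_isSolution`): test both equations with the positive part of ψ(u₁) -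
ψ(u₂), where ψ is chosen to make the support compact. Submodularity of the oscillation gives the
sign of the difference of the actions, so the weighted integral of u₁ - u₂ is nonpositive.
Uniqueness is the case of equal data.

Level sets: the perimeter of G is 1/(2r) times the volume of the open set of centres whose ball
meets both G and its complement in positive measure. A set of finite energy agrees a.e. with a
bounded set, and testing with its mollified characteristic function gives ∫_G (u - g) ≤ h Per(G)
(`setIntegral_sub_le`). For sublevel sets of u the reverse inequality follows by testing with steep
truncations of u and Fatou's lemma (`volume_interfaceSet_sublevel_le`). Hence every energy is at
least (1/h) ∫_G (u - t) ≥ (1/h) ∫ min(u - t, 0), both sublevel sets attain this bound, and equality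
forces G to lie between them (`le_geomEnergy`).

Existence: the extremal pairs in each ball are replaced by the Gibbs measure with density
proportional to exp(β(u(w+x) - u(w+y))). Its divergence is an explicit function of u, and the
regularised equation is solved by a contraction that preserves order, commutes with translations and
is compatible with adding constants; the solution is therefore as Lipschitz as g
(`exists_lipschitz_solution`). Bounds on g - u that do not depend on β, tightness of the Gibbs
fields and disintegration give a limit pair as β → ∞. The Gibbs measures concentrate on extremal
pairs uniformly over L-Lipschitz functions (`exists_gibbsAvg_le`), so the limit field is a
Cahn–Hoffman field. The case of `LipMinus` follows from that of `LipPlus` by reflection. -/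

/-- The supremum of `f` over the closed ball of radius `r` at `w`. -/
def ballSup (r : ℝ) (f : Space N → ℝ) (w : Space N) : ℝ := sSup (f '' closedBall w r)

/-- The infimum of `f` over the closed ball of radius `r` at `w`. -/
def ballInf (r : ℝ) (f : Space N → ℝ) (w : Space N) : ℝ := sInf (f '' closedBall w r)

/-- The oscillation of `f` over the closed ball of radius `r` at `w`. -/
def ballOsc (r : ℝ) (f : Space N → ℝ) (w : Space N) : ℝ := ballSup r f w - ballInf r f w

theorem exists_eq_ballSup (hr : 0 ≤ r) {f : Space N → ℝ} (hf : Continuous f) (w : Space N) :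
    ∃ x ∈ closedBall w r, f x = ballSup r f w := by
  have hc : IsCompact (f '' closedBall w r) := (isCompact_closedBall w r).image hf
  obtain ⟨x, hx, h⟩ := hc.sSup_mem ((nonempty_closedBall.2 hr).image f)
  exact ⟨x, hx, h⟩

theorem exists_eq_ballInf (hr : 0 ≤ r) {f : Space N → ℝ} (hf : Continuous f) (w : Space N) :
    ∃ x ∈ closedBall w r, f x = ballInf r f w := by
  have hc : IsCompact (f '' closedBall w r) := (isCompact_closedBall w r).image hf
  obtain ⟨x, hx, h⟩ := hc.sInf_mem ((nonempty_closedBall.2 hr).image f)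
  exact ⟨x, hx, h⟩

theorem le_ballSup {f : Space N → ℝ} (hf : Continuous f) {w x : Space N}
    (hx : x ∈ closedBall w r) : f x ≤ ballSup r f w :=
  le_csSup ((isCompact_closedBall w r).image hf).bddAbove (mem_image_of_mem f hx)

theorem ballInf_le {f : Space N → ℝ} (hf : Continuous f) {w x : Space N}
    (hx : x ∈ closedBall w r) : ballInf r f w ≤ f x :=
  csInf_le ((isCompact_closedBall w r).image hf).bddBelow (mem_image_of_mem f hx)

theorem sub_le_ballOsc {f : Space N → ℝ} (hf : Continuous f) {w x y : Space N}
    (hx : x ∈ closedBall w r) (hy : y ∈ closedBall w r) : f x - f y ≤ ballOsc r f w :=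
  sub_le_sub (le_ballSup hf hx) (ballInf_le hf hy)

theorem exists_eq_ballOsc (hr : 0 ≤ r) {f : Space N → ℝ} (hf : Continuous f) (w : Space N) :
    ∃ x ∈ closedBall w r, ∃ y ∈ closedBall w r, f x - f y = ballOsc r f w := by
  obtain ⟨x, hx, h⟩ := exists_eq_ballSup hr hf w
  obtain ⟨y, hy, h'⟩ := exists_eq_ballInf hr hf w
  exact ⟨x, hx, y, hy, by rw [h, h']; rfl⟩

theorem ballOsc_nonneg (hr : 0 ≤ r) {f : Space N → ℝ} (hf : Continuous f) (w : Space N) :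
    0 ≤ ballOsc r f w := by
  have hw : w ∈ closedBall w r := mem_closedBall_self hr
  simpa using sub_le_ballOsc hf hw hw

theorem ballSup_comp (hr : 0 ≤ r) {f : Space N → ℝ} (hf : Continuous f) {ψ : ℝ → ℝ}
    (hψ : Continuous ψ) (hm : Monotone ψ) (w : Space N) :
    ballSup r (fun x => ψ (f x)) w = ψ (ballSup r f w) := by
  obtain ⟨x, hx, h⟩ := exists_eq_ballSup hr hf w
  obtain ⟨y, hy, h'⟩ := exists_eq_ballSup hr (hψ.comp hf) w
  refine le_antisymm ?_ ?_
  · exact h'.symm.le.trans (hm (le_ballSup hf hy))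
  · rw [← h]
    exact le_ballSup (hψ.comp hf) hx

theorem ballInf_comp (hr : 0 ≤ r) {f : Space N → ℝ} (hf : Continuous f) {ψ : ℝ → ℝ}
    (hψ : Continuous ψ) (hm : Monotone ψ) (w : Space N) :
    ballInf r (fun x => ψ (f x)) w = ψ (ballInf r f w) := by
  obtain ⟨x, hx, h⟩ := exists_eq_ballInf hr hf w
  obtain ⟨y, hy, h'⟩ := exists_eq_ballInf hr (hψ.comp hf) w
  refine le_antisymm ?_ ?_
  · rw [← h]
    exact ballInf_le (hψ.comp hf) hx
  · exact (hm (ballInf_le hf hy)).trans h'.le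

theorem ballOsc_comp (hr : 0 ≤ r) {f : Space N → ℝ} (hf : Continuous f) {ψ : ℝ → ℝ}
    (hψ : Continuous ψ) (hm : Monotone ψ) (w : Space N) :
    ballOsc r (fun x => ψ (f x)) w = ψ (ballSup r f w) - ψ (ballInf r f w) := by
  rw [ballOsc, ballSup_comp hr hf hψ hm, ballInf_comp hr hf hψ hm]

/-- Submodularity of the oscillation. -/
theorem ballOsc_min_add_ballOsc_max_le (hr : 0 ≤ r) {f g : Space N → ℝ} (hf : Continuous f)
    (hg : Continuous g) (w : Space N) :
    ballOsc r (fun x => min (f x) (g x)) w + ballOsc r (fun x => max (f x) (g x)) w ≤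
      ballOsc r f w + ballOsc r g w := by
  obtain ⟨x, hx, y, hy, h⟩ := exists_eq_ballOsc hr (hf.min hg) w
  obtain ⟨x', hx', y', hy', h'⟩ := exists_eq_ballOsc hr (hf.max hg) w
  rw [← h, ← h']
  -- Whichever function realises the maximum at `x'` is charged there; the minimum at `x` is then
  -- charged to the other one.
  have hsup : min (f x) (g x) + max (f x') (g x') ≤ ballSup r f w + ballSup r g w := by
    rcases le_total (f x') (g x') with k | k
    · rw [max_eq_right k]
      exact add_le_add ((min_le_left _ _).trans (le_ballSup hf hx)) (le_ballSup hg hx')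
    · rw [max_eq_left k, add_comm]
      exact add_le_add (le_ballSup hf hx') ((min_le_right _ _).trans (le_ballSup hg hx))
  have hinf : ballInf r f w + ballInf r g w ≤ min (f y) (g y) + max (f y') (g y') := by
    rcases le_total (f y) (g y) with k | k
    · rw [min_eq_left k]
      exact add_le_add (ballInf_le hf hy) ((ballInf_le hg hy').trans (le_max_right _ _))
    · rw [min_eq_right k, add_comm]
      exact add_le_add (ballInf_le hg hy) ((ballInf_le hf hy').trans (le_max_left _ _))
  simp only [ballOsc]
  linarith

theorem ballOsc_le_of_lipschitz (hr : 0 ≤ r) {f : Space N → ℝ} {K : ℝ≥0} (hf : LipschitzWith K f)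
    (w : Space N) : ballOsc r f w ≤ K * (2 * r) := by
  obtain ⟨x, hx, y, hy, h⟩ := exists_eq_ballOsc hr hf.continuous w
  rw [← h]
  refine (le_abs_self _).trans ((hf.dist_le_mul x y).trans ?_)
  refine mul_le_mul_of_nonneg_left ?_ K.2
  have := dist_triangle_right x y w
  rw [mem_closedBall] at hx hy
  linarith

theorem ballSup_sub_le (hr : 0 ≤ r) {f : Space N → ℝ} {K : ℝ≥0} (hf : LipschitzWith K f)
    (w w' : Space N) : ballSup r f w - ballSup r f w' ≤ K * dist w w' := by
  obtain ⟨x, hx, h⟩ := exists_eq_ballSup hr hf.continuous w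
  have hx' : x + (w' - w) ∈ closedBall w' r := by
    rw [mem_closedBall, dist_eq_norm] at hx ⊢
    convert hx using 2
    abel
  have h1 := le_ballSup hf.continuous hx'
  have h2 := (le_abs_self _).trans (hf.dist_le_mul x (x + (w' - w)))
  rw [dist_self_add_right, ← dist_eq_norm, dist_comm] at h2
  linarith

theorem ballInf_eq_neg_ballSup (f : Space N → ℝ) (w : Space N) :
    ballInf r f w = -ballSup r (fun x => -f x) w := by
  rw [ballInf, ballSup, Real.sInf_def]
  congr 2
  ext y
  simp only [Set.mem_neg, mem_image]
  exact ⟨fun ⟨x, hx, h⟩ => ⟨x, hx, by rw [h, neg_neg]⟩, fun ⟨x, hx, h⟩ => ⟨x, hx, by rw [← h, neg_neg]⟩⟩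

theorem ballOsc_neg (f : Space N → ℝ) (w : Space N) :
    ballOsc r (fun x => -f x) w = ballOsc r f w := by
  simp only [ballOsc, ballInf_eq_neg_ballSup, neg_neg]
  ring

theorem continuous_ballSup (hr : 0 ≤ r) {f : Space N → ℝ} {K : ℝ≥0} (hf : LipschitzWith K f) :
    Continuous (ballSup r f) :=
  (LipschitzWith.of_le_add_mul K fun w w' => by
    linarith [ballSup_sub_le hr hf w w']).continuous

theorem continuous_ballOsc (hr : 0 ≤ r) {f : Space N → ℝ} {K : ℝ≥0} (hf : LipschitzWith K f) :
    Continuous (ballOsc r f) := by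
  have h : ballOsc r f = fun w => ballSup r f w + ballSup r (fun x => -f x) w := by
    ext w
    rw [ballOsc, ballInf_eq_neg_ballSup, sub_neg_eq_add]
  rw [h]
  exact (continuous_ballSup hr hf).add (continuous_ballSup hr hf.neg)

theorem ballOsc_le_add (hr : 0 ≤ r) {f g : Space N → ℝ} (hf : Continuous f) (hg : Continuous g)
    {w : Space N} {d : ℝ} (h : ∀ x ∈ closedBall w r, |f x - g x| ≤ d) :
    ballOsc r f w ≤ ballOsc r g w + 2 * d := by
  obtain ⟨x, hx, y, hy, e⟩ := exists_eq_ballOsc hr hf w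
  have := sub_le_ballOsc hg hx hy
  have h1 := abs_le.1 (h x hx)
  have h2 := abs_le.1 (h y hy)
  linarith [h1.1, h1.2, h2.1, h2.2]

/-- By continuity, being close to the maximum over the closed ball is an open condition. The maximum
may sit on the sphere, but for r > 0 the closed ball is the closure of the open one, so this open
set meets the open ball in positive measure. This identifies the essential oscillation with
`ballOsc`. -/
theorem essSup_ball_eq (hr : 0 < r) {f : Space N → ℝ} (hf : Continuous f) (w : Space N) :
    essSup (fun x => (f x : EReal)) (volume.restrict (ball w r)) = (ballSup r f w : EReal) := by
  refine le_antisymm ?_ ?_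
  · refine essSup_le_of_ae_le _ ?_
    filter_upwards [ae_restrict_mem measurableSet_ball] with x hx
    exact EReal.coe_le_coe_iff.2 (le_ballSup hf (ball_subset_closedBall hx))
  · refine le_of_forall_lt fun c hc => ?_
    obtain ⟨d, hcd, hd⟩ := exists_between hc
    refine hcd.trans_le ?_
    obtain ⟨x, hx, h⟩ := exists_eq_ballSup hr.le hf w
    have hopen : IsOpen {y | d < (f y : EReal)} :=
      isOpen_Ioi.preimage (continuous_coe_real_ereal.comp hf)
    have hne : ({y | d < (f y : EReal)} ∩ ball w r).Nonempty := by
      rw [← closure_ball w hr.ne'] at hx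
      exact mem_closure_iff.1 hx _ hopen (by simpa [h] using hd)
    have hpos := (hopen.inter isOpen_ball).measure_pos volume hne
    by_contra hlt
    rw [not_le] at hlt
    have hae := ae_lt_of_essSup_lt hlt
    rw [ae_restrict_iff' measurableSet_ball, ae_iff] at hae
    refine hpos.ne' (measure_mono_null ?_ hae)
    rintro y ⟨hy, hyb⟩
    simp only [mem_ofPred_eq, Classical.not_imp, not_lt]
    exact ⟨hyb, le_of_lt hy⟩

theorem essInf_ball_eq (hr : 0 < r) {f : Space N → ℝ} (hf : Continuous f) (w : Space N) :
    essInf (fun x => (f x : EReal)) (volume.restrict (ball w r)) = (ballInf r f w : EReal) := by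
  refine le_antisymm ?_ ?_
  · refine le_of_forall_gt fun c hc => ?_
    obtain ⟨d, hd, hdc⟩ := exists_between hc
    refine lt_of_le_of_lt ?_ hdc
    obtain ⟨x, hx, h⟩ := exists_eq_ballInf hr.le hf w
    have hopen : IsOpen {y | (f y : EReal) < d} :=
      isOpen_Iio.preimage (continuous_coe_real_ereal.comp hf)
    have hne : ({y | (f y : EReal) < d} ∩ ball w r).Nonempty := by
      rw [← closure_ball w hr.ne'] at hx
      exact mem_closure_iff.1 hx _ hopen (by simpa [h] using hd)
    have hpos := (hopen.inter isOpen_ball).measure_pos volume hne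
    by_contra hlt
    rw [not_le] at hlt
    have hae := ae_lt_of_lt_essInf hlt
    rw [ae_restrict_iff' measurableSet_ball, ae_iff] at hae
    refine hpos.ne' (measure_mono_null ?_ hae)
    rintro y ⟨hy, hyb⟩
    simp only [mem_ofPred_eq, Classical.not_imp, not_lt]
    exact ⟨hyb, le_of_lt hy⟩
  · refine le_essInf_of_ae_le _ ?_
    filter_upwards [ae_restrict_mem measurableSet_ball] with x hx
    exact EReal.coe_le_coe_iff.2 (ballInf_le hf (ball_subset_closedBall hx))

theorem essOsc_ball_eq (hr : 0 < r) {f : Space N → ℝ} (hf : Continuous f) (w : Space N) :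
    essOsc (ball w r) f = (ballOsc r f w : EReal) := by
  rw [essOsc, essSup_ball_eq hr hf, essInf_ball_eq hr hf, ballOsc, EReal.coe_sub]

end NonlocalROF

end

/-! ### Action of a field of measures on test functions. -/

noncomputable section

namespace NonlocalROF

open Metric Set

variable {N : ℕ} {r : ℝ}

instance instCompactSpaceBallPair : CompactSpace (ballPair N r) :=
  isCompact_iff_compactSpace.1 ((isCompact_closedBall 0 r).prod (isCompact_closedBall 0 r))

/-- The difference `(w, p) ↦ φ (w + p.1) - φ (w + p.2)` along pairs of points of a ball. -/
def pairDiff (φ : Space N → ℝ) (w : Space N) (p : ballPair N r) : ℝ :=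
  φ (w + p.1.1) - φ (w + p.1.2)

theorem fieldAction_eq (z : Space N → FiniteMeasure (ballPair N r)) (φ : Space N → ℝ)
    (w : Space N) : fieldAction r z φ w = ∫ p, pairDiff φ w p ∂(z w : Measure (ballPair N r)) :=
  rfl

theorem fst_mem (w : Space N) (p : ballPair N r) : w + p.1.1 ∈ closedBall w r := by
  have := p.2.1
  rw [mem_closedBall_zero_iff] at this
  simpa [mem_closedBall, dist_eq_norm] using this

theorem snd_mem (w : Space N) (p : ballPair N r) : w + p.1.2 ∈ closedBall w r := by
  have := p.2.2
  rw [mem_closedBall_zero_iff] at this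
  simpa [mem_closedBall, dist_eq_norm] using this

theorem continuous_pairDiff {φ : Space N → ℝ} (hφ : Continuous φ) :
    Continuous fun q : Space N × ballPair N r => pairDiff φ q.1 q.2 := by
  unfold pairDiff
  fun_prop

theorem continuous_pairDiff_right {φ : Space N → ℝ} (hφ : Continuous φ) (w : Space N) :
    Continuous fun p : ballPair N r => pairDiff φ w p := by
  unfold pairDiff
  fun_prop

theorem pairDiff_le {φ : Space N → ℝ} (hφ : Continuous φ) (w : Space N) (p : ballPair N r) :
    pairDiff φ w p ≤ ballOsc r φ w :=
  sub_le_ballOsc hφ (fst_mem w p) (snd_mem w p)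

theorem abs_pairDiff_le {φ : Space N → ℝ} (hφ : Continuous φ) (w : Space N) (p : ballPair N r) :
    |pairDiff φ w p| ≤ ballOsc r φ w := by
  refine abs_le.2 ⟨?_, pairDiff_le hφ w p⟩
  have := sub_le_ballOsc hφ (snd_mem w p) (fst_mem w p)
  unfold pairDiff
  linarith

theorem pairDiff_eq_zero {φ : Space N → ℝ} {w : Space N}
    (h : ∀ x ∈ closedBall w r, φ x = 0) (p : ballPair N r) : pairDiff φ w p = 0 := by
  rw [pairDiff, h _ (fst_mem w p), h _ (snd_mem w p), sub_zero]

theorem integrable_of_continuous_ballPair (μ : Measure (ballPair N r)) [IsFiniteMeasure μ]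
    {f : ballPair N r → ℝ} (hf : Continuous f) : Integrable f μ := by
  simpa using (hf.continuousOn (s := univ)).integrableOn_compact' isCompact_univ MeasurableSet.univ

theorem fieldAction_sub (z : Space N → FiniteMeasure (ballPair N r)) {φ ψ : Space N → ℝ}
    (hφ : Continuous φ) (hψ : Continuous ψ) (w : Space N) :
    fieldAction r z (fun x => φ x - ψ x) w = fieldAction r z φ w - fieldAction r z ψ w := by
  rw [fieldAction_eq, fieldAction_eq, fieldAction_eq, ← integral_sub
    (integrable_of_continuous_ballPair _ (continuous_pairDiff_right hφ w))
    (integrable_of_continuous_ballPair _ (continuous_pairDiff_right hψ w))]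
  congr 1 with p
  simp only [pairDiff]
  ring

theorem fieldAction_const_mul (z : Space N → FiniteMeasure (ballPair N r)) (φ : Space N → ℝ)
    (c : ℝ) (w : Space N) :
    fieldAction r z (fun x => c * φ x) w = c * fieldAction r z φ w := by
  rw [fieldAction_eq, fieldAction_eq, ← integral_const_mul]
  congr 1 with p
  simp only [pairDiff]
  ring

theorem abs_fieldAction_le (z : Space N → FiniteMeasure (ballPair N r)) {φ : Space N → ℝ}
    {w : Space N} (hm : (z w).mass ≤ 1) {C : ℝ} (hC : 0 ≤ C)
    (h : ∀ p : ballPair N r, |pairDiff φ w p| ≤ C) : |fieldAction r z φ w| ≤ C := by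
  rw [fieldAction_eq, ← Real.norm_eq_abs]
  refine (norm_integral_le_of_norm_le_const (Eventually.of_forall h)).trans ?_
  have : (z w : Measure (ballPair N r)).real univ ≤ 1 := by exact_mod_cast hm
  nlinarith

theorem fieldAction_le (hr : 0 ≤ r) (z : Space N → FiniteMeasure (ballPair N r)) {φ : Space N → ℝ}
    (hφ : Continuous φ) {w : Space N} (hm : (z w).mass ≤ 1) :
    fieldAction r z φ w ≤ ballOsc r φ w :=
  (le_abs_self _).trans (abs_fieldAction_le z hm (ballOsc_nonneg hr hφ w) (abs_pairDiff_le hφ w))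

/-- Monotonicity of C s - ψ(s) encodes the Lipschitz bound. Both ψ(u) and Cu - ψ(u) are increasing
functions of u, so their oscillations add up to C times that of u. The action is linear, bounded by
the oscillation on each summand and equal to it on the sum, hence equal on each. -/
theorem fieldAction_comp (hr : 0 ≤ r) (z : Space N → FiniteMeasure (ballPair N r))
    {u : Space N → ℝ} (hu : Continuous u) {w : Space N} (hm : (z w).mass ≤ 1)
    (h : fieldAction r z u w = ballOsc r u w) {ψ : ℝ → ℝ} (hψ : Continuous ψ) (hmψ : Monotone ψ)
    {C : ℝ} (hC' : Monotone fun s => C * s - ψ s) :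
    fieldAction r z (fun x => ψ (u x)) w = ballOsc r (fun x => ψ (u x)) w := by
  have hψu : Continuous fun x => ψ (u x) := hψ.comp hu
  refine le_antisymm (fieldAction_le hr z hψu hm) ?_
  have hcψ : Continuous fun s => C * s - ψ s := by fun_prop
  have h1 := fieldAction_le hr z (hcψ.comp hu) hm
  simp only [Function.comp_def] at h1
  rw [fieldAction_sub z (hu.const_mul C) hψu, fieldAction_const_mul, h,
    ballOsc_comp hr hu hcψ hC'] at h1
  rw [ballOsc_comp hr hu hψ hmψ]
  simp only [ballOsc] at h1
  linarith

/-- Weak measurability is assumed only for test functions independent of w. A family depending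
continuously on w is a uniform limit, for each w, of simple functions of w with values in C(C_r),
and for those the integral is a finite sum of measurable pieces. -/
theorem aemeasurable_integral_field {z : Space N → FiniteMeasure (ballPair N r)}
    (hz : ∀ f : C(ballPair N r, ℝ),
      AEMeasurable (fun w => ∫ p, f p ∂(z w : Measure (ballPair N r))) volume)
    (F : C(Space N, C(ballPair N r, ℝ))) :
    AEMeasurable (fun w => ∫ p, F w p ∂(z w : Measure (ballPair N r))) volume := by
  classical
  have hF : StronglyMeasurable F := F.continuous.stronglyMeasurable
  refine aemeasurable_of_tendsto_metrizable_ae atTop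
    (f := fun n w => ∫ p, hF.approx n w p ∂(z w : Measure (ballPair N r))) (fun n => ?_)
    (Eventually.of_forall fun w => ?_)
  · have h : (fun w => ∫ p, hF.approx n w p ∂(z w : Measure (ballPair N r))) =
        fun w => ∑ f ∈ (hF.approx n).range, (hF.approx n ⁻¹' {f}).indicator
          (fun w => ∫ p, f p ∂(z w : Measure (ballPair N r))) w := by
      ext w
      rw [Finset.sum_eq_single (hF.approx n w)]
      · simp
      · intro f _ hf
        rw [indicator_of_notMem]
        simpa using hf.symm
      · intro hw
        exact absurd (SimpleFunc.mem_range_self _ w) hw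
    rw [h]
    refine Finset.aemeasurable_fun_sum _ fun f _ => ?_
    exact (hz f).indicator ((hF.approx n).measurableSet_fiber f)
  · have hlim := hF.tendsto_approx w
    rw [tendsto_iff_norm_sub_tendsto_zero] at hlim ⊢
    refine squeeze_zero (fun _ => norm_nonneg _)
      (g := fun n => ‖hF.approx n w - F w‖ * (z w : Measure (ballPair N r)).real univ)
      (fun n => ?_) (by simpa using hlim.mul_const _)
    rw [← integral_sub (integrable_of_continuous_ballPair _ (map_continuous _))
      (integrable_of_continuous_ballPair _ (map_continuous _))]
    exact norm_integral_le_of_norm_le_const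
      (Eventually.of_forall fun p => (hF.approx n w - F w).norm_coe_le_norm p)

/-- The pair difference of a continuous function as a continuous family of continuous functions. -/
def pairDiffMap {φ : Space N → ℝ} (hφ : Continuous φ) : C(Space N, C(ballPair N r, ℝ)) :=
  ContinuousMap.curry ⟨fun q => pairDiff φ q.1 q.2, continuous_pairDiff hφ⟩

theorem aemeasurable_fieldAction {z : Space N → FiniteMeasure (ballPair N r)}
    (hz : IsBoundedField r z) {φ : Space N → ℝ} (hφ : Continuous φ) :
    AEMeasurable (fieldAction r z φ) volume :=
  aemeasurable_integral_field hz.1 (pairDiffMap hφ)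

theorem fieldAction_eq_zero (z : Space N → FiniteMeasure (ballPair N r)) {φ : Space N → ℝ}
    {w : Space N} (h : ∀ x ∈ closedBall w r, φ x = 0) : fieldAction r z φ w = 0 := by
  rw [fieldAction_eq]
  simp [pairDiff_eq_zero h]

theorem exists_forall_eq_zero {φ : Space N → ℝ} (hφ : HasCompactSupport φ) (r : ℝ) :
    ∃ R, ∀ w ∉ closedBall (0 : Space N) R, ∀ x ∈ closedBall w r, φ x = 0 := by
  obtain ⟨R, hR⟩ := hφ.isCompact.isBounded.subset_closedBall (0 : Space N)
  refine ⟨R + r, fun w hw x hx => image_eq_zero_of_notMem_tsupport fun hxs => hw ?_⟩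
  have h1 := hR hxs
  rw [mem_closedBall] at *
  linarith [dist_triangle_left w 0 x]

theorem exists_abs_pairDiff_le {φ : Space N → ℝ} (hφ : Continuous φ) (hc : HasCompactSupport φ) :
    ∃ C, 0 ≤ C ∧ ∀ (w : Space N) (p : ballPair N r), |pairDiff φ w p| ≤ C := by
  obtain ⟨C, hC⟩ := hφ.bounded_above_of_compact_support hc
  have h0 : 0 ≤ C := (norm_nonneg _).trans (hC 0)
  refine ⟨C + C, by positivity, fun w p => ?_⟩
  exact (abs_sub _ _).trans (add_le_add (hC _) (hC _))

theorem integrable_of_bounded_of_zero {f : Space N → ℝ} (hf : AEStronglyMeasurable f volume)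
    {C R : ℝ} (hC : ∀ᵐ w, |f w| ≤ C) (hR : ∀ w ∉ closedBall (0 : Space N) R, f w = 0) :
    Integrable f volume := by
  have : IntegrableOn f (closedBall 0 R) volume :=
    Measure.integrableOn_of_bounded (measure_closedBall_lt_top).ne hf
      (ae_restrict_of_ae hC)
  refine (integrableOn_iff_integrable_of_support_subset fun w hw => ?_).1 this
  by_contra h
  exact hw (hR w h)

theorem integrable_fieldAction {z : Space N → FiniteMeasure (ballPair N r)}
    (hz : IsBoundedField r z) (hm : ∀ᵐ w, (z w).mass ≤ 1) {φ : Space N → ℝ} (hφ : Continuous φ)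
    (hc : HasCompactSupport φ) : Integrable (fieldAction r z φ) volume := by
  obtain ⟨C, h0, hC⟩ := exists_abs_pairDiff_le (r := r) hφ hc
  obtain ⟨R, hR⟩ := exists_forall_eq_zero hc r
  refine integrable_of_bounded_of_zero (C := C) (R := R)
    (aemeasurable_fieldAction hz hφ).aestronglyMeasurable ?_ ?_
  · filter_upwards [hm] with w hw
    exact abs_fieldAction_le z hw h0 (hC w)
  · exact fun w hw => fieldAction_eq_zero z (hR w hw)

theorem IsCahnHoffmanField.fieldAction_eq_ballOsc (hr : 0 < r) {u : Space N → ℝ}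
    (hu : Continuous u) {z : Space N → FiniteMeasure (ballPair N r)}
    (hz : IsCahnHoffmanField r u z) :
    ∀ᵐ w : Space N, (z w).mass ≤ 1 ∧ fieldAction r z u w = ballOsc r u w := by
  filter_upwards [hz.2] with w hw
  refine ⟨hw.1, ?_⟩
  have := hw.2
  rw [essOsc_ball_eq hr hu] at this
  exact_mod_cast this

end NonlocalROF

end

/-! ### Comparison principle and reflection. -/

noncomputable section

namespace NonlocalROF

open Metric Set

variable {N : ℕ} {r h : ℝ}

theorem SolvesEquation.integral_fieldAction {g u : Space N → ℝ}
    {z : Space N → FiniteMeasure (ballPair N r)} (hz : SolvesEquation r h g u z)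
    (hu : Continuous u) (hg : Continuous g) {φ : Space N → ℝ} (hφ : Continuous φ)
    (hc : HasCompactSupport φ) :
    h * (1 / (2 * r)) * ∫ w, fieldAction r z φ w = ∫ w, φ w * (g w - u w) := by
  have h1 := hz φ hφ hc
  have hiu : Integrable (fun w => φ w * u w) :=
    (hφ.mul hu).integrable_of_hasCompactSupport hc.mul_right
  have hig : Integrable (fun w => φ w * g w) :=
    (hφ.mul hg).integrable_of_hasCompactSupport hc.mul_right
  simp only [mul_sub]
  rw [integral_sub hig hiu, ← h1, nonlocalDiv]
  ring

/-- With a = ψ(u₁) and b = ψ(u₂), the test function is (a - b)⁺, written both as max(a,b) - b and as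
a - min(a,b). The field z₂ is exact on b and z₁ is exact on a, so submodularity makes the action of
z₂ at most that of z₁. Subtracting the equations gives ∫ φ (u₁ - u₂) ≤ ∫ φ (g₁ - g₂) ≤ 0, whose left
integrand is nonnegative and would be positive at a point where a > b. -/
theorem comp_le_comp_of_isSolution (hr : 0 < r) (hh : 0 < h) {g₁ g₂ u₁ u₂ : Space N → ℝ}
    (hu₁ : Continuous u₁) (hu₂ : Continuous u₂) (hg₁ : Continuous g₁) (hg₂ : Continuous g₂)
    (hs₁ : IsSolution r h g₁ u₁) (hs₂ : IsSolution r h g₂ u₂) (hg : ∀ w, g₁ w ≤ g₂ w)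
    {ψ : ℝ → ℝ} (hψ : Continuous ψ) (hm : Monotone ψ) (hm' : Monotone fun s => 1 * s - ψ s)
    (hc : HasCompactSupport fun w => max (ψ (u₁ w)) (ψ (u₂ w)) - ψ (u₂ w)) (w : Space N) :
    ψ (u₁ w) ≤ ψ (u₂ w) := by
  obtain ⟨z₁, hz₁, he₁⟩ := hs₁
  obtain ⟨z₂, hz₂, he₂⟩ := hs₂
  set φ : Space N → ℝ := fun w => max (ψ (u₁ w)) (ψ (u₂ w)) - ψ (u₂ w) with hφdef
  have ha : Continuous fun w => ψ (u₁ w) := hψ.comp hu₁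
  have hb : Continuous fun w => ψ (u₂ w) := hψ.comp hu₂
  have hφ : Continuous φ := (ha.max hb).sub hb
  have hφ' : φ = fun w => ψ (u₁ w) - min (ψ (u₁ w)) (ψ (u₂ w)) := by
    ext w
    simp only [hφdef]
    linarith [min_add_max (ψ (u₁ w)) (ψ (u₂ w))]
  have hφ0 : ∀ w, 0 ≤ φ w := fun w => sub_nonneg.2 (le_max_right _ _)
  have hp₁ := hz₁.fieldAction_eq_ballOsc hr hu₁
  have hp₂ := hz₂.fieldAction_eq_ballOsc hr hu₂
  have hle : ∫ w, fieldAction r z₂ φ w ≤ ∫ w, fieldAction r z₁ φ w := by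
    refine integral_mono_ae
      (integrable_fieldAction hz₂.1 (hp₂.mono fun _ k => k.1) hφ hc)
      (integrable_fieldAction hz₁.1 (hp₁.mono fun _ k => k.1) hφ hc) ?_
    filter_upwards [hp₁, hp₂] with w h₁ h₂
    have k₁ := fieldAction_comp hr.le z₁ hu₁ h₁.1 h₁.2 hψ hm hm'
    have k₂ := fieldAction_comp hr.le z₂ hu₂ h₂.1 h₂.2 hψ hm hm'
    rw [hφdef, fieldAction_sub z₂ (ha.max hb) hb, k₂, ← hφdef, hφ',
      fieldAction_sub z₁ ha (ha.min hb), k₁]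
    have l₁ := fieldAction_le hr.le z₁ (ha.min hb) h₁.1
    have l₂ := fieldAction_le hr.le z₂ (ha.max hb) h₂.1
    linarith [ballOsc_min_add_ballOsc_max_le hr.le ha hb w]
  have q₁ := he₁.integral_fieldAction hu₁ hg₁ hφ hc
  have q₂ := he₂.integral_fieldAction hu₂ hg₂ hφ hc
  have hpos : 0 < h * (1 / (2 * r)) := by positivity
  have hint : ∀ f : Space N → ℝ, Continuous f → Integrable fun w => φ w * f w := fun f hf =>
    (hφ.mul hf).integrable_of_hasCompactSupport hc.mul_right
  have key : ∫ w, φ w * (u₁ w - u₂ w) ≤ 0 := by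
    have e : ∫ w, φ w * (u₁ w - u₂ w) = (∫ w, φ w * (g₁ w - g₂ w)) -
        ((∫ w, φ w * (g₁ w - u₁ w)) - ∫ w, φ w * (g₂ w - u₂ w)) := by
      have i₁ := hint (fun w => g₁ w - u₁ w) (hg₁.sub hu₁)
      have i₂ := hint (fun w => g₂ w - u₂ w) (hg₂.sub hu₂)
      have i₃ := hint (fun w => g₁ w - g₂ w) (hg₁.sub hg₂)
      have i₄ : Integrable fun w => φ w * (g₁ w - u₁ w) - φ w * (g₂ w - u₂ w) := i₁.sub i₂
      rw [← integral_sub i₁ i₂, ← integral_sub i₃ i₄]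
      congr 1 with w
      ring
    have hneg : ∫ w, φ w * (g₁ w - g₂ w) ≤ 0 :=
      integral_nonpos fun w => mul_nonpos_of_nonneg_of_nonpos (hφ0 w) (sub_nonpos.2 (hg w))
    rw [e, ← q₁, ← q₂]
    nlinarith
  by_contra hlt
  rw [not_le] at hlt
  have hnn : ∀ w, 0 ≤ φ w * (u₁ w - u₂ w) := by
    intro w
    rcases le_or_gt (u₂ w) (u₁ w) with k | k
    · exact mul_nonneg (hφ0 w) (sub_nonneg.2 k)
    · have : φ w = 0 := by
        simp only [hφdef]
        rw [max_eq_right (hm k.le), sub_self]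
      simp [this]
  have hw : φ w * (u₁ w - u₂ w) ≠ 0 := by
    refine mul_ne_zero ?_ ?_
    · simp only [hφdef]
      rw [max_eq_left hlt.le]
      exact (sub_pos.2 hlt).ne'
    · intro k
      rw [sub_eq_zero.1 k] at hlt
      exact lt_irrefl _ hlt
  exact absurd key (not_le.2 (Continuous.integral_pos_of_hasCompactSupport_nonneg_nonzero
    (hφ.mul (hu₁.sub hu₂)) hc.mul_right hnn hw))

theorem hasCompactSupport_of_eventually_cocompact {f : Space N → ℝ}
    (hf : ∀ᶠ x in cocompact (Space N), f x = 0) : HasCompactSupport f :=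
  hasCompactSupport_iff_eventuallyEq.2 (by rwa [coclosedCompact_eq_cocompact])

theorem LipPlus.continuous {g : Space N → ℝ} (hg : g ∈ LipPlus N) : Continuous g :=
  hg.1.choose_spec.continuous

theorem LipMinus.continuous {g : Space N → ℝ} (hg : g ∈ LipMinus N) : Continuous g :=
  hg.1.choose_spec.continuous

theorem LipPlus.neg {g : Space N → ℝ} (hg : g ∈ LipPlus N) : (fun x => -g x) ∈ LipMinus N :=
  ⟨⟨_, hg.1.choose_spec.neg⟩, tendsto_neg_atTop_atBot.comp hg.2⟩

theorem LipMinus.neg {g : Space N → ℝ} (hg : g ∈ LipMinus N) : (fun x => -g x) ∈ LipPlus N :=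
  ⟨⟨_, hg.1.choose_spec.neg⟩, tendsto_neg_atBot_atTop.comp hg.2⟩

theorem monotone_min_const (T : ℝ) : Monotone fun s : ℝ => min s T :=
  fun _ _ hab => min_le_min_right T hab

theorem monotone_sub_min_const (T : ℝ) : Monotone fun s : ℝ => 1 * s - min s T := by
  intro a b hab
  dsimp only
  rcases le_total b T with k | k
  · rw [min_eq_left k, min_eq_left (hab.trans k)]
    linarith
  · rw [min_eq_right k]
    rcases le_total a T with l | l
    · rw [min_eq_left l]
      linarith
    · rw [min_eq_right l]
      linarith

theorem le_of_isSolution_of_lipPlus (hr : 0 < r) (hh : 0 < h) {g₁ g₂ u₁ u₂ : Space N → ℝ}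
    (hg₁ : Continuous g₁) (hg₂ : Continuous g₂) (hu₁ : u₁ ∈ LipPlus N) (hu₂ : u₂ ∈ LipPlus N)
    (hs₁ : IsSolution r h g₁ u₁) (hs₂ : IsSolution r h g₂ u₂) (hg : ∀ w, g₁ w ≤ g₂ w)
    (w : Space N) : u₁ w ≤ u₂ w := by
  -- Truncation at height T makes the test function vanish wherever u₂ ≥ T, that is outside a
  -- compact set, and loses nothing at the point w itself.
  set T := u₁ w
  have key := comp_le_comp_of_isSolution hr hh (LipPlus.continuous hu₁) (LipPlus.continuous hu₂)
    hg₁ hg₂ hs₁ hs₂ hg (ψ := fun s => min s T) (by fun_prop) (monotone_min_const T)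
    (monotone_sub_min_const T)
    (hasCompactSupport_of_eventually_cocompact (by
      filter_upwards [hu₂.2.eventually_ge_atTop T] with x hx
      rw [min_eq_right hx, max_eq_right (min_le_right _ _), sub_self])) w
  simpa [T] using key

/-- The reflection of a pair of points of the ball. -/
def swapPair (p : ballPair N r) : ballPair N r := ⟨p.1.swap, p.2.2, p.2.1⟩

theorem continuous_swapPair : Continuous (swapPair : ballPair N r → ballPair N r) :=
  (continuous_swap.comp continuous_subtype_val).subtype_mk _

/-- Exchanging the two points of every pair reverses the sign of the action and keeps the masses, so
the swapped field is calibrated for -u and solves the equation with datum -g. -/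
theorem isSolution_neg (hr : 0 < r) {g u : Space N → ℝ} (hu : Continuous u)
    (hs : IsSolution r h g u) : IsSolution r h (fun x => -g x) (fun x => -u x) := by
  obtain ⟨z, hz, he⟩ := hs
  have hmeas : Measurable (swapPair : ballPair N r → ballPair N r) :=
    continuous_swapPair.measurable
  let z' : Space N → FiniteMeasure (ballPair N r) := fun w => (z w).map swapPair
  have hint : ∀ (w : Space N) (f : ballPair N r → ℝ), Continuous f →
      ∫ p, f p ∂(z' w : Measure (ballPair N r)) =
        ∫ p, f (swapPair p) ∂(z w : Measure (ballPair N r)) := by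
    intro w f hf
    change ∫ p, f p ∂((z w : Measure (ballPair N r)).map swapPair) = _
    exact integral_map hmeas.aemeasurable hf.aestronglyMeasurable
  have hmass : ∀ w, (z' w).mass = (z w).mass := by
    intro w
    exact (z w).map_apply hmeas MeasurableSet.univ
  have hact : ∀ φ : Space N → ℝ, Continuous φ → ∀ w,
      fieldAction r z' φ w = -fieldAction r z φ w := by
    intro φ hφ w
    rw [fieldAction_eq, hint w _ (continuous_pairDiff_right hφ w), fieldAction_eq, ← integral_neg]
    congr 1 with p
    simp [pairDiff, swapPair]
  have hactneg : ∀ φ : Space N → ℝ, ∀ w,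
      fieldAction r z (fun x => -φ x) w = -fieldAction r z φ w := by
    intro φ w
    simpa using fieldAction_const_mul z φ (-1) w
  refine ⟨z', ⟨⟨fun f => ?_, ?_⟩, ?_⟩, fun φ hφ hc => ?_⟩
  · simp only [hint _ _ (map_continuous f)]
    exact hz.1.1 (f.comp ⟨swapPair, continuous_swapPair⟩)
  · simp only [hmass]
    exact hz.1.2
  · filter_upwards [hz.fieldAction_eq_ballOsc hr hu] with w hw
    have hun : Continuous fun x => -u x := hu.neg
    rw [hmass, hact _ hun, hactneg, neg_neg, hw.2, essOsc_ball_eq hr hun, ballOsc_neg]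
    exact ⟨hw.1, rfl⟩
  · have := he φ hφ hc
    simp only [nonlocalDiv, hact φ hφ, mul_neg, integral_neg] at this ⊢
    linarith

theorem le_of_isSolution_of_lipMinus (hr : 0 < r) (hh : 0 < h) {g₁ g₂ u₁ u₂ : Space N → ℝ}
    (hg₁ : Continuous g₁) (hg₂ : Continuous g₂) (hu₁ : u₁ ∈ LipMinus N) (hu₂ : u₂ ∈ LipMinus N)
    (hs₁ : IsSolution r h g₁ u₁) (hs₂ : IsSolution r h g₂ u₂) (hg : ∀ w, g₁ w ≤ g₂ w)
    (w : Space N) : u₁ w ≤ u₂ w :=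
  neg_le_neg_iff.1 (le_of_isSolution_of_lipPlus hr hh hg₂.neg hg₁.neg (LipMinus.neg hu₂)
    (LipMinus.neg hu₁) (isSolution_neg hr (LipMinus.continuous hu₂) hs₂)
    (isSolution_neg hr (LipMinus.continuous hu₁) hs₁) (fun w => neg_le_neg (hg w)) w)

/-- No truncation is needed: near infinity u₁ ≤ 0 ≤ u₂, so (u₁ - u₂)⁺ already has compact support.
-/
theorem le_of_isSolution_of_lipMinus_of_lipPlus (hr : 0 < r) (hh : 0 < h)
    {g₁ g₂ u₁ u₂ : Space N → ℝ}
    (hg₁ : Continuous g₁) (hg₂ : Continuous g₂) (hu₁ : u₁ ∈ LipMinus N) (hu₂ : u₂ ∈ LipPlus N)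
    (hs₁ : IsSolution r h g₁ u₁) (hs₂ : IsSolution r h g₂ u₂) (hg : ∀ w, g₁ w ≤ g₂ w)
    (w : Space N) : u₁ w ≤ u₂ w :=
  comp_le_comp_of_isSolution hr hh (LipMinus.continuous hu₁) (LipPlus.continuous hu₂)
    hg₁ hg₂ hs₁ hs₂ hg (ψ := fun s => s) continuous_id monotone_id
    (fun a b _ => by simp)
    (hasCompactSupport_of_eventually_cocompact (by
      filter_upwards [hu₂.2.eventually_ge_atTop 0, hu₁.2.eventually_le_atBot 0] with x hx hx'
      rw [max_eq_right (hx'.trans hx), sub_self])) w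

/-- The hypotheses contradict each other unless the space is compact, that is of dimension zero.
There every condition at infinity is vacuous and `LipPlus` and `LipMinus` coincide. -/
theorem cocompact_eq_bot_of_lipPlus_le_lipMinus {g₁ g₂ : Space N → ℝ} (hg₁ : g₁ ∈ LipPlus N)
    (hg₂ : g₂ ∈ LipMinus N) (hg : ∀ w, g₁ w ≤ g₂ w) : cocompact (Space N) = ⊥ := by
  by_contra hne
  have : (cocompact (Space N)).NeBot := ⟨hne⟩
  obtain ⟨x, hx, hx'⟩ :=
    ((hg₁.2.eventually_gt_atTop 0).and (hg₂.2.eventually_lt_atBot 0)).exists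
  linarith [hg x]

/-- Comparison principle for the Euler-Lagrange system. -/
theorem le_of_isSolution (hr : 0 < r) (hh : 0 < h) {g₁ g₂ u₁ u₂ : Space N → ℝ}
    (h₁ : (g₁ ∈ LipPlus N ∧ u₁ ∈ LipPlus N) ∨ (g₁ ∈ LipMinus N ∧ u₁ ∈ LipMinus N))
    (h₂ : (g₂ ∈ LipPlus N ∧ u₂ ∈ LipPlus N) ∨ (g₂ ∈ LipMinus N ∧ u₂ ∈ LipMinus N))
    (hs₁ : IsSolution r h g₁ u₁) (hs₂ : IsSolution r h g₂ u₂) (hg : ∀ w, g₁ w ≤ g₂ w)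
    (w : Space N) : u₁ w ≤ u₂ w := by
  rcases h₁ with ⟨hg₁, hu₁⟩ | ⟨hg₁, hu₁⟩ <;> rcases h₂ with ⟨hg₂, hu₂⟩ | ⟨hg₂, hu₂⟩
  · exact le_of_isSolution_of_lipPlus hr hh (LipPlus.continuous hg₁) (LipPlus.continuous hg₂)
      hu₁ hu₂ hs₁ hs₂ hg w
  · have hbot := cocompact_eq_bot_of_lipPlus_le_lipMinus hg₁ hg₂ hg
    have hu₂' : u₂ ∈ LipPlus N := ⟨hu₂.1, by rw [hbot]; exact tendsto_bot⟩
    exact le_of_isSolution_of_lipPlus hr hh (LipPlus.continuous hg₁) (LipMinus.continuous hg₂)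
      hu₁ hu₂' hs₁ hs₂ hg w
  · exact le_of_isSolution_of_lipMinus_of_lipPlus hr hh (LipMinus.continuous hg₁)
      (LipPlus.continuous hg₂) hu₁ hu₂ hs₁ hs₂ hg w
  · exact le_of_isSolution_of_lipMinus hr hh (LipMinus.continuous hg₁) (LipMinus.continuous hg₂)
      hu₁ hu₂ hs₁ hs₂ hg w

end NonlocalROF

end

/-! ### Nonlocal perimeter, interfaces and good representatives. -/

noncomputable section

namespace NonlocalROF

open Metric Set

variable {N : ℕ} {r h : ℝ}

/-- The centres of the balls of radius `r` that meet both `G` and its complement in positive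
measure. -/
def interfaceSet (r : ℝ) (G : Set (Space N)) : Set (Space N) :=
  {w | volume (ball w r ∩ G) ≠ 0 ∧ volume (ball w r ∩ Gᶜ) ≠ 0}

/-- An open set has positive mass exactly when it meets the support. This presents the interface as
an intersection of two open thickenings, hence as an open, measurable set for arbitrary G. -/
theorem measure_ball_inter_ne_zero_iff (G : Set (Space N)) (w : Space N) :
    volume (ball w r ∩ G) ≠ 0 ↔ w ∈ thickening r (volume.restrict G).support := by
  rw [← Measure.restrict_apply measurableSet_ball, mem_thickening_iff]
  constructor
  · intro hw
    obtain ⟨x, hx, hx'⟩ := Measure.nonempty_inter_support_of_pos (pos_iff_ne_zero.2 hw)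
    exact ⟨x, hx', by rwa [dist_comm]⟩
  · rintro ⟨x, hx, hd⟩
    exact ((Measure.mem_support_iff_forall x).1 hx _
      (isOpen_ball.mem_nhds (by rwa [mem_ball, dist_comm]))).ne'

theorem isOpen_interfaceSet (G : Set (Space N)) : IsOpen (interfaceSet r G) := by
  have : interfaceSet r G = thickening r (volume.restrict G).support ∩
      thickening r (volume.restrict Gᶜ).support := by
    ext w
    rw [mem_inter_iff, ← measure_ball_inter_ne_zero_iff, ← measure_ball_inter_ne_zero_iff]
    rfl
  rw [this]
  exact isOpen_thickening.inter isOpen_thickening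

theorem restrict_ball_ne_zero (hr : 0 < r) (w : Space N) :
    (volume.restrict (ball w r) : Measure (Space N)) ≠ 0 := by
  rw [Ne, Measure.restrict_eq_zero]
  exact (measure_ball_pos volume w hr).ne'

theorem ae_restrict_ball_iff {G : Set (Space N)} {w : Space N} :
    (∀ᵐ x ∂(volume.restrict (ball w r)), x ∉ G) ↔ volume (ball w r ∩ G) = 0 := by
  rw [ae_restrict_iff' measurableSet_ball, ae_iff]
  congr! 3
  ext x
  simp

theorem essOsc_indicator_toENNReal (hr : 0 < r) (G : Set (Space N)) (w : Space N) :
    (essOsc (ball w r) (G.indicator fun _ => (1 : ℝ))).toENNReal =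
      (interfaceSet r G).indicator (fun _ => 1) w := by
  classical
  have hne := restrict_ball_ne_zero hr w
  have hconst : ∀ c : ℝ, (fun x => ((G.indicator (fun _ => (1 : ℝ)) x : ℝ) : EReal))
      =ᵐ[volume.restrict (ball w r)] (fun _ => (c : EReal)) →
      (essOsc (ball w r) (G.indicator fun _ => (1 : ℝ))).toENNReal = 0 := by
    intro c hc
    rw [essOsc, essSup_congr_ae hc, essInf_congr_ae hc, essSup_const _ hne, essInf_const _ hne,
      ← EReal.coe_sub, sub_self]
    simp
  by_cases h1 : volume (ball w r ∩ G) = 0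
  · rw [indicator_of_notMem (fun k => k.1 h1)]
    refine hconst 0 ?_
    filter_upwards [ae_restrict_ball_iff.2 h1] with x hx
    rw [indicator_of_notMem hx]
  by_cases h2 : volume (ball w r ∩ Gᶜ) = 0
  · rw [indicator_of_notMem (fun k => k.2 h2)]
    refine hconst 1 ?_
    filter_upwards [ae_restrict_ball_iff.2 h2] with x hx
    rw [indicator_of_mem (not_not.1 hx)]
  rw [indicator_of_mem (show w ∈ interfaceSet r G from ⟨h1, h2⟩)]
  have hle : ∀ x, G.indicator (fun _ => (1 : ℝ)) x ≤ 1 := fun x =>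
    indicator_le_self' (fun _ _ => zero_le_one) x
  have hge : ∀ x, 0 ≤ G.indicator (fun _ => (1 : ℝ)) x := fun x =>
    indicator_nonneg (fun _ _ => zero_le_one) x
  have hsup : essSup (fun x => ((G.indicator (fun _ => (1 : ℝ)) x : ℝ) : EReal))
      (volume.restrict (ball w r)) = 1 := by
    refine le_antisymm (essSup_le_of_ae_le _ (Eventually.of_forall fun x => ?_)) ?_
    · exact EReal.coe_le_coe_iff.2 (hle x)
    · by_contra hlt
      rw [not_le] at hlt
      refine h1 (ae_restrict_ball_iff.1 ?_)
      filter_upwards [ae_lt_of_essSup_lt hlt] with x hx hxG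
      rw [indicator_of_mem hxG] at hx
      exact lt_irrefl _ hx
  have hinf : essInf (fun x => ((G.indicator (fun _ => (1 : ℝ)) x : ℝ) : EReal))
      (volume.restrict (ball w r)) = 0 := by
    refine le_antisymm ?_ (le_essInf_of_ae_le _ (Eventually.of_forall fun x => ?_))
    · by_contra hlt
      rw [not_le] at hlt
      refine h2 (ae_restrict_ball_iff.1 ?_)
      filter_upwards [ae_lt_of_lt_essInf hlt] with x hx hxG
      rw [indicator_of_notMem hxG] at hx
      exact lt_irrefl _ hx
    · exact EReal.coe_le_coe_iff.2 (hge x)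
  rw [essOsc, hsup, hinf, sub_zero]
  exact EReal.toENNReal_coe (x := 1)

theorem nonlocalPer_eq (hr : 0 < r) (G : Set (Space N)) :
    nonlocalPer r G = ENNReal.ofReal (1 / (2 * r)) * volume (interfaceSet r G) := by
  rw [nonlocalPer, nonlocalTV]
  simp only [essOsc_indicator_toENNReal hr]
  rw [lintegral_indicator_const (isOpen_interfaceSet G).measurableSet, one_mul]

/-- A measurable set that coincides almost everywhere with `G` and contains no point of a ball that
`G` misses up to a null set, and all points of a ball that `G` contains up to a null set. -/
theorem exists_good_representative {G : Set (Space N)} (hG : NullMeasurableSet G volume) (r : ℝ) :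
    ∃ G' : Set (Space N), MeasurableSet G' ∧ G' =ᵐ[volume] G ∧
      (∀ w, volume (ball w r ∩ G) = 0 → ∀ x ∈ ball w r, x ∉ G') ∧
      ∀ w, volume (ball w r ∩ Gᶜ) = 0 → ∀ x ∈ ball w r, x ∈ G' := by
  obtain ⟨G₀, -, hG₀, hae⟩ := hG.exists_measurable_superset_ae_eq
  set K₁ := (volume.restrict G).support
  set K₂ := (volume.restrict Gᶜ).support
  -- A point outside both supports would have an open neighbourhood that is null in G and in its
  -- complement, hence null.
  have hK : ∀ x, x ∈ K₁ ∨ x ∈ K₂ := by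
    intro x
    by_contra hx
    push Not at hx
    obtain ⟨U, hU, hU'⟩ := Measure.notMem_support_iff_exists.1 hx.1
    obtain ⟨V, hV, hV'⟩ := Measure.notMem_support_iff_exists.1 hx.2
    obtain ⟨O, hO, hOo, hxO⟩ := _root_.mem_nhds_iff.1 (inter_mem hU hV)
    have h1 : volume (O ∩ G) = 0 := by
      rw [← Measure.restrict_apply hOo.measurableSet]
      exact measure_mono_null (hO.trans inter_subset_left) hU'
    have h2 : volume (O ∩ Gᶜ) = 0 := by
      rw [← Measure.restrict_apply hOo.measurableSet]
      exact measure_mono_null (hO.trans inter_subset_right) hV'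
    refine (hOo.measure_pos volume ⟨x, hxO⟩).ne' (measure_mono_null ?_ (measure_union_null h1 h2))
    intro y hy
    by_cases hyG : y ∈ G
    · exact Or.inl ⟨hy, hyG⟩
    · exact Or.inr ⟨hy, hyG⟩
  have hball : ∀ (F : Set (Space N)) (w : Space N), volume (ball w r ∩ F) = 0 →
      ∀ x ∈ ball w r, x ∉ (volume.restrict F).support := by
    intro F w hw x hx
    refine Measure.notMem_support_iff_exists.2 ⟨_, isOpen_ball.mem_nhds hx, ?_⟩
    rwa [Measure.restrict_apply measurableSet_ball]
  have h1 : ∀ᵐ x : Space N, x ∈ G → x ∈ K₁ := by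
    have := Measure.measure_compl_support (μ := (volume : Measure (Space N)).restrict G)
    rw [Measure.restrict_apply Measure.isClosed_support.measurableSet.compl] at this
    rw [ae_iff]
    refine measure_mono_null (fun x hx => ?_) this
    simpa [and_comm] using hx
  have h2 : ∀ᵐ x : Space N, x ∉ G → x ∈ K₂ := by
    have := Measure.measure_compl_support (μ := (volume : Measure (Space N)).restrict Gᶜ)
    rw [Measure.restrict_apply Measure.isClosed_support.measurableSet.compl] at this
    rw [ae_iff]
    refine measure_mono_null (fun x hx => ?_) this
    simpa [and_comm] using hx
  -- Points with a neighbourhood that G misses up to a null set are removed, and points with a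
  -- neighbourhood almost contained in G are added.
  refine ⟨(G₀ ∩ K₁) ∪ K₂ᶜ, (hG₀.inter Measure.isClosed_support.measurableSet).union
    Measure.isClosed_support.measurableSet.compl, ?_, ?_, ?_⟩
  · rw [eventuallyEq_set]
    filter_upwards [h1, h2, hae.mem_iff] with x k1 k2 k3
    simp only [mem_union, mem_inter_iff, mem_compl_iff, k3]
    tauto
  · intro w hw x hx
    have k1 := hball G w hw x hx
    rintro (k | k)
    · exact k1 k.2
    · exact (hK x).elim k1 k
  · intro w hw x hx
    exact Or.inr (hball Gᶜ w hw x hx)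

/-- Finite volume forces the part of S outside a large ball to have less volume than one ball of
radius r, so no r-ball contained in S can lie that far out. -/
theorem exists_subset_closedBall_of_measure_lt_top (hr : 0 < r) {K S : Set (Space N)}
    (hKS : ∀ x ∈ K, ball x r ⊆ S) (hS : MeasurableSet S) (hfin : volume S ≠ ∞) :
    ∃ R, K ⊆ closedBall 0 R := by
  have hlim : Tendsto (fun n : ℕ => volume (S \ closedBall (0 : Space N) n)) atTop (𝓝 0) := by
    have := tendsto_measure_iInter_atTop (μ := (volume : Measure (Space N)))
      (s := fun n : ℕ => S \ closedBall (0 : Space N) n)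
      (fun n => (hS.diff measurableSet_closedBall).nullMeasurableSet)
      (fun m n hmn => sdiff_subset_sdiff_right (closedBall_subset_closedBall (by exact_mod_cast hmn)))
      ⟨0, measure_ne_top_of_subset sdiff_subset hfin⟩
    have he : ⋂ n : ℕ, S \ closedBall (0 : Space N) n = ∅ := by
      refine eq_empty_of_forall_notMem fun x hx => ?_
      obtain ⟨n, hn⟩ := exists_nat_ge (dist x 0)
      exact (mem_iInter.1 hx n).2 hn
    rwa [he, measure_empty] at this
  have hpos : 0 < volume (ball (0 : Space N) r) := measure_ball_pos _ _ hr
  obtain ⟨n, hn⟩ := (hlim.eventually (gt_mem_nhds hpos)).exists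
  refine ⟨n + r, fun x hx => ?_⟩
  by_contra hxn
  refine absurd hn (not_lt.2 ?_)
  rw [← Measure.addHaar_ball_center volume x r]
  refine measure_mono fun y hy => ⟨hKS x hx hy, fun hy' => hxn ?_⟩
  rw [mem_closedBall] at *
  rw [mem_ball] at hy
  linarith [dist_triangle_left x 0 y]

/-- A ball centred at w that contains a point of the representative is not almost disjoint from G.
So w is on the interface, or the ball is almost contained in G and w belongs to the representative.
Hence the r-ball at each point of the representative lies in a set of finite volume. -/
theorem exists_good_representative_bounded (hr : 0 < r) {G : Set (Space N)}
    (hG : NullMeasurableSet G volume) (hfin : volume G ≠ ∞)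
    (hfin' : volume (interfaceSet r G) ≠ ∞) :
    ∃ G' : Set (Space N), MeasurableSet G' ∧ G' =ᵐ[volume] G ∧
      (∀ w ∉ interfaceSet r G, (∀ x ∈ ball w r, x ∉ G') ∨ ∀ x ∈ ball w r, x ∈ G') ∧
      ∃ R, G' ⊆ closedBall 0 R := by
  obtain ⟨G', hm, hae, h1, h2⟩ := exists_good_representative hG r
  refine ⟨G', hm, hae, fun w hw => ?_, ?_⟩
  · by_cases hw1 : volume (ball w r ∩ G) = 0
    · exact Or.inl (h1 w hw1)
    · exact Or.inr (h2 w (not_not.1 fun k => hw ⟨hw1, k⟩))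
  · refine exists_subset_closedBall_of_measure_lt_top hr (S := interfaceSet r G ∪ G')
      (fun x hx w hw => ?_) ((isOpen_interfaceSet G).measurableSet.union hm) ?_
    · have hxw : x ∈ ball w r := mem_ball_comm.1 hw
      by_cases hw1 : volume (ball w r ∩ G) = 0
      · exact absurd hx (h1 w hw1 x hxw)
      · by_cases hw2 : volume (ball w r ∩ Gᶜ) = 0
        · exact Or.inr (h2 w hw2 w (mem_ball_self hr))
        · exact Or.inl ⟨hw1, hw2⟩
    · refine (measure_union_lt_top hfin'.lt_top ?_).ne
      rw [measure_congr hae]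
      exact hfin.lt_top

end NonlocalROF

end

/-! ### Calibration inequality for bounded sets, by mollification. -/

noncomputable section

namespace NonlocalROF

open Metric Set ContinuousLinearMap
open scoped Convolution

variable {N : ℕ} {r h : ℝ}

theorem locallyIntegrable_indicator_one {G : Set (Space N)} (hG : MeasurableSet G) :
    LocallyIntegrable (G.indicator fun _ => (1 : ℝ)) volume :=
  (locallyIntegrable_const (1 : ℝ)).indicator hG

/-- The oscillation of a mollified characteristic function is controlled by the mollification of the
characteristic function of the interface. -/
theorem convolution_indicator_sub_le {b : Space N → ℝ} (hb : Continuous b)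
    (hbc : HasCompactSupport b) (hb0 : ∀ x, 0 ≤ b x) (hr : 0 < r) {G W : Set (Space N)}
    (hG : MeasurableSet G) (hW : MeasurableSet W)
    (hGW : ∀ w ∉ W, (∀ x ∈ ball w r, x ∉ G) ∨ ∀ x ∈ ball w r, x ∈ G) {w x y : Space N}
    (hx : x ∈ closedBall w r) (hy : y ∈ closedBall w r) :
    (b ⋆[lsmul ℝ ℝ, volume] G.indicator fun _ => (1 : ℝ)) x -
      (b ⋆[lsmul ℝ ℝ, volume] G.indicator fun _ => (1 : ℝ)) y ≤
      (b ⋆[lsmul ℝ ℝ, volume] W.indicator fun _ => (1 : ℝ)) w := by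
  set φ := b ⋆[lsmul ℝ ℝ, volume] G.indicator fun _ => (1 : ℝ)
  have hφ : Continuous φ :=
    hbc.continuous_convolution_left _ hb (locallyIntegrable_indicator_one hG)
  have hex := fun (F : Set (Space N)) (hF : MeasurableSet F) =>
    hbc.convolutionExists_left (lsmul ℝ ℝ) hb (locallyIntegrable_indicator_one hF)
  -- Compare under the integral sign at shift t: the two values of the characteristic function
  -- differ by at most one, and agree when the shifted centre w - t is outside W.
  have key : ∀ x ∈ ball w r, ∀ y ∈ ball w r,
      φ x - φ y ≤ (b ⋆[lsmul ℝ ℝ, volume] W.indicator fun _ => (1 : ℝ)) w := by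
    intro x hx y hy
    simp only [φ, convolution_def]
    rw [← integral_sub (hex G hG x) (hex G hG y)]
    refine integral_mono ((hex G hG x).sub (hex G hG y)) (hex W hW w) fun t => ?_
    simp only [lsmul_apply, smul_eq_mul, ← mul_sub]
    refine mul_le_mul_of_nonneg_left ?_ (hb0 t)
    have hx' : x - t ∈ ball (w - t) r := by simpa [mem_ball, dist_eq_norm] using hx
    have hy' : y - t ∈ ball (w - t) r := by simpa [mem_ball, dist_eq_norm] using hy
    have h0 : ∀ z : Space N, 0 ≤ G.indicator (fun _ => (1 : ℝ)) z := fun z =>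
      indicator_nonneg (fun _ _ => zero_le_one) z
    have h1 : ∀ z : Space N, G.indicator (fun _ => (1 : ℝ)) z ≤ 1 := fun z =>
      indicator_le_self' (fun _ _ => zero_le_one) z
    by_cases hw : w - t ∈ W
    · rw [indicator_of_mem hw]
      linarith [h0 (y - t), h1 (x - t)]
    · rw [indicator_of_notMem hw]
      rcases hGW _ hw with k | k
      · rw [indicator_of_notMem (k _ hx'), indicator_of_notMem (k _ hy'), sub_self]
      · rw [indicator_of_mem (k _ hx'), indicator_of_mem (k _ hy'), sub_self]
  -- The hypothesis on W concerns open balls; continuity of the mollification carries the bound to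
  -- the closed ball, one variable at a time.
  have key' : ∀ x ∈ closedBall w r, ∀ y ∈ ball w r,
      φ x - φ y ≤ (b ⋆[lsmul ℝ ℝ, volume] W.indicator fun _ => (1 : ℝ)) w := by
    intro x hx y hy
    rw [← closure_ball w hr.ne'] at hx
    exact closure_minimal (fun x hx => key x hx y hy)
      (isClosed_le (hφ.sub continuous_const) continuous_const) hx
  rw [← closure_ball w hr.ne'] at hy
  exact closure_minimal (fun y hy => key' x hx y hy)
    (isClosed_le (continuous_const.sub hφ) continuous_const) hy

/-- Test the equation with the mollified characteristic function of G. The action is bounded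
pointwise by the mollified characteristic function of W, whose integral is the volume of W since the
mollifier has mass one. -/
theorem integral_convolution_mul_le (hr : 0 < r) (hh : 0 < h) {g u : Space N → ℝ}
    (hu : Continuous u) (hg : Continuous g) {z : Space N → FiniteMeasure (ballPair N r)}
    (hzb : IsBoundedField r z) (hm : ∀ᵐ w, (z w).mass ≤ 1) (he : SolvesEquation r h g u z)
    {b : Space N → ℝ} (hb : Continuous b)
    (hbc : HasCompactSupport b) (hb0 : ∀ x, 0 ≤ b x) (hb1 : ∫ x, b x = 1) {G W : Set (Space N)}
    (hG : MeasurableSet G) {R : ℝ} (hR : G ⊆ closedBall 0 R) (hW : MeasurableSet W)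
    (hWfin : volume W ≠ ∞)
    (hGW : ∀ w ∉ W, (∀ x ∈ ball w r, x ∉ G) ∨ ∀ x ∈ ball w r, x ∈ G) :
    ∫ x, (b ⋆[lsmul ℝ ℝ, volume] G.indicator fun _ => (1 : ℝ)) x * (u x - g x) ≤
      h * (1 / (2 * r)) * volume.real W := by
  set φ := b ⋆[lsmul ℝ ℝ, volume] G.indicator fun _ => (1 : ℝ)
  have hφ : Continuous φ :=
    hbc.continuous_convolution_left _ hb (locallyIntegrable_indicator_one hG)
  have hφc : HasCompactSupport φ := hbc.convolution _ (HasCompactSupport.intro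
    (isCompact_closedBall 0 R) fun x hx => indicator_of_notMem (fun k => hx (hR k)) _)
  have hWi : Integrable (W.indicator fun _ => (1 : ℝ)) volume :=
    (integrable_indicator_iff hW).2 (integrableOn_const hWfin)
  have hbi : Integrable b volume := hb.integrable_of_hasCompactSupport hbc
  have h1 := he.integral_fieldAction hu hg hφ hφc
  have h2 : ∫ x, φ x * (u x - g x) = -(h * (1 / (2 * r)) * ∫ w, fieldAction r z φ w) := by
    rw [h1, ← integral_neg]
    congr 1 with x
    ring
  rw [h2, ← mul_neg]
  refine mul_le_mul_of_nonneg_left ?_ (by positivity)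
  have h3 : ∫ w, (b ⋆[lsmul ℝ ℝ, volume] W.indicator fun _ => (1 : ℝ)) w = volume.real W := by
    rw [integral_convolution _ hbi hWi, hb1, integral_indicator hW]
    simp [Measure.real]
  rw [← h3, ← integral_neg]
  refine integral_mono_ae (integrable_fieldAction hzb hm hφ hφc).neg
    (hbi.integrable_convolution _ hWi) ?_
  filter_upwards [hm] with w hw
  refine (neg_le_abs _).trans (abs_fieldAction_le z hw ?_ fun p => ?_)
  · exact integral_nonneg fun t => mul_nonneg (hb0 t) (indicator_nonneg (fun _ _ => zero_le_one) _)
  · refine abs_le.2 ⟨?_, ?_⟩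
    · have := convolution_indicator_sub_le hb hbc hb0 hr hG hW hGW (snd_mem w p) (fst_mem w p)
      unfold pairDiff
      linarith
    · exact convolution_indicator_sub_le hb hbc hb0 hr hG hW hGW (fst_mem w p) (snd_mem w p)

/-- A characteristic function is not an admissible test function, so the bound is taken for
mollifications and passed to the limit by Lebesgue differentiation and dominated convergence. With W
the interface of G, the right side is h times the perimeter. -/
theorem setIntegral_sub_le (hr : 0 < r) (hh : 0 < h) {g u : Space N → ℝ}
    (hu : Continuous u) (hg : Continuous g) {z : Space N → FiniteMeasure (ballPair N r)}
    (hzb : IsBoundedField r z) (hm : ∀ᵐ w, (z w).mass ≤ 1) (he : SolvesEquation r h g u z)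
    {G W : Set (Space N)} (hG : MeasurableSet G) {R : ℝ} (hR : G ⊆ closedBall 0 R)
    (hW : MeasurableSet W) (hWfin : volume W ≠ ∞)
    (hGW : ∀ w ∉ W, (∀ x ∈ ball w r, x ∉ G) ∨ ∀ x ∈ ball w r, x ∈ G) :
    ∫ x in G, (u x - g x) ≤ h * (1 / (2 * r)) * volume.real W := by
  -- The outer radius is twice the inner one, so the quotient of the radii stays bounded, as the
  -- differentiation theorem requires (K = 2).
  let b : ℕ → ContDiffBump (0 : Space N) := fun n =>
    ⟨1 / (2 * ((n : ℝ) + 1)), 1 / ((n : ℝ) + 1), by positivity,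
      one_div_lt_one_div_of_lt (by positivity) (by linarith [(Nat.cast_nonneg n : (0 : ℝ) ≤ n)])⟩
  have hb1 : ∀ n, (b n).rOut ≤ 1 := fun n => by
    change 1 / ((n : ℝ) + 1) ≤ 1
    rw [div_le_one (by positivity)]
    linarith [(Nat.cast_nonneg n : (0 : ℝ) ≤ n)]
  have hbc : ∀ n, HasCompactSupport ((b n).normed volume) := fun n => (b n).hasCompactSupport_normed
  have hbcont : ∀ n, Continuous ((b n).normed volume) := fun n => (b n).continuous_normed
  have hloc := locallyIntegrable_indicator_one hG
  have hlim := ContDiffBump.ae_convolution_tendsto_right_of_locallyIntegrable (φ := b) (K := 2)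
    (l := atTop) (μ := volume) tendsto_one_div_add_atTop_nhds_zero_nat
    (Eventually.of_forall fun n => by
      change 1 / ((n : ℝ) + 1) ≤ 2 * (1 / (2 * ((n : ℝ) + 1)))
      field_simp
      exact le_rfl) hloc
  set χ : Space N → ℝ := G.indicator fun _ => (1 : ℝ)
  have hχ0 : ∀ x, 0 ≤ χ x := fun x => indicator_nonneg (fun _ _ => zero_le_one) x
  have hχ1 : ∀ x, χ x ≤ 1 := fun x => indicator_le_self' (fun _ _ => zero_le_one) x
  have hφ0 : ∀ n x, 0 ≤ ((b n).normed volume ⋆[lsmul ℝ ℝ, volume] χ) x := fun n x =>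
    integral_nonneg fun t => mul_nonneg ((b n).nonneg_normed t) (hχ0 _)
  have hφ1 : ∀ n x, ((b n).normed volume ⋆[lsmul ℝ ℝ, volume] χ) x ≤ 1 := fun n x => by
    rw [← (b n).integral_normed (μ := volume)]
    refine integral_mono ((hbc n).convolutionExists_left (lsmul ℝ ℝ) (hbcont n) hloc x)
      ((hbcont n).integrable_of_hasCompactSupport (hbc n)) fun t => ?_
    exact mul_le_of_le_one_right ((b n).nonneg_normed t) (hχ1 _)
  have hsupp : ∀ n, ∀ x ∉ closedBall (0 : Space N) (R + 1),
      ((b n).normed volume ⋆[lsmul ℝ ℝ, volume] χ) x = 0 := by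
    intro n x hx
    rw [convolution_def]
    refine integral_eq_zero_of_ae (Eventually.of_forall fun t => ?_)
    simp only [lsmul_apply, smul_eq_mul, Pi.zero_apply, mul_eq_zero]
    by_contra hne
    push Not at hne
    have ht : t ∈ ball (0 : Space N) (b n).rOut := by
      rw [← (b n).support_normed_eq (μ := volume)]
      exact hne.1
    have hxt : x - t ∈ closedBall (0 : Space N) R := hR (by
      by_contra k
      exact hne.2 (indicator_of_notMem k _))
    rw [mem_ball_zero_iff] at ht
    rw [mem_closedBall_zero_iff] at hxt hx
    refine hx ?_
    have := norm_add_le (x - t) t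
    rw [sub_add_cancel] at this
    linarith [hb1 n]
  have hf : Continuous fun x => u x - g x := hu.sub hg
  have htend : Tendsto (fun n => ∫ x, ((b n).normed volume ⋆[lsmul ℝ ℝ, volume] χ) x * (u x - g x))
      atTop (𝓝 (∫ x, χ x * (u x - g x))) := by
    refine tendsto_integral_of_dominated_convergence
      ((closedBall (0 : Space N) (R + 1)).indicator fun x => |u x - g x|) (fun n => ?_) ?_
      (fun n => Eventually.of_forall fun x => ?_) ?_
    · exact (((hbc n).continuous_convolution_left _ (hbcont n) hloc).mul hf).aestronglyMeasurable
    · rw [integrable_indicator_iff measurableSet_closedBall]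
      exact hf.abs.continuousOn.integrableOn_compact (isCompact_closedBall _ _)
    · by_cases hx : x ∈ closedBall (0 : Space N) (R + 1)
      · rw [indicator_of_mem hx, Real.norm_eq_abs, abs_mul, abs_of_nonneg (hφ0 n x)]
        exact mul_le_of_le_one_left (abs_nonneg _) (hφ1 n x)
      · rw [indicator_of_notMem hx, hsupp n x hx, zero_mul, norm_zero]
    · filter_upwards [hlim] with x hx
      exact hx.mul_const _
  have heq : ∫ x, χ x * (u x - g x) = ∫ x in G, (u x - g x) := by
    rw [← integral_indicator hG]
    congr 1 with x
    by_cases hx : x ∈ G <;> simp [χ, hx]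
  rw [heq] at htend
  refine le_of_tendsto htend (Eventually.of_forall fun n => ?_)
  exact integral_convolution_mul_le hr hh hu hg hzb hm he (hbcont n) (hbc n)
    (fun x => (b n).nonneg_normed x) (b n).integral_normed hG hR hW hWfin hGW

end NonlocalROF

end

/-! ### Perimeter of the sublevel sets of a solution. -/

noncomputable section

namespace NonlocalROF

open Metric Set

variable {N : ℕ} {r h : ℝ}

theorem LipPlus.exists_closedBall {u : Space N → ℝ} (hu : u ∈ LipPlus N) (T : ℝ) :
    ∃ R, ∀ x ∉ closedBall (0 : Space N) R, T ≤ u x := by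
  obtain ⟨K, hK, hKs⟩ := mem_cocompact.1 (hu.2.eventually_ge_atTop T)
  obtain ⟨R, hR⟩ := hK.isBounded.subset_closedBall (0 : Space N)
  exact ⟨R, fun x hx => hKs fun hxK => hx (hR hxK)⟩

/-- A lower bound for the mass of the interface of `{u ∈ I}` by approximation of the characteristic
function of `I` by Lipschitz nonincreasing functions. -/
theorem volume_interfaceSet_preimage_le (hr : 0 < r) (hh : 0 < h) {g u : Space N → ℝ}
    (hg : Continuous g) (hu : u ∈ LipPlus N) {z : Space N → FiniteMeasure (ballPair N r)}
    (hz : IsCahnHoffmanField r u z) (he : SolvesEquation r h g u z) {I : Set ℝ}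
    (hI : MeasurableSet I) {T : ℝ} {ψ : ℕ → ℝ → ℝ} (hψ : ∀ n, Continuous (ψ n))
    (hm : ∀ n, Monotone (ψ n)) (hC : ∀ n, ∃ C : ℝ, Monotone fun s => C * s - ψ n s)
    (hψ0 : ∀ n s, ψ n s ≤ 0) (hψ1 : ∀ n s, -1 ≤ ψ n s) (hT : ∀ n s, T ≤ s → ψ n s = 0)
    (hlim : ∀ s, Tendsto (fun n => ψ n s) atTop (𝓝 (I.indicator (fun _ => (-1 : ℝ)) s))) :
    0 ≤ ∫ x in u ⁻¹' I, (u x - g x) ∧ volume (interfaceSet r (u ⁻¹' I)) ≤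
      ENNReal.ofReal ((h * (1 / (2 * r)))⁻¹ * ∫ x in u ⁻¹' I, (u x - g x)) := by
  have huc := LipPlus.continuous hu
  have hE : MeasurableSet (u ⁻¹' I) := huc.measurable hI
  set c := h * (1 / (2 * r))
  have hc : 0 < c := by positivity
  obtain ⟨R, hR⟩ := LipPlus.exists_closedBall hu T
  have hcomp : ∀ n, Continuous fun x => ψ n (u x) := fun n => (hψ n).comp huc
  have hsupp : ∀ n, HasCompactSupport fun x => ψ n (u x) := fun n =>
    HasCompactSupport.intro (isCompact_closedBall 0 R) fun x hx => hT n _ (hR x hx)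
  have hact := hz.fieldAction_eq_ballOsc hr huc
  have hosc : ∀ᵐ w, ∀ n, fieldAction r z (fun x => ψ n (u x)) w =
      ballOsc r (fun x => ψ n (u x)) w := by
    filter_upwards [hact] with w hw n
    obtain ⟨C, hC⟩ := hC n
    exact fieldAction_comp hr.le z huc hw.1 hw.2 (hψ n) (hm n) hC
  have hint : ∀ n, Integrable (fieldAction r z fun x => ψ n (u x)) volume := fun n =>
    integrable_fieldAction hz.1 (hact.mono fun _ k => k.1) (hcomp n) (hsupp n)
  have hnn : ∀ n, 0 ≤ᵐ[volume] fieldAction r z fun x => ψ n (u x) := fun n => by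
    filter_upwards [hosc] with w hw
    rw [hw n]
    exact ballOsc_nonneg hr.le (hcomp n) w
  have hval : ∀ n, ∫ w, fieldAction r z (fun x => ψ n (u x)) w =
      c⁻¹ * ∫ x, ψ n (u x) * (g x - u x) := fun n => by
    rw [← he.integral_fieldAction huc hg (hcomp n) (hsupp n), inv_mul_cancel_left₀ hc.ne']
  have hf : Continuous fun x => g x - u x := hg.sub huc
  have htend : Tendsto (fun n => ∫ x, ψ n (u x) * (g x - u x)) atTop
      (𝓝 (∫ x in u ⁻¹' I, (u x - g x))) := by
    have heq : ∫ x in u ⁻¹' I, (u x - g x) =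
        ∫ x, I.indicator (fun _ => (-1 : ℝ)) (u x) * (g x - u x) := by
      rw [← integral_indicator hE]
      congr 1 with x
      by_cases hx : u x ∈ I
      · rw [indicator_of_mem (show x ∈ u ⁻¹' I from hx), indicator_of_mem hx]
        ring
      · rw [indicator_of_notMem (show x ∉ u ⁻¹' I from hx), indicator_of_notMem hx, zero_mul]
    rw [heq]
    refine tendsto_integral_of_dominated_convergence
      ((closedBall (0 : Space N) R).indicator fun x => |g x - u x|) (fun n => ?_) ?_
      (fun n => Eventually.of_forall fun x => ?_) (Eventually.of_forall fun x => ?_)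
    · exact ((hcomp n).mul hf).aestronglyMeasurable
    · rw [integrable_indicator_iff measurableSet_closedBall]
      exact hf.abs.continuousOn.integrableOn_compact (isCompact_closedBall _ _)
    · by_cases hx : x ∈ closedBall (0 : Space N) R
      · rw [indicator_of_mem hx, Real.norm_eq_abs, abs_mul]
        exact mul_le_of_le_one_left (abs_nonneg _)
          (abs_le.2 ⟨hψ1 n _, (hψ0 n _).trans zero_le_one⟩)
      · rw [indicator_of_notMem hx, hT n _ (hR x hx), zero_mul, norm_zero]
    · exact (hlim (u x)).mul_const _
  constructor
  · refine ge_of_tendsto htend (Eventually.of_forall fun n => ?_)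
    have h0 : 0 ≤ ∫ w, fieldAction r z (fun x => ψ n (u x)) w := integral_nonneg_of_ae (hnn n)
    rw [hval n] at h0
    exact nonneg_of_mul_nonneg_right h0 (inv_pos.2 hc)
  · have hlint : ∀ n, ∫⁻ w, ENNReal.ofReal (fieldAction r z (fun x => ψ n (u x)) w) =
        ENNReal.ofReal (c⁻¹ * ∫ x, ψ n (u x) * (g x - u x)) := fun n => by
      rw [← hval n, ofReal_integral_eq_lintegral_ofReal (hint n) (hnn n)]
    have hlim' : Tendsto (fun n => ENNReal.ofReal (c⁻¹ * ∫ x, ψ n (u x) * (g x - u x))) atTop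
        (𝓝 (ENNReal.ofReal (c⁻¹ * ∫ x in u ⁻¹' I, (u x - g x)))) :=
      (ENNReal.continuous_ofReal.tendsto _).comp (htend.const_mul _)
    -- The actions equal the oscillations of ψ_n(u), and their integrals converge by the equation.
    -- It remains to bound the lower limit of these oscillations below by one on the interface.
    have hfatou := lintegral_liminf_le' (u := atTop) (μ := (volume : Measure (Space N)))
      (f := fun n w => ENNReal.ofReal (fieldAction r z (fun x => ψ n (u x)) w))
      (fun n => (hint n).aestronglyMeasurable.aemeasurable.ennreal_ofReal)
    simp only [hlint] at hfatou
    rw [hlim'.liminf_eq] at hfatou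
    refine le_trans ?_ hfatou
    rw [← one_mul (volume (interfaceSet r (u ⁻¹' I))),
      ← lintegral_indicator_const (isOpen_interfaceSet _).measurableSet]
    refine lintegral_mono_ae ?_
    filter_upwards [hosc] with w hw
    by_cases hwI : w ∈ interfaceSet r (u ⁻¹' I)
    swap
    · rw [indicator_of_notMem hwI]
      exact zero_le
    rw [indicator_of_mem hwI]
    obtain ⟨x, hxw, hx⟩ := nonempty_of_measure_ne_zero hwI.1
    obtain ⟨y, hyw, hy⟩ := nonempty_of_measure_ne_zero hwI.2
    -- With u x in I and u y outside, the oscillation is at least ψ_n(u y) - ψ_n(u x), which tends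
    -- to 0 - (-1) = 1.
    have hl : Tendsto (fun n => ENNReal.ofReal (ψ n (u y) - ψ n (u x))) atTop (𝓝 1) := by
      have := (hlim (u y)).sub (hlim (u x))
      rw [indicator_of_mem (show u x ∈ I from hx), indicator_of_notMem (show u y ∉ I from hy)]
        at this
      simpa [Function.comp_def] using (ENNReal.continuous_ofReal.tendsto _).comp this
    rw [← hl.liminf_eq]
    refine liminf_le_liminf (Eventually.of_forall fun n => ENNReal.ofReal_le_ofReal ?_)
    rw [hw n]
    exact sub_le_ballOsc (hcomp n) (ball_subset_closedBall hyw) (ball_subset_closedBall hxw)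

/-- The truncation of the real line to the interval `[-1, 0]`. -/
def clampNeg (s : ℝ) : ℝ := max (-1) (min 0 s)

theorem monotone_clampNeg : Monotone clampNeg :=
  fun _ _ hst => max_le_max_left _ (min_le_min_left _ hst)

theorem clampNeg_sub_le {s t : ℝ} (hst : s ≤ t) : clampNeg t - clampNeg s ≤ t - s := by
  unfold clampNeg
  grind

/-- The approximations are ramps of slope n + 1 from -1 to 0. For the open half-line the ramp ends
at t, for the closed one it starts at t; the offset a = 0 or a = 1 decides which limit appears at s
= t. -/
theorem volume_interfaceSet_sublevel_le (hr : 0 < r) (hh : 0 < h) {g u : Space N → ℝ}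
    (hg : Continuous g) (hu : u ∈ LipPlus N) {z : Space N → FiniteMeasure (ballPair N r)}
    (hz : IsCahnHoffmanField r u z) (he : SolvesEquation r h g u z) (t : ℝ) {I : Set ℝ}
    (hI : I = Iio t ∨ I = Iic t) :
    0 ≤ ∫ x in u ⁻¹' I, (u x - g x) ∧ volume (interfaceSet r (u ⁻¹' I)) ≤
      ENNReal.ofReal ((h * (1 / (2 * r)))⁻¹ * ∫ x in u ⁻¹' I, (u x - g x)) := by
  have hlin : ∀ (a : ℝ) (n : ℕ), Monotone fun s : ℝ => ((n : ℝ) + 1) * (s - t) - a :=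
    fun a n x y hxy => by
      have : (0 : ℝ) ≤ (n : ℝ) + 1 := by positivity
      simp only
      nlinarith
  have key : ∀ a : ℝ, a ≤ 1 →
      (∀ s, Tendsto (fun n : ℕ => clampNeg (((n : ℝ) + 1) * (s - t) - a)) atTop
        (𝓝 (I.indicator (fun _ => (-1 : ℝ)) s))) → MeasurableSet I →
      0 ≤ ∫ x in u ⁻¹' I, (u x - g x) ∧ volume (interfaceSet r (u ⁻¹' I)) ≤
        ENNReal.ofReal ((h * (1 / (2 * r)))⁻¹ * ∫ x in u ⁻¹' I, (u x - g x)) := by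
    intro a ha hlim hI
    refine volume_interfaceSet_preimage_le hr hh hg hu hz he hI (T := t + 1)
      (ψ := fun n s => clampNeg (((n : ℝ) + 1) * (s - t) - a)) (fun n => ?_)
      (fun n => monotone_clampNeg.comp (hlin a n)) (fun n => ⟨(n : ℝ) + 1, fun x y hxy => ?_⟩)
      (fun n s => ?_) (fun n s => le_max_left _ _) (fun n s hs => ?_) hlim
    · unfold clampNeg
      fun_prop
    · have := clampNeg_sub_le (hlin a n hxy)
      simp only at this ⊢
      linarith
    · exact max_le (by norm_num) (min_le_left _ _)
    · have h0 : 0 ≤ ((n : ℝ) + 1) * (s - t) - a := by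
        have : (0 : ℝ) ≤ n := Nat.cast_nonneg n
        nlinarith
      simp only [clampNeg]
      rw [min_eq_left h0, max_eq_right (by norm_num)]
  have htop : ∀ s, t < s → Tendsto (fun n : ℕ => ((n : ℝ) + 1) * (s - t)) atTop atTop :=
    fun s hs => (tendsto_atTop_add_const_right _ _ tendsto_natCast_atTop_atTop).atTop_mul_const
      (sub_pos.2 hs)
  have hbot : ∀ s, s < t → Tendsto (fun n : ℕ => ((n : ℝ) + 1) * (s - t)) atTop atBot :=
    fun s hs => (tendsto_atTop_add_const_right _ _ tendsto_natCast_atTop_atTop).atTop_mul_const_of_neg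
      (sub_neg.2 hs)
  rcases hI with rfl | rfl
  · refine key 0 zero_le_one (fun s => ?_) measurableSet_Iio
    by_cases hs : s < t
    · rw [indicator_of_mem (mem_Iio.2 hs)]
      refine tendsto_const_nhds.congr' ?_
      filter_upwards [(hbot s hs).eventually_le_atBot (-1)] with n hn
      rw [clampNeg, sub_zero, min_eq_right (hn.trans (by norm_num)), max_eq_left hn]
    · rw [indicator_of_notMem (by simpa using hs)]
      refine tendsto_const_nhds.congr fun n => ?_
      rw [not_lt] at hs
      have : 0 ≤ ((n : ℝ) + 1) * (s - t) := mul_nonneg (by positivity) (sub_nonneg.2 hs)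
      rw [clampNeg, sub_zero, min_eq_left this, max_eq_right (by norm_num)]
  · refine key 1 le_rfl (fun s => ?_) measurableSet_Iic
    by_cases hs : s ≤ t
    · rw [indicator_of_mem (mem_Iic.2 hs)]
      refine tendsto_const_nhds.congr fun n => ?_
      have : ((n : ℝ) + 1) * (s - t) ≤ 0 :=
        mul_nonpos_of_nonneg_of_nonpos (by positivity) (sub_nonpos.2 hs)
      rw [clampNeg, min_eq_right (by linarith), max_eq_left (by linarith)]
    · rw [indicator_of_notMem (by simpa using hs)]
      refine tendsto_const_nhds.congr' ?_
      filter_upwards [(htop s (not_le.1 hs)).eventually_ge_atTop 1] with n hn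
      rw [clampNeg, min_eq_left (by linarith), max_eq_right (by norm_num)]

end NonlocalROF

end

/-! ### Sublevel sets as minimal and maximal minimizers. -/

noncomputable section

namespace NonlocalROF

open Metric Set

variable {N : ℕ} {r h : ℝ}

theorem extIntegral_eq {F : Set (Space N)} {f : Space N → ℝ} (hf : IntegrableOn f F volume) :
    extIntegral F f = ((∫ x in F, f x : ℝ) : EReal) := by
  have hn : ∫⁻ x in F, ENNReal.ofReal (-f x) ≠ ∞ := hf.neg.lintegral_lt_top.ne
  rw [integral_eq_lintegral_pos_part_sub_lintegral_neg_part hf, EReal.coe_sub, extIntegral,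
    ← EReal.coe_ennreal_toReal hf.lintegral_lt_top.ne,
    ← EReal.coe_ennreal_toReal hn]

theorem geomEnergy_eq (hr : 0 < r) {F : Set (Space N)} {f : Space N → ℝ}
    (hf : IntegrableOn f F volume) (hF : volume (interfaceSet r F) ≠ ∞) :
    geomEnergy r h f F =
      ((1 / (2 * r) * volume.real (interfaceSet r F) + 1 / h * ∫ x in F, f x : ℝ) : EReal) := by
  have hp : ((nonlocalPer r F : ℝ≥0∞) : EReal) =
      ((1 / (2 * r) * volume.real (interfaceSet r F) : ℝ) : EReal) := by
    rw [nonlocalPer_eq hr, ← EReal.coe_ennreal_toReal (ENNReal.mul_ne_top ENNReal.ofReal_ne_top hF),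
      ENNReal.toReal_mul, ENNReal.toReal_ofReal (by positivity)]
    rfl
  rw [geomEnergy, extIntegral_eq hf, hp, EReal.coe_add, EReal.coe_mul (1 / h)]

section Sublevel

variable {g u : Space N → ℝ}

theorem integrable_min_zero (hu : u ∈ LipPlus N) (t : ℝ) :
    Integrable (fun x => min (u x - t) 0) volume := by
  have huc := LipPlus.continuous hu
  obtain ⟨R, hR⟩ := LipPlus.exists_closedBall hu t
  refine Continuous.integrable_of_hasCompactSupport (by fun_prop)
    (HasCompactSupport.intro (isCompact_closedBall 0 R) fun x hx => ?_)
  rw [min_eq_right (sub_nonneg.2 (hR x hx))]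

/-- The level set {u = t} contributes nothing, so both sublevel sets have the same integral, the
least possible among all sets. -/
theorem setIntegral_sublevel (hu : u ∈ LipPlus N) (t : ℝ) {I : Set ℝ}
    (hI : I = Iio t ∨ I = Iic t) :
    ∫ x in u ⁻¹' I, (u x - t) = ∫ x, min (u x - t) 0 := by
  have hIm : MeasurableSet I := by
    rcases hI with rfl | rfl
    · exact measurableSet_Iio
    · exact measurableSet_Iic
  rw [← integral_indicator ((LipPlus.continuous hu).measurable hIm)]
  congr 1 with x
  rcases lt_trichotomy (u x) t with k | k | k
  · rw [min_eq_left (by linarith), indicator_of_mem]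
    rcases hI with rfl | rfl
    · exact k
    · exact k.le
  · by_cases hx : x ∈ u ⁻¹' I
    · rw [indicator_of_mem hx, k]
      simp
    · rw [indicator_of_notMem hx, k]
      simp
  · rw [min_eq_right (by linarith), indicator_of_notMem]
    rcases hI with rfl | rfl
    · exact not_lt.2 k.le
    · exact not_le.2 k

/-- The perimeter is at most (1/h) ∫ (u - g) over the sublevel set; adding (1/h) ∫ (g - t) cancels
g. -/
theorem geomEnergy_sublevel_le (hr : 0 < r) (hh : 0 < h) (hg : Continuous g) (hu : u ∈ LipPlus N)
    (hs : IsSolution r h g u) (t : ℝ) {I : Set ℝ} (hI : I = Iio t ∨ I = Iic t) :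
    geomEnergy r h (fun w => g w - t) (u ⁻¹' I) ≤ ((1 / h * ∫ x, min (u x - t) 0 : ℝ) : EReal) := by
  obtain ⟨z, hz, he⟩ := hs
  have huc := LipPlus.continuous hu
  obtain ⟨h0, hle⟩ := volume_interfaceSet_sublevel_le hr hh hg hu hz he t hI
  obtain ⟨R, hR⟩ := LipPlus.exists_closedBall hu (t + 1)
  have hsub : u ⁻¹' I ⊆ closedBall 0 R := by
    intro x hx
    by_contra k
    have := hR x k
    rcases hI with rfl | rfl
    · have hx' : u x < t := hx
      linarith
    · have hx' : u x ≤ t := hx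
      linarith
  have hint : ∀ f : Space N → ℝ, Continuous f → IntegrableOn f (u ⁻¹' I) volume := fun f hf =>
    (hf.continuousOn.integrableOn_compact (isCompact_closedBall _ _)).mono_set hsub
  have hfin : volume (interfaceSet r (u ⁻¹' I)) ≠ ∞ := ne_top_of_le_ne_top ENNReal.ofReal_ne_top hle
  have i₁ := hint (fun x => u x - g x) (huc.sub hg)
  have i₂ := hint (fun x => g x - t) (hg.sub continuous_const)
  rw [geomEnergy_eq hr i₂ hfin, EReal.coe_le_coe_iff,
    ← setIntegral_sublevel hu t hI]
  have h1 : volume.real (interfaceSet r (u ⁻¹' I)) ≤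
      (h * (1 / (2 * r)))⁻¹ * ∫ x in u ⁻¹' I, (u x - g x) :=
    ENNReal.toReal_le_of_le_ofReal (by positivity) hle
  have h2 : 1 / (2 * r) * volume.real (interfaceSet r (u ⁻¹' I)) ≤
      1 / h * ∫ x in u ⁻¹' I, (u x - g x) := by
    refine (mul_le_mul_of_nonneg_left h1 (by positivity)).trans (le_of_eq ?_)
    field_simp
  have h3 : ∫ x in u ⁻¹' I, (u x - t) =
      (∫ x in u ⁻¹' I, (u x - g x)) + ∫ x in u ⁻¹' I, (g x - t) := by
    rw [← integral_add i₁ i₂]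
    congr 1 with x
    ring
  rw [h3, mul_add]
  linarith

/-- The negative part of g - t is integrable because g tends to +∞, so no infinite terms can cancel:
perimeter and positive part are both finite. Outside a large ball g - t ≥ 1, so the positive part
controls the volume. -/
theorem volume_ne_top_of_geomEnergy_ne_top (hr : 0 < r) (hh : 0 < h) (hg : g ∈ LipPlus N) (t : ℝ)
    {G : Set (Space N)} (hG : geomEnergy r h (fun w => g w - t) G ≠ ⊤) :
    volume G ≠ ∞ ∧ volume (interfaceSet r G) ≠ ∞ := by
  have hgc := LipPlus.continuous hg
  have hneg : ∫⁻ x in G, ENNReal.ofReal (-(g x - t)) ≠ ∞ := by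
    have hi : Integrable (fun x => -min (g x - t) 0) volume := (integrable_min_zero hg t).neg
    refine ne_top_of_le_ne_top hi.lintegral_lt_top.ne
      ((setLIntegral_le_lintegral _ _).trans (lintegral_mono fun x => ?_))
    exact ENNReal.ofReal_le_ofReal (neg_le_neg (min_le_left _ _))
  have hne : ((∫⁻ x in G, ENNReal.ofReal (-(g x - t)) : ℝ≥0∞) : EReal) ≠ ⊤ := by
    simpa using hneg
  have hpos : ∫⁻ x in G, ENNReal.ofReal (g x - t) ≠ ∞ := by
    intro htop
    refine hG ?_
    rw [geomEnergy, extIntegral, htop, EReal.coe_ennreal_top, EReal.top_sub hne,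
      EReal.coe_mul_top_of_pos (by positivity)]
    exact EReal.add_top_of_ne_bot (EReal.coe_ennreal_ne_bot _)
  have hper : nonlocalPer r G ≠ ∞ := by
    intro htop
    refine hG ?_
    rw [geomEnergy, htop, EReal.coe_ennreal_top]
    refine EReal.top_add_of_ne_bot ?_
    rw [extIntegral, ← EReal.coe_ennreal_toReal hpos, ← EReal.coe_ennreal_toReal hneg,
      ← EReal.coe_sub, ← EReal.coe_mul]
    exact EReal.coe_ne_bot _
  constructor
  · obtain ⟨R, hR⟩ := LipPlus.exists_closedBall hg (t + 1)
    have hsub : G ⊆ closedBall 0 R ∪ ((closedBall 0 R)ᶜ ∩ G) := by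
      rw [union_inter_distrib_left, union_compl_self, univ_inter]
      exact subset_union_right
    refine ne_top_of_le_ne_top ?_ (measure_mono hsub)
    refine (measure_union_lt_top measure_closedBall_lt_top ?_).ne
    refine lt_of_le_of_lt ?_ hpos.lt_top
    rw [← Measure.restrict_apply measurableSet_closedBall.compl,
      ← one_mul (volume.restrict G _),
      ← lintegral_indicator_const measurableSet_closedBall.compl]
    refine lintegral_mono fun x => ?_
    by_cases hx : x ∈ (closedBall (0 : Space N) R)ᶜ
    swap
    · rw [indicator_of_notMem hx]
      exact zero_le
    rw [indicator_of_mem hx, ← ENNReal.ofReal_one]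
    exact ENNReal.ofReal_le_ofReal (by linarith [hR x hx])
  · intro htop
    refine hper ?_
    rw [nonlocalPer_eq hr, htop, ENNReal.mul_top]
    simpa using hr

/-- Every set of finite energy has at least the energy of the sublevel sets, and equality forces it
to lie between them. -/
theorem le_geomEnergy (hr : 0 < r) (hh : 0 < h) (hg : g ∈ LipPlus N) (hu : u ∈ LipPlus N)
    (hs : IsSolution r h g u) (t : ℝ) {G : Set (Space N)} (hG : NullMeasurableSet G volume) :
    ((1 / h * ∫ x, min (u x - t) 0 : ℝ) : EReal) ≤ geomEnergy r h (fun w => g w - t) G ∧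
      (geomEnergy r h (fun w => g w - t) G ≤ ((1 / h * ∫ x, min (u x - t) 0 : ℝ) : EReal) →
        {w | u w < t} ≤ᵐ[volume] G ∧ G ≤ᵐ[volume] {w | u w ≤ t}) := by
  by_cases hfin : geomEnergy r h (fun w => g w - t) G = ⊤
  · rw [hfin]
    exact ⟨le_top, fun k => absurd k (not_le.2 (EReal.coe_lt_top _))⟩
  obtain ⟨z, hz, he⟩ := hs
  have huc := LipPlus.continuous hu
  have hgc := LipPlus.continuous hg
  obtain ⟨hv, hW⟩ := volume_ne_top_of_geomEnergy_ne_top hr hh hg t hfin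
  obtain ⟨G', hm, hae, hP, R, hR⟩ := exists_good_representative_bounded hr hG hv hW
  have hint : ∀ f : Space N → ℝ, Continuous f → IntegrableOn f G' volume := fun f hf =>
    (hf.continuousOn.integrableOn_compact (isCompact_closedBall _ _)).mono_set hR
  have hcal := setIntegral_sub_le hr hh huc hgc hz.1 (hz.2.mono fun _ k => k.1) he hm hR
    (isOpen_interfaceSet G).measurableSet hW hP
  have hutc : Continuous fun x => u x - t := huc.sub continuous_const
  have hgtc : Continuous fun x => g x - t := hgc.sub continuous_const
  rw [geomEnergy_eq hr ((hint _ hgtc).congr_set_ae hae.symm) hW, EReal.coe_le_coe_iff,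
    EReal.coe_le_coe_iff, ← setIntegral_congr_set hae]
  set W := interfaceSet r G
  -- The calibration inequality divided by h, stated for the bounded representative and the
  -- interface of the original set.
  have h1 : 1 / h * (∫ x in G', (u x - g x)) ≤ 1 / (2 * r) * volume.real W := by
    refine (mul_le_mul_of_nonneg_left hcal (by positivity)).trans (le_of_eq ?_)
    field_simp
  have h3 : ∫ x in G', (u x - t) =
      (∫ x in G', (u x - g x)) + ∫ x in G', (g x - t) := by
    rw [← integral_add (hint (fun x => u x - g x) (huc.sub hgc)) (hint _ hgtc)]
    congr 1 with x
    ring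
  have hi := integrable_min_zero hu t
  have hi' : Integrable (G'.indicator fun x => u x - t) volume :=
    (integrable_indicator_iff hm).2 (hint _ hutc)
  -- The excess energy is at least the integral of this nonnegative function times 1/h. It vanishes
  -- at x only if x is in the set when u x < t and outside it when u x > t, which gives the equality
  -- case.
  have hnn : ∀ x, 0 ≤ G'.indicator (fun x => u x - t) x - min (u x - t) 0 := by
    intro x
    rw [sub_nonneg]
    by_cases hx : x ∈ G'
    · rw [indicator_of_mem hx]
      exact min_le_left _ _
    · rw [indicator_of_notMem hx]
      exact min_le_right _ _
  have h4 : (∫ x in G', (u x - t)) - ∫ x, min (u x - t) 0 =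
      ∫ x, (G'.indicator (fun x => u x - t) x - min (u x - t) 0) := by
    rw [integral_sub hi' hi, integral_indicator hm]
  have h5 : 0 ≤ (∫ x in G', (u x - t)) - ∫ x, min (u x - t) 0 := by
    rw [h4]
    exact integral_nonneg hnn
  have hhinv : 0 < 1 / h := by positivity
  constructor
  · have := mul_le_mul_of_nonneg_left (sub_nonneg.1 h5) hhinv.le
    rw [h3, mul_add] at this
    linarith
  · intro hle
    have h6 : (∫ x in G', (u x - t)) - ∫ x, min (u x - t) 0 = 0 := by
      refine le_antisymm ?_ h5
      rw [sub_nonpos]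
      refine le_of_mul_le_mul_left ?_ hhinv
      rw [h3, mul_add]
      linarith
    rw [h4, integral_eq_zero_iff_of_nonneg hnn (hi'.sub hi)] at h6
    constructor
    · filter_upwards [h6, hae.mem_iff] with x hx hx' hxu
      rw [← show x ∈ G' ↔ G x from hx']
      by_contra k
      rw [Pi.zero_apply, indicator_of_notMem k] at hx
      have hxu' : u x < t := hxu
      rw [min_eq_left (by linarith)] at hx
      linarith
    · filter_upwards [h6, hae.mem_iff] with x hx hx' hxG
      have k : x ∈ G' := hx'.2 hxG
      change u x ≤ t
      by_contra hlt
      rw [not_le] at hlt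
      rw [Pi.zero_apply, indicator_of_mem k, min_eq_right (by linarith)] at hx
      linarith

theorem isMinimalMinimizer_and_isMaximalMinimizer (hr : 0 < r) (hh : 0 < h) (hg : g ∈ LipPlus N)
    (hu : u ∈ LipPlus N) (hs : IsSolution r h g u) (t : ℝ) :
    IsMinimalMinimizer r h (fun w => g w - t) {w | u w < t} ∧
      IsMaximalMinimizer r h (fun w => g w - t) {w | u w ≤ t} := by
  have hgc := LipPlus.continuous hg
  have huc := LipPlus.continuous hu
  have e₁ := geomEnergy_sublevel_le hr hh hgc hu hs t (Or.inl rfl)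
  have e₂ := geomEnergy_sublevel_le hr hh hgc hu hs t (Or.inr rfl)
  have m₁ : IsGeomMinimizer r h (fun w => g w - t) {w | u w < t} :=
    ⟨(isOpen_lt huc continuous_const).measurableSet.nullMeasurableSet, fun G hG =>
      e₁.trans (le_geomEnergy hr hh hg hu hs t hG).1⟩
  have m₂ : IsGeomMinimizer r h (fun w => g w - t) {w | u w ≤ t} :=
    ⟨(isClosed_le huc continuous_const).measurableSet.nullMeasurableSet, fun G hG =>
      e₂.trans (le_geomEnergy hr hh hg hu hs t hG).1⟩
  refine ⟨⟨m₁, fun G hG => ?_⟩, m₂, fun G hG => ?_⟩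
  · exact ((le_geomEnergy hr hh hg hu hs t hG.1).2 ((hG.2 _ m₁.1).trans e₁)).1
  · exact ((le_geomEnergy hr hh hg hu hs t hG.1).2 ((hG.2 _ m₁.1).trans e₁)).2

end Sublevel

end NonlocalROF

end

/-! ### Order-preserving contraction for u + A u = g. -/

noncomputable section

namespace NonlocalROF

open Metric Set

variable {N : ℕ} {r h : ℝ}

section FixedPoint

/-- An explicit Euler step for the equation `u + A u = g`. -/
def eulerStep (A : (Space N → ℝ) → Space N → ℝ) (s : ℝ) (g u : Space N → ℝ) (x : Space N) : ℝ :=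
  (1 - s) * u x + s * (g x - A u x)

variable {A : (Space N → ℝ) → Space N → ℝ} {L : ℝ≥0} {M C s : ℝ}

/-- The increment of the step is at least (1 - s(1 + C))(v - u) + s(g₂ - g₁), which explains the
restriction on the step size s. -/
theorem eulerStep_mono
    (hmono : ∀ u v x, LipschitzWith L u → LipschitzWith L v → (∀ y, u y ≤ v y) →
      A v x - A u x ≤ C * (v x - u x))
    (hs : 0 ≤ s) (hs' : s * (1 + C) ≤ 1) {g₁ g₂ u v : Space N → ℝ} (hg : ∀ x, g₁ x ≤ g₂ x)
    (hu : LipschitzWith L u) (hv : LipschitzWith L v) (huv : ∀ x, u x ≤ v x) (x : Space N) :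
    eulerStep A s g₁ u x ≤ eulerStep A s g₂ v x := by
  have h1 := mul_le_mul_of_nonneg_left (hmono u v x hu hv huv) hs
  have h2 := mul_le_mul_of_nonneg_left (hg x) hs
  have h3 := mul_nonneg (sub_nonneg.2 hs') (sub_nonneg.2 (huv x))
  simp only [eulerStep]
  nlinarith

theorem eulerStep_add_const (hconst : ∀ u c, A (fun x => u x + c) = A u) (g u : Space N → ℝ)
    (c : ℝ) (x : Space N) :
    eulerStep A s g (fun x => u x + c) x = eulerStep A s g u x + (1 - s) * c := by
  simp only [eulerStep, hconst]
  ring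

theorem lipschitzWith_add_const {u : Space N → ℝ} (hu : LipschitzWith L u) (c : ℝ) :
    LipschitzWith L fun x => u x + c :=
  LipschitzWith.of_dist_le_mul fun x y => by
    rw [dist_add_right]
    exact hu.dist_le_mul x y

/-- For an L-Lipschitz function the translate by τ lies below the function plus L|τ|. The step
preserves this inequality, since it preserves order and commutes with translations, and since adding
L|τ| to both u and g adds exactly L|τ| to the result. -/
theorem lipschitzWith_eulerStep
    (hconst : ∀ u c, A (fun x => u x + c) = A u)
    (htrans : ∀ u τ x, A (fun y => u (y + τ)) x = A u (x + τ))
    (hmono : ∀ u v x, LipschitzWith L u → LipschitzWith L v → (∀ y, u y ≤ v y) →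
      A v x - A u x ≤ C * (v x - u x))
    (hs : 0 ≤ s) (hs' : s * (1 + C) ≤ 1) {g u : Space N → ℝ} (hg : LipschitzWith L g)
    (hu : LipschitzWith L u) : LipschitzWith L (eulerStep A s g u) := by
  refine LipschitzWith.of_le_add_mul L fun x y => ?_
  set τ := x - y
  have hτ : ∀ f : Space N → ℝ, LipschitzWith L f → ∀ z, f (z + τ) ≤ f z + L * dist x y := by
    intro f hf z
    have := (le_abs_self _).trans (hf.dist_le_mul (z + τ) z)
    rw [dist_self_add_left, ← dist_eq_norm] at this
    linarith
  have huτ : LipschitzWith L fun z => u (z + τ) := LipschitzWith.of_dist_le_mul fun a b => by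
    simpa using hu.dist_le_mul (a + τ) (b + τ)
  have h1 : eulerStep A s g u x =
      eulerStep A s (fun z => g (z + τ)) (fun z => u (z + τ)) y := by
    simp [eulerStep, htrans, τ]
  rw [h1]
  refine (eulerStep_mono hmono hs hs' (hτ g hg) huτ (lipschitzWith_add_const hu _) (hτ u hu) y).trans ?_
  rw [eulerStep_add_const hconst]
  simp only [eulerStep]
  linarith

/-- Solvability of `u + A u = g` in the class of `L`-Lipschitz functions, for an operator `A` that
is bounded, invariant under translations and the addition of constants, and such that `C • id - A`
is order preserving. -/
theorem exists_lipschitz_solution (hC : 0 ≤ C)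
    (hconst : ∀ u c, A (fun x => u x + c) = A u)
    (htrans : ∀ u τ x, A (fun y => u (y + τ)) x = A u (x + τ))
    (hbd : ∀ u, LipschitzWith L u → ∀ x, |A u x| ≤ M)
    (hmono : ∀ u v x, LipschitzWith L u → LipschitzWith L v → (∀ y, u y ≤ v y) →
      A v x - A u x ≤ C * (v x - u x))
    {g : Space N → ℝ} (hg : LipschitzWith L g) :
    ∃ u, LipschitzWith L u ∧ ∀ x, u x + A u x = g x := by
  -- The largest step size for which the Euler step preserves order.
  set s : ℝ := 1 / (1 + C) with hsdef
  have hs : 0 < s := by positivity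
  have hs1 : s ≤ 1 := by
    rw [hsdef, div_le_one (by positivity)]
    linarith
  have hs' : s * (1 + C) ≤ 1 := by
    rw [hsdef]
    field_simp
    exact le_rfl
  -- Since g is unbounded, the iteration is carried out on the bounded difference b = u - g; the
  -- Lipschitz constraint on g + b is closed in the sup norm.
  let X : Set (BoundedContinuousFunction (Space N) ℝ) :=
    {b | LipschitzWith L fun x => g x + b x}
  have hX : IsClosed X := by
    have : X = ⋂ (x : Space N) (y : Space N),
        {b : BoundedContinuousFunction (Space N) ℝ |
          dist (g x + b x) (g y + b y) ≤ L * dist x y} := by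
      ext b
      simp only [mem_iInter]
      exact lipschitzWith_iff_dist_le_mul
    rw [this]
    refine isClosed_iInter fun x => isClosed_iInter fun y => isClosed_le ?_ continuous_const
    have hc := fun x : Space N => (BoundedContinuousFunction.lipschitz_eval_const (β := ℝ) x).continuous
    exact (continuous_const.add (hc x)).dist (continuous_const.add (hc y))
  have hstep : ∀ b ∈ X, LipschitzWith L (eulerStep A s g fun x => g x + b x) := fun b hb =>
    lipschitzWith_eulerStep hconst htrans hmono hs.le hs' hg hb
  let T : X → X := fun b => ⟨BoundedContinuousFunction.ofNormedAddCommGroup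
    (fun x => eulerStep A s g (fun x => g x + b.1 x) x - g x)
    ((hstep b.1 b.2).continuous.sub hg.continuous) (‖b.1‖ + M) (fun x => by
      have h1 : eulerStep A s g (fun x => g x + b.1 x) x - g x =
          (1 - s) * b.1 x - s * A (fun x => g x + b.1 x) x := by
        simp only [eulerStep]
        ring
      have h2 := b.1.norm_coe_le_norm x
      have h3 := hbd _ b.2 x
      rw [h1]
      refine (norm_sub_le _ _).trans (add_le_add ?_ ?_)
      · rw [norm_mul, Real.norm_of_nonneg (sub_nonneg.2 hs1)]
        exact (mul_le_of_le_one_left (norm_nonneg _) (by linarith)).trans h2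
      · rw [norm_mul, Real.norm_of_nonneg hs.le]
        exact (mul_le_of_le_one_left (norm_nonneg _) hs1).trans h3), by
      change LipschitzWith L fun x => g x + (eulerStep A s g (fun x => g x + b.1 x) x - g x)
      simpa using hstep b.1 b.2⟩
  -- Order preservation turns b ≤ b' + dist into a sup-norm estimate, and constants are multiplied
  -- by 1 - s.
  have hle : ∀ b b' : X, ∀ x, (T b).1 x ≤ (T b').1 x + (1 - s) * dist b b' := by
    intro b b' x
    change eulerStep A s g (fun x => g x + b.1 x) x - g x ≤
      eulerStep A s g (fun x => g x + b'.1 x) x - g x + (1 - s) * dist b b'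
    have hbb : ∀ y, g y + b.1 y ≤ (g y + b'.1 y) + dist b b' := fun y => by
      have := (le_abs_self _).trans (BoundedContinuousFunction.dist_coe_le_dist (f := b.1)
        (g := b'.1) y)
      rw [Subtype.dist_eq]
      linarith
    have h1 := eulerStep_mono hmono hs.le hs' (fun x => le_refl (g x)) b.2
      (lipschitzWith_add_const b'.2 (dist b b')) hbb x
    rw [eulerStep_add_const hconst g fun x => g x + b'.1 x] at h1
    linarith
  have hT : ContractingWith (Real.toNNReal (1 - s)) T := by
    refine ⟨?_, LipschitzWith.of_dist_le_mul fun b b' => ?_⟩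
    · rw [Real.toNNReal_lt_one]
      linarith
    · rw [Real.coe_toNNReal _ (sub_nonneg.2 hs1), Subtype.dist_eq, BoundedContinuousFunction.dist_le
        (mul_nonneg (sub_nonneg.2 hs1) dist_nonneg)]
      intro x
      refine abs_sub_le_iff.2 ⟨?_, ?_⟩
      · linarith [hle b b' x]
      · have := hle b' b x
        rw [dist_comm] at this
        linarith
  have hne : Nonempty X := ⟨⟨0, by
    change LipschitzWith L fun x => g x + 0
    simpa using hg⟩⟩
  have hcomp : CompleteSpace X := hX.completeSpace_coe
  set b := hT.fixedPoint T
  have hb : T b = b := hT.fixedPoint_isFixedPt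
  refine ⟨fun x => g x + b.1 x, b.2, fun x => ?_⟩
  have hx : (T b).1 x = b.1 x := by rw [hb]
  change eulerStep A s g (fun x => g x + b.1 x) x - g x = b.1 x at hx
  simp only [eulerStep] at hx
  have : s * (b.1 x + A (fun x => g x + b.1 x) x) = 0 := by linarith
  have := (mul_eq_zero.1 this).resolve_left hs.ne'
  linarith

end FixedPoint

end NonlocalROF

end

/-! ### The regularised operator and its solvability. -/

noncomputable section

namespace NonlocalROF

open Metric Set

variable {N : ℕ} {r h β : ℝ} {L : ℝ≥0}

theorem setIntegral_closedBall_add (F : Space N → ℝ) (x τ : Space N) (r : ℝ) :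
    ∫ w in closedBall x r, F (w + τ) = ∫ w in closedBall (x + τ) r, F w := by
  rw [← integral_indicator measurableSet_closedBall, ← integral_indicator measurableSet_closedBall,
    ← integral_add_right_eq_self ((closedBall (x + τ) r).indicator F) τ]
  congr 1 with w
  by_cases hw : w ∈ closedBall x r
  · rw [indicator_of_mem hw, indicator_of_mem (by simpa using hw)]
  · rw [indicator_of_notMem hw, indicator_of_notMem (by simpa using hw)]

theorem integrableOn_closedBall {F : Space N → ℝ} (hF : Continuous F) (x : Space N) (r : ℝ) :
    IntegrableOn F (closedBall x r) volume :=
  hF.continuousOn.integrableOn_compact (isCompact_closedBall _ _)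

theorem continuous_setIntegral_closedBall {F : Space N → ℝ} (hF : Continuous F) (r : ℝ) :
    Continuous fun w => ∫ y in closedBall w r, F y := by
  have : (fun w => ∫ y in closedBall w r, F y) =
      fun w => ∫ y in closedBall (0 : Space N) r, F (y + w) := by
    ext w
    rw [setIntegral_closedBall_add, zero_add]
  rw [this]
  exact continuous_parametric_integral_of_continuous (by fun_prop) (isCompact_closedBall _ _)

theorem measureReal_closedBall_pos (hr : 0 < r) (x : Space N) :
    0 < volume.real (closedBall x r) :=
  ENNReal.toReal_pos (measure_closedBall_pos _ _ hr).ne' measure_closedBall_lt_top.ne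

theorem measureReal_closedBall_eq (x y : Space N) :
    volume.real (closedBall x r) = volume.real (closedBall y r) := by
  simp only [Measure.real, Measure.addHaar_closedBall_center volume x,
    Measure.addHaar_closedBall_center volume y]

theorem setIntegral_closedBall_pos (hr : 0 < r) {F : Space N → ℝ} (hF : Continuous F)
    (hpos : ∀ x, 0 < F x) (w : Space N) : 0 < ∫ y in closedBall w r, F y := by
  rw [setIntegral_pos_iff_support_of_nonneg_ae (Eventually.of_forall fun x => (hpos x).le)
    (integrableOn_closedBall hF w r)]
  have : Function.support F = univ := by
    ext x
    simpa using (hpos x).ne'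
  rw [this, univ_inter]
  exact measure_closedBall_pos _ _ hr

/-- The reciprocal of the relative exponential mass of the ball at `w`. -/
def expMass (r β : ℝ) (u : Space N → ℝ) (x w : Space N) : ℝ :=
  ∫ y in closedBall w r, Real.exp (β * (u y - u x))

theorem expMass_pos (hr : 0 < r) {u : Space N → ℝ} (hu : Continuous u) (x w : Space N) :
    0 < expMass r β u x w :=
  setIntegral_closedBall_pos hr (by fun_prop) (fun _ => Real.exp_pos _) w

theorem continuous_expMass {u : Space N → ℝ} (hu : Continuous u) (x : Space N) :
    Continuous (expMass r β u x) :=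
  continuous_setIntegral_closedBall (by fun_prop) r

theorem continuous_inv_expMass (hr : 0 < r) {u : Space N → ℝ} (hu : Continuous u) (x : Space N) :
    Continuous fun w => (expMass r β u x w)⁻¹ :=
  (continuous_expMass hu x).inv₀ fun w => (expMass_pos hr hu x w).ne'

/-- The soft version of the amount by which the point `x` is a maximum of `u` over the balls that
contain it. -/
def softMax (r β : ℝ) (u : Space N → ℝ) (x : Space N) : ℝ :=
  ∫ w in closedBall x r, (expMass r β u x w)⁻¹

theorem softMax_add_const (u : Space N → ℝ) (c : ℝ) :
    softMax r β (fun x => u x + c) = softMax r β u := by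
  ext x
  simp [softMax, expMass]

theorem softMax_translate (u : Space N → ℝ) (τ x : Space N) :
    softMax r β (fun y => u (y + τ)) x = softMax r β u (x + τ) := by
  have h1 : ∀ w, expMass r β (fun y => u (y + τ)) x w = expMass r β u (x + τ) (w + τ) := fun w =>
    setIntegral_closedBall_add (fun y => Real.exp (β * (u y - u (x + τ)))) w τ r
  simp only [softMax, h1]
  exact setIntegral_closedBall_add (fun w => (expMass r β u (x + τ) w)⁻¹) x τ r

theorem softMax_nonneg (hr : 0 < r) {u : Space N → ℝ} (hu : Continuous u) (x : Space N) :
    0 ≤ softMax r β u x :=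
  integral_nonneg fun w => (inv_pos.2 (expMass_pos hr hu x w)).le

/-- Points of a ball containing x are within 2r of x, so the exponential is at least exp(-2βLr)
there. The volume of the ball of averaging cancels that of the ball of centres. -/
theorem softMax_le (hr : 0 < r) (hβ : 0 ≤ β) {u : Space N → ℝ} (hu : LipschitzWith L u)
    (x : Space N) : softMax r β u x ≤ Real.exp (β * (L * (2 * r))) := by
  have hc := measureReal_closedBall_pos hr x
  have h1 : ∀ w ∈ closedBall x r,
      (expMass r β u x w)⁻¹ ≤ (volume.real (closedBall x r))⁻¹ * Real.exp (β * (L * (2 * r))) := by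
    intro w hw
    have h2 : volume.real (closedBall x r) * Real.exp (-(β * (L * (2 * r)))) ≤
        expMass r β u x w := by
      rw [measureReal_closedBall_eq x w, expMass, ← smul_eq_mul, ← setIntegral_const]
      refine setIntegral_mono_on (integrableOn_closedBall continuous_const _ _)
        (integrableOn_closedBall (by have := hu.continuous; fun_prop) _ _)
        measurableSet_closedBall fun y hy => Real.exp_le_exp.2 ?_
      rw [← mul_neg]
      refine mul_le_mul_of_nonneg_left ?_ hβ
      have h3 := (neg_abs_le _).trans' (neg_le_neg (hu.dist_le_mul y x))
      refine le_trans ?_ h3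
      refine neg_le_neg (mul_le_mul_of_nonneg_left ?_ L.2)
      rw [mem_closedBall] at hw hy
      linarith [dist_triangle y w x]
    refine (inv_anti₀ (by positivity) h2).trans (le_of_eq ?_)
    rw [mul_inv, Real.exp_neg, inv_inv]
  refine (setIntegral_mono_on
    (integrableOn_closedBall (continuous_inv_expMass hr hu.continuous x) _ _)
    (integrableOn_closedBall continuous_const _ _) measurableSet_closedBall h1).trans (le_of_eq ?_)
  rw [setIntegral_const, smul_eq_mul, mul_inv_cancel_left₀ hc.ne']

/-- If u ≤ v then u y - u x ≤ v y - v x + d with d = v x - u x, whatever y is. Hence the exponential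
masses compare with factor exp(βd), and 1 - exp(-βd) ≤ βd. Only the value at x enters the bound, as
the order-preserving scheme requires. -/
theorem softMax_sub_le (hr : 0 < r) (hβ : 0 ≤ β) {u v : Space N → ℝ} (hu : LipschitzWith L u)
    (hv : LipschitzWith L v) (huv : ∀ y, u y ≤ v y) (x : Space N) :
    softMax r β v x - softMax r β u x ≤ Real.exp (β * (L * (2 * r))) * β * (v x - u x) := by
  set d := v x - u x
  have hd : 0 ≤ d := sub_nonneg.2 (huv x)
  have h1 : Real.exp (-(β * d)) * softMax r β v x ≤ softMax r β u x := by
    rw [softMax, ← integral_const_mul]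
    refine integral_mono
      ((integrableOn_closedBall (continuous_inv_expMass hr hv.continuous x) _ _).const_mul _)
      (integrableOn_closedBall (continuous_inv_expMass hr hu.continuous x) _ _) fun w => ?_
    have h2 : expMass r β u x w ≤ Real.exp (β * d) * expMass r β v x w := by
      rw [expMass, expMass, ← integral_const_mul]
      have := hu.continuous
      have := hv.continuous
      refine integral_mono (integrableOn_closedBall (by fun_prop) _ _)
        ((integrableOn_closedBall (by fun_prop) _ _).const_mul _) fun y => ?_
      simp only
      rw [← Real.exp_add, Real.exp_le_exp, ← mul_add]
      refine mul_le_mul_of_nonneg_left ?_ hβ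
      simp only [d]
      linarith [huv y]
    have h3 := inv_anti₀ (expMass_pos hr hu.continuous x w) h2
    rwa [mul_inv, ← Real.exp_neg] at h3
  have h4 : 1 - β * d ≤ Real.exp (-(β * d)) := by
    linarith [Real.add_one_le_exp (-(β * d))]
  have h5 := mul_le_mul_of_nonneg_right h4 (softMax_nonneg (β := β) hr hv.continuous x)
  have h6 := mul_le_mul_of_nonneg_left (softMax_le hr hβ hv x) (mul_nonneg hβ hd)
  linarith

/-- The regularised nonlocal divergence operator. -/
def softOp (r h β : ℝ) (u : Space N → ℝ) (x : Space N) : ℝ :=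
  h * (1 / (2 * r)) * (softMax r β u x - softMax r β (fun y => -u y) x)

theorem exists_softOp_solution (hr : 0 < r) (hh : 0 < h) (hβ : 0 ≤ β) {g : Space N → ℝ}
    (hg : LipschitzWith L g) :
    ∃ u, LipschitzWith L u ∧ ∀ x, u x + softOp r h β u x = g x := by
  have hc : 0 < h * (1 / (2 * r)) := by positivity
  -- The bound M is that of one soft maximum, because the operator is a difference of two
  -- nonnegative terms with the same bound; the one-sided constant C collects one estimate for u and
  -- one for -u, hence the factor 2.
  refine exists_lipschitz_solution (L := L)
    (M := h * (1 / (2 * r)) * Real.exp (β * (L * (2 * r))))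
    (C := h * (1 / (2 * r)) * (2 * (Real.exp (β * (L * (2 * r))) * β))) (by positivity)
    (fun u c => ?_) (fun u τ x => ?_) (fun u hu x => ?_) (fun u v x hu hv huv => ?_) hg
  · ext x
    have : (fun y => -(u y + c)) = fun y => -u y + -c := by
      ext y
      ring
    rw [softOp, softOp, this, softMax_add_const u c, softMax_add_const (fun y => -u y)]
  · rw [softOp, softOp, softMax_translate, softMax_translate (fun y => -u y)]
  · rw [softOp, abs_mul, abs_of_pos hc]
    refine mul_le_mul_of_nonneg_left ?_ hc.le
    have h1 := softMax_le hr hβ hu x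
    have h2 := softMax_le (u := fun y => -u y) hr hβ hu.neg x
    have h3 := softMax_nonneg (β := β) hr hu.continuous x
    have h4 := softMax_nonneg (β := β) (u := fun y => -u y) hr hu.neg.continuous x
    exact abs_le.2 ⟨by linarith, by linarith⟩
  · have h1 := softMax_sub_le hr hβ hu hv huv x
    have h2 := softMax_sub_le (u := fun y => -v y) (v := fun y => -u y) hr hβ hv.neg hu.neg
      (fun y => neg_le_neg (huv y)) x
    simp only [softOp]
    rw [← mul_sub, mul_assoc (h * (1 / (2 * r)))]
    refine mul_le_mul_of_nonneg_left ?_ hc.le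
    linarith

end NonlocalROF

end

/-! ### Gibbs measures on pairs and the weak form of the regularised equation. -/

noncomputable section

namespace NonlocalROF

open Metric Set

variable {N : ℕ} {r h β : ℝ} {L : ℝ≥0}

/-- Lebesgue measure on the set of pairs of points of the ball. -/
def pairVol (N : ℕ) (r : ℝ) : Measure (ballPair N r) := Measure.comap Subtype.val volume

theorem measurableSet_ballPair : MeasurableSet (ballPair N r) :=
  measurableSet_closedBall.prod measurableSet_closedBall

theorem integral_pairVol (f : Space N × Space N → ℝ) :
    ∫ p, f p.1 ∂(pairVol N r) = ∫ p in ballPair N r, f p :=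
  integral_subtype_comap measurableSet_ballPair f

theorem pairVol_image (s : Set (ballPair N r)) :
    pairVol N r s = volume (Subtype.val '' s) :=
  comap_subtype_coe_apply measurableSet_ballPair volume s

instance instIsFiniteMeasurePairVol : IsFiniteMeasure (pairVol N r) := by
  refine ⟨?_⟩
  rw [pairVol_image univ, image_univ, Subtype.range_coe]
  exact ((isCompact_closedBall 0 r).prod (isCompact_closedBall 0 r)).measure_lt_top

theorem pairVol_ne_zero (hr : 0 < r) : pairVol N r ≠ 0 := by
  rw [Ne, ← Measure.measure_univ_eq_zero, pairVol_image univ, image_univ,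
    Subtype.range_coe, ballPair, Measure.volume_eq_prod, Measure.prod_prod]
  exact mul_ne_zero (measure_closedBall_pos _ _ hr).ne' (measure_closedBall_pos _ _ hr).ne'

theorem integral_pairVol_mul (f g : Space N → ℝ) :
    ∫ p, f p.1.1 * g p.1.2 ∂(pairVol N r) =
      (∫ x in closedBall 0 r, f x) * ∫ y in closedBall 0 r, g y := by
  rw [integral_pairVol fun p => f p.1 * g p.2, ballPair, Measure.volume_eq_prod]
  exact setIntegral_prod_mul f g _ _

/-- The partition function of the Gibbs measure of the pair difference. -/
def gibbsMass (r β : ℝ) (u : Space N → ℝ) (w : Space N) : ℝ :=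
  ∫ p, Real.exp (β * pairDiff u w p) ∂(pairVol N r)

/-- The density of the Gibbs measure of the pair difference. -/
def gibbsDensity (r β : ℝ) (u : Space N → ℝ) (w : Space N) (p : ballPair N r) : ℝ :=
  Real.exp (β * pairDiff u w p) / gibbsMass r β u w

theorem continuous_exp_pairDiff {u : Space N → ℝ} (hu : Continuous u) :
    Continuous fun q : Space N × ballPair N r => Real.exp (β * pairDiff u q.1 q.2) :=
  Real.continuous_exp.comp (continuous_const.mul (continuous_pairDiff hu))

theorem continuous_gibbsMass {u : Space N → ℝ} (hu : Continuous u) :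
    Continuous (gibbsMass r β u) := by
  have := continuous_parametric_integral_of_continuous (μ := pairVol N r)
    (f := fun w p => Real.exp (β * pairDiff u w p)) (continuous_exp_pairDiff hu) isCompact_univ
  simp only [Measure.restrict_univ] at this
  exact this

theorem integrable_exp_pairDiff {u : Space N → ℝ} (hu : Continuous u) (w : Space N) :
    Integrable (fun p => Real.exp (β * pairDiff u w p)) (pairVol N r) :=
  integrable_of_continuous_ballPair _
    (Real.continuous_exp.comp (continuous_const.mul (continuous_pairDiff_right hu w)))

theorem gibbsMass_pos (hr : 0 < r) {u : Space N → ℝ} (hu : Continuous u) (w : Space N) :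
    0 < gibbsMass r β u w := by
  have : NeZero (pairVol N r) := ⟨pairVol_ne_zero hr⟩
  exact integral_exp_pos (integrable_exp_pairDiff hu w)

theorem continuous_gibbsDensity (hr : 0 < r) {u : Space N → ℝ} (hu : Continuous u) :
    Continuous fun q : Space N × ballPair N r => gibbsDensity r β u q.1 q.2 :=
  (continuous_exp_pairDiff hu).div ((continuous_gibbsMass hu).comp continuous_fst)
    fun q => (gibbsMass_pos hr hu q.1).ne'

theorem continuous_gibbsDensity_right (hr : 0 < r) {u : Space N → ℝ} (hu : Continuous u)
    (w : Space N) : Continuous fun p : ballPair N r => gibbsDensity r β u w p :=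
  (continuous_gibbsDensity hr hu).comp (by fun_prop : Continuous fun p : ballPair N r => (w, p))

theorem gibbsDensity_nonneg (hr : 0 < r) {u : Space N → ℝ} (hu : Continuous u) (w : Space N)
    (p : ballPair N r) : 0 ≤ gibbsDensity r β u w p :=
  div_nonneg (Real.exp_pos _).le (gibbsMass_pos hr hu w).le

theorem integral_gibbsDensity (hr : 0 < r) {u : Space N → ℝ} (hu : Continuous u) (w : Space N) :
    ∫ p, gibbsDensity r β u w p ∂(pairVol N r) = 1 := by
  simp only [gibbsDensity]
  rw [integral_div]
  exact div_self (gibbsMass_pos hr hu w).ne'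

/-- The average of `f` with respect to the Gibbs measure. -/
def gibbsAvg (r β : ℝ) (u : Space N → ℝ) (w : Space N) (f : ballPair N r → ℝ) : ℝ :=
  ∫ p, gibbsDensity r β u w p * f p ∂(pairVol N r)

theorem integrable_gibbsDensity_mul (hr : 0 < r) {u : Space N → ℝ} (hu : Continuous u)
    (w : Space N) {f : ballPair N r → ℝ} (hf : Continuous f) :
    Integrable (fun p => gibbsDensity r β u w p * f p) (pairVol N r) :=
  integrable_of_continuous_ballPair _ ((continuous_gibbsDensity_right hr hu w).mul hf)

theorem gibbsAvg_mono (hr : 0 < r) {u : Space N → ℝ} (hu : Continuous u) (w : Space N)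
    {f g : ballPair N r → ℝ} (hf : Continuous f) (hg : Continuous g) (hfg : ∀ p, f p ≤ g p) :
    gibbsAvg r β u w f ≤ gibbsAvg r β u w g :=
  integral_mono (integrable_gibbsDensity_mul hr hu w hf) (integrable_gibbsDensity_mul hr hu w hg)
    fun p => mul_le_mul_of_nonneg_left (hfg p) (gibbsDensity_nonneg hr hu w p)

theorem gibbsAvg_const (hr : 0 < r) {u : Space N → ℝ} (hu : Continuous u) (w : Space N) (c : ℝ) :
    gibbsAvg r β u w (fun _ => c) = c := by
  rw [gibbsAvg, integral_mul_const, integral_gibbsDensity hr hu, one_mul]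

theorem abs_gibbsAvg_le (hr : 0 < r) {u : Space N → ℝ} (hu : Continuous u) (w : Space N)
    {f : ballPair N r → ℝ} (hf : Continuous f) {c : ℝ} (hc : ∀ p, |f p| ≤ c) :
    |gibbsAvg r β u w f| ≤ c := by
  have h1 := gibbsAvg_mono (β := β) hr hu w continuous_const hf fun p => (abs_le.1 (hc p)).1
  have h2 := gibbsAvg_mono (β := β) hr hu w hf continuous_const fun p => (abs_le.1 (hc p)).2
  rw [gibbsAvg_const hr hu] at h1 h2
  exact abs_le.2 ⟨h1, h2⟩

/-- The exponentially weighted average of `φ` over the ball at `w`. -/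
def expAvg (r β : ℝ) (u φ : Space N → ℝ) (w : Space N) : ℝ :=
  (∫ y in closedBall w r, φ y * Real.exp (β * u y)) / ∫ y in closedBall w r, Real.exp (β * u y)

/-- The Gibbs density is a product of a weight exp(βu) in the first point and exp(-βu) in the
second, so each half of the pair difference only sees one marginal. -/
theorem gibbsAvg_pairDiff (hr : 0 < r) {u φ : Space N → ℝ} (hu : Continuous u) (hφ : Continuous φ)
    (w : Space N) :
    gibbsAvg r β u w (pairDiff φ w) =
      expAvg r β u φ w - expAvg r β (fun y => -u y) φ w := by
  have hshift : ∀ F : Space N → ℝ,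
      ∫ y in closedBall w r, F y = ∫ y in closedBall (0 : Space N) r, F (w + y) := by
    intro F
    have := setIntegral_closedBall_add F 0 w r
    rw [zero_add] at this
    rw [← this]
    simp only [add_comm]
  set M₁ := ∫ y in closedBall w r, Real.exp (β * u y) with hM₁
  set M₂ := ∫ y in closedBall w r, Real.exp (β * -u y) with hM₂
  have h1 : 0 < M₁ := setIntegral_closedBall_pos hr (by fun_prop) (fun _ => Real.exp_pos _) w
  have h2 : 0 < M₂ := setIntegral_closedBall_pos hr (by fun_prop) (fun _ => Real.exp_pos _) w
  have hexp : ∀ p : ballPair N r, Real.exp (β * pairDiff u w p) =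
      Real.exp (β * u (w + p.1.1)) * Real.exp (β * -u (w + p.1.2)) := by
    intro p
    rw [← Real.exp_add, pairDiff]
    ring_nf
  have hZ : gibbsMass r β u w = M₁ * M₂ := by
    simp only [gibbsMass, hexp]
    rw [integral_pairVol_mul (fun x => Real.exp (β * u (w + x)))
      (fun x => Real.exp (β * -u (w + x))), hM₁, hM₂, hshift, hshift fun y => Real.exp (β * -u y)]
  have hsplit : ∀ p : ballPair N r, gibbsDensity r β u w p * pairDiff φ w p =
      (M₁ * M₂)⁻¹ * ((φ (w + p.1.1) * Real.exp (β * u (w + p.1.1))) *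
        Real.exp (β * -u (w + p.1.2))) - (M₁ * M₂)⁻¹ * (Real.exp (β * u (w + p.1.1)) *
        (φ (w + p.1.2) * Real.exp (β * -u (w + p.1.2)))) := by
    intro p
    rw [gibbsDensity, hexp, hZ, pairDiff, div_eq_mul_inv]
    ring
  rw [gibbsAvg]
  simp only [hsplit]
  rw [integral_sub, integral_const_mul, integral_const_mul,
    integral_pairVol_mul (fun x => φ (w + x) * Real.exp (β * u (w + x)))
      (fun x => Real.exp (β * -u (w + x))),
    integral_pairVol_mul (fun x => Real.exp (β * u (w + x)))
      (fun x => φ (w + x) * Real.exp (β * -u (w + x))),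
    ← hshift fun y => φ y * Real.exp (β * u y), ← hshift fun y => Real.exp (β * -u y),
    ← hshift fun y => Real.exp (β * u y), ← hshift fun y => φ y * Real.exp (β * -u y), expAvg,
    expAvg, ← hM₁, ← hM₂]
  · field_simp
  · exact integrable_of_continuous_ballPair _ (by fun_prop)
  · exact integrable_of_continuous_ballPair _ (by fun_prop)

/-- Fubini, with the symmetry of the relation |x - w| ≤ r. -/
theorem integral_mul_setIntegral_closedBall {F H : Space N → ℝ} (hF : Continuous F)
    (hH : Continuous H) (hc : HasCompactSupport F) :
    ∫ x, F x * ∫ w in closedBall x r, H w = ∫ w, H w * ∫ x in closedBall w r, F x := by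
  obtain ⟨R, hR⟩ := hc.isCompact.isBounded.subset_closedBall (0 : Space N)
  have hF0 : ∀ x ∉ closedBall (0 : Space N) R, F x = 0 := fun x hx =>
    image_eq_zero_of_notMem_tsupport fun k => hx (hR k)
  -- H is only continuous, so integrability on the product is obtained by restricting to this
  -- compact set, outside which the integrand vanishes.
  set S : Set (Space N × Space N) := {p | p.1 ∈ closedBall 0 R ∧ dist p.2 p.1 ≤ r}
  have hSc : IsClosed S := (isClosed_closedBall.preimage continuous_fst).inter
    (isClosed_le (continuous_snd.dist continuous_fst) continuous_const)
  have hS : IsCompact S := by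
    refine ((isCompact_closedBall (0 : Space N) R).prod
      (isCompact_closedBall (0 : Space N) (R + r))).of_isClosed_subset hSc fun p hp => ⟨hp.1, ?_⟩
    have h1 := hp.1
    rw [mem_closedBall] at h1 ⊢
    linarith [hp.2, dist_triangle p.2 p.1 0]
  have hint : Integrable (Function.uncurry fun x w => S.indicator (fun p => F p.1 * H p.2) (x, w))
      (volume.prod volume) := by
    change Integrable (S.indicator fun p => F p.1 * H p.2) _
    rw [integrable_indicator_iff hSc.measurableSet]
    exact (by fun_prop : Continuous fun p : Space N × Space N => F p.1 * H p.2).continuousOn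
      |>.integrableOn_compact hS
  have hswap := integral_integral_swap hint
  have hval : ∀ x w, S.indicator (fun p => F p.1 * H p.2) (x, w) =
      F x * (closedBall x r).indicator H w := by
    intro x w
    by_cases hx : x ∈ closedBall (0 : Space N) R
    · by_cases hw : w ∈ closedBall x r
      · rw [indicator_of_mem (show (x, w) ∈ S from ⟨hx, hw⟩), indicator_of_mem hw]
      · rw [indicator_of_notMem (show (x, w) ∉ S from fun k => hw k.2), indicator_of_notMem hw,
          mul_zero]
    · rw [indicator_of_notMem (show (x, w) ∉ S from fun k => hx k.1), hF0 x hx, zero_mul]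
  have hval' : ∀ x w, F x * (closedBall x r).indicator H w =
      H w * (closedBall w r).indicator F x := by
    intro x w
    by_cases hw : w ∈ closedBall x r
    · rw [indicator_of_mem hw, indicator_of_mem (mem_closedBall_comm.1 hw), mul_comm]
    · rw [indicator_of_notMem hw, indicator_of_notMem fun k => hw (mem_closedBall_comm.1 k),
        mul_zero, mul_zero]
  simp only [hval, integral_const_mul] at hswap
  simp only [← integral_indicator measurableSet_closedBall]
  rw [hswap]
  simp only [hval', integral_const_mul]

theorem softMax_eq (u : Space N → ℝ) (x : Space N) :
    softMax r β u x = Real.exp (β * u x) *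
      ∫ w in closedBall x r, (∫ y in closedBall w r, Real.exp (β * u y))⁻¹ := by
  rw [softMax, ← integral_const_mul]
  congr 1 with w
  have : expMass r β u x w =
      (Real.exp (β * u x))⁻¹ * ∫ y in closedBall w r, Real.exp (β * u y) := by
    rw [expMass, ← integral_const_mul]
    congr 1 with y
    rw [← Real.exp_neg, ← Real.exp_add]
    ring_nf
  rw [this, mul_inv, inv_inv]

theorem continuous_inv_setIntegral_exp (hr : 0 < r) {u : Space N → ℝ} (hu : Continuous u) :
    Continuous fun w => (∫ y in closedBall w r, Real.exp (β * u y))⁻¹ :=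
  (continuous_setIntegral_closedBall (by fun_prop) r).inv₀ fun w =>
    (setIntegral_closedBall_pos hr (by fun_prop) (fun _ => Real.exp_pos _) w).ne'

theorem continuous_softMax (hr : 0 < r) {u : Space N → ℝ} (hu : Continuous u) :
    Continuous (softMax r β u) := by
  simp only [funext (softMax_eq (r := r) (β := β) u)]
  exact (by fun_prop : Continuous fun x => Real.exp (β * u x)).mul
    (continuous_setIntegral_closedBall (continuous_inv_setIntegral_exp hr hu) r)

/-- `softMax` is the density at x of the superposition over w of the exponentially weighted
probability measures on the balls at w; integrating φ against it and exchanging the order gives the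
averages of φ. -/
theorem integral_mul_softMax (hr : 0 < r) {u φ : Space N → ℝ} (hu : Continuous u)
    (hφ : Continuous φ) (hc : HasCompactSupport φ) :
    ∫ x, φ x * softMax r β u x = ∫ w, expAvg r β u φ w := by
  simp only [softMax_eq, ← mul_assoc]
  refine (integral_mul_setIntegral_closedBall (F := fun x => φ x * Real.exp (β * u x))
    (by fun_prop) (continuous_inv_setIntegral_exp hr hu) hc.mul_right).trans ?_
  congr 1 with w
  rw [expAvg, div_eq_mul_inv, mul_comm]

theorem expAvg_eq_zero {u φ : Space N → ℝ} {w : Space N} (h : ∀ x ∈ closedBall w r, φ x = 0) :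
    expAvg r β u φ w = 0 := by
  rw [expAvg, setIntegral_eq_zero_of_forall_eq_zero fun x hx => by rw [h x hx, zero_mul], zero_div]

theorem integrable_expAvg (hr : 0 < r) {u φ : Space N → ℝ} (hu : Continuous u)
    (hφ : Continuous φ) (hc : HasCompactSupport φ) : Integrable (expAvg r β u φ) volume := by
  obtain ⟨R, hR⟩ := exists_forall_eq_zero hc r
  refine Continuous.integrable_of_hasCompactSupport ?_
    (HasCompactSupport.intro (isCompact_closedBall 0 R) fun w hw => expAvg_eq_zero (hR w hw))
  exact (continuous_setIntegral_closedBall (by fun_prop) r).div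
    (continuous_setIntegral_closedBall (by fun_prop) r) fun w =>
      (setIntegral_closedBall_pos hr (by fun_prop) (fun _ => Real.exp_pos _) w).ne'

/-- The weak form of the regularised equation. -/
theorem integral_gibbsAvg_pairDiff (hr : 0 < r) {g u φ : Space N → ℝ}
    (hu : Continuous u) (hs : ∀ x, u x + softOp r h β u x = g x)
    (hφ : Continuous φ) (hc : HasCompactSupport φ) :
    h * (1 / (2 * r)) * ∫ w, gibbsAvg r β u w (pairDiff φ w) = ∫ x, φ x * (g x - u x) := by
  have hun : Continuous fun y => -u y := hu.neg
  have hi : Integrable (fun x => φ x * softMax r β u x) volume :=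
    (hφ.mul (continuous_softMax hr hu)).integrable_of_hasCompactSupport hc.mul_right
  have hi' : Integrable (fun x => φ x * softMax r β (fun y => -u y) x) volume :=
    (hφ.mul (continuous_softMax hr hun)).integrable_of_hasCompactSupport hc.mul_right
  simp only [gibbsAvg_pairDiff hr hu hφ]
  rw [integral_sub (integrable_expAvg hr hu hφ hc) (integrable_expAvg hr hun hφ hc),
    ← integral_mul_softMax hr hu hφ hc, ← integral_mul_softMax hr hun hφ hc,
    ← integral_sub hi hi', ← integral_const_mul]
  congr 1 with x
  rw [← hs x, softOp]
  ring

end NonlocalROF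

end

/-! ### Estimates uniform in β: distance to the datum and concentration. -/

noncomputable section

namespace NonlocalROF

open Metric Set

variable {N : ℕ} {r h β : ℝ} {L : ℝ≥0}

/-- The tent function of height one at `x`. -/
def tent (x y : Space N) : ℝ := max 0 (1 - dist y x)

theorem continuous_tent (x : Space N) : Continuous (tent x) := by
  unfold tent
  fun_prop

theorem tent_nonneg (x y : Space N) : 0 ≤ tent x y := le_max_left _ _

theorem tent_le_one (x y : Space N) : tent x y ≤ 1 :=
  max_le zero_le_one (by linarith [dist_nonneg (x := y) (y := x)])

theorem tent_eq_zero {x y : Space N} (hy : y ∉ closedBall x 1) : tent x y = 0 := by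
  rw [mem_closedBall, not_le] at hy
  exact max_eq_left (by linarith)

theorem hasCompactSupport_tent (x : Space N) : HasCompactSupport (tent x) :=
  HasCompactSupport.intro (isCompact_closedBall x 1) fun _ hy => tent_eq_zero hy

theorem integral_tent (x : Space N) : ∫ y, tent x y = ∫ y, tent (0 : Space N) y := by
  rw [← integral_sub_right_eq_self (tent (0 : Space N)) x]
  simp [tent, dist_eq_norm]

theorem integral_tent_pos (x : Space N) : 0 < ∫ y, tent x y :=
  (continuous_tent x).integral_pos_of_hasCompactSupport_nonneg_nonzero (hasCompactSupport_tent x)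
    (tent_nonneg x) (x := x) (by simp [tent])

/-- A bound for `g - u` that depends neither on `β` nor on `g`. -/
theorem exists_abs_sub_le (hr : 0 < r) (hh : 0 < h) (N : ℕ) (L : ℝ≥0) :
    ∃ C : ℝ, ∀ (β : ℝ) (g u : Space N → ℝ), LipschitzWith L g → LipschitzWith L u →
      (∀ x, u x + softOp r h β u x = g x) → ∀ x, |g x - u x| ≤ C := by
  set m := ∫ y, tent (0 : Space N) y
  have hm : 0 < m := integral_tent_pos 0
  set V := volume.real (closedBall (0 : Space N) (1 + r))
  have hc : 0 < h * (1 / (2 * r)) := by positivity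
  -- Testing with a unit tent, whose integral is m, costs c V for the divergence term, since the
  -- averages are at most one and vanish outside a ball of radius 1 + r, and 2Lm for replacing g - u
  -- on the unit ball by its value at x.
  refine ⟨(h * (1 / (2 * r)) * V + 2 * L * m) / m, fun β g u hg hu hs x => ?_⟩
  rw [le_div_iff₀ hm]
  set φ := tent x
  have hφ : Continuous φ := continuous_tent x
  have hφc : HasCompactSupport φ := hasCompactSupport_tent x
  have hd : Continuous fun y => g y - u y := hg.continuous.sub hu.continuous
  have hweak := integral_gibbsAvg_pairDiff hr hu.continuous hs hφ hφc
  have h1 : |∫ w, gibbsAvg r β u w (pairDiff φ w)| ≤ V := by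
    have hzero : ∀ w ∉ closedBall x (1 + r), gibbsAvg r β u w (pairDiff φ w) = 0 := by
      intro w hw
      have h0 : ∀ p : ballPair N r, pairDiff φ w p = 0 := pairDiff_eq_zero fun y hy =>
        tent_eq_zero fun k => hw (by
          rw [mem_closedBall] at *
          linarith [dist_triangle_left w x y])
      simp [gibbsAvg, h0]
    have hone : ∀ w ∈ closedBall x (1 + r), ‖gibbsAvg r β u w (pairDiff φ w)‖ ≤ 1 := fun w _ => by
      refine abs_gibbsAvg_le hr hu.continuous w (continuous_pairDiff_right hφ w) fun p => ?_
      unfold pairDiff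
      exact abs_le.2 ⟨by linarith [tent_nonneg x (w + p.1.1), tent_le_one x (w + p.1.2)],
        by linarith [tent_nonneg x (w + p.1.2), tent_le_one x (w + p.1.1)]⟩
    have hle := norm_setIntegral_le_of_norm_le_const (μ := volume)
      (measure_closedBall_lt_top (x := x) (r := 1 + r)) hone
    rwa [setIntegral_eq_integral_of_forall_compl_eq_zero hzero, one_mul,
      measureReal_closedBall_eq x 0] at hle
  have hi₁ : Integrable (fun y => φ y * (g y - u y)) volume :=
    (hφ.mul hd).integrable_of_hasCompactSupport hφc.mul_right
  have hi₂ : Integrable (fun y => φ y * ((g x - u x) - (g y - u y))) volume :=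
    (hφ.mul (continuous_const.sub hd)).integrable_of_hasCompactSupport hφc.mul_right
  have h2 : (g x - u x) * m =
      (∫ y, φ y * (g y - u y)) + ∫ y, φ y * ((g x - u x) - (g y - u y)) := by
    rw [← integral_add hi₁ hi₂, show m = ∫ y, tent x y from (integral_tent x).symm,
      ← integral_const_mul]
    congr 1 with y
    ring
  have h3 : |∫ y, φ y * ((g x - u x) - (g y - u y))| ≤ 2 * L * m := by
    rw [show m = ∫ y, tent x y from (integral_tent x).symm, ← integral_const_mul]
    refine (norm_integral_le_integral_norm _).trans (integral_mono hi₂.norm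
      ((hφ.integrable_of_hasCompactSupport hφc).const_mul _) fun y => ?_)
    rw [Real.norm_eq_abs, abs_mul, abs_of_nonneg (tent_nonneg x y), mul_comm]
    by_cases hy : y ∈ closedBall x 1
    · refine mul_le_mul_of_nonneg_right ?_ (tent_nonneg x y)
      have e1 := hg.dist_le_mul x y
      have e2 := hu.dist_le_mul x y
      have e3 : (L : ℝ) * dist x y ≤ L * 1 :=
        mul_le_mul_of_nonneg_left (mem_closedBall'.1 hy) L.2
      rw [Real.dist_eq] at e1 e2
      have e4 := abs_sub (g x - g y) (u x - u y)
      rw [show g x - u x - (g y - u y) = g x - g y - (u x - u y) by ring]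
      linarith
    · simp [φ, tent_eq_zero hy]
  have h4 : |(g x - u x) * m| = |g x - u x| * m := by rw [abs_mul, abs_of_pos hm]
  rw [← h4, h2, ← hweak]
  refine (abs_add_le _ _).trans (add_le_add ?_ h3)
  rw [abs_mul, abs_of_pos hc]
  exact mul_le_mul_of_nonneg_left h1 hc.le

/-- An extremal point a may lie on the boundary sphere; moving the centre inwards by at most δ makes
room for a full δ-ball, which stays within 2δ of a. -/
theorem smul_mem_and_closedBall_subset {δ : ℝ} (hr : 0 < r) (hδ : 0 ≤ δ) (hδr : δ ≤ r)
    {a : Space N} (ha : a ∈ closedBall (0 : Space N) r) :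
    closedBall ((1 - δ / r) • a) δ ⊆ closedBall 0 r ∩ closedBall a (2 * δ) := by
  have h0 : 0 ≤ δ / r := by positivity
  have h1 : δ / r ≤ 1 := (div_le_one hr).2 hδr
  have hrδ : δ / r * r = δ := div_mul_cancel₀ _ hr.ne'
  rw [mem_closedBall_zero_iff] at ha
  intro x hx
  rw [mem_closedBall, dist_eq_norm] at hx
  refine ⟨?_, ?_⟩
  · rw [mem_closedBall_zero_iff]
    have h2 : ‖x‖ ≤ ‖x - (1 - δ / r) • a‖ + ‖(1 - δ / r) • a‖ := by
      simpa using norm_add_le (x - (1 - δ / r) • a) ((1 - δ / r) • a)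
    rw [norm_smul, Real.norm_of_nonneg (sub_nonneg.2 h1)] at h2
    nlinarith
  · rw [mem_closedBall, dist_eq_norm]
    have h2 : ‖x - a‖ ≤ ‖x - (1 - δ / r) • a‖ + ‖(δ / r) • a‖ := by
      refine (norm_sub_le (x - (1 - δ / r) • a) ((δ / r) • a)).trans' (le_of_eq ?_)
      congr 1
      rw [sub_smul, one_smul]
      abel
    rw [norm_smul, Real.norm_of_nonneg h0] at h2
    nlinarith

/-- The Gibbs measures concentrate on the pairs that realise the oscillation, uniformly for
`L`-Lipschitz functions. -/
theorem exists_gibbsAvg_le (hr : 0 < r) (N : ℕ) (L : ℝ≥0) {ε : ℝ} (hε : 0 < ε) :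
    ∃ K : ℝ, ∀ (β : ℝ) (u : Space N → ℝ), 0 < β → LipschitzWith L u → ∀ w,
      gibbsAvg r β u w (fun p => ballOsc r u w - pairDiff u w p) ≤ ε + K / β := by
  -- Each of the two extremal points moves by at most 2δ, which changes the pair difference by at
  -- most 4Lδ ≤ ε.
  set δ : ℝ := min r (ε / (4 * (L + 1)))
  have hL : (0 : ℝ) ≤ L := L.2
  have hδ : 0 < δ := lt_min hr (by positivity)
  have hδr : δ ≤ r := min_le_left _ _
  have hδε : 4 * L * δ ≤ ε := by
    have h1 : δ * (4 * (L + 1)) ≤ ε := (le_div_iff₀ (by positivity)).1 (min_le_right _ _)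
    nlinarith
  set c := volume.real (closedBall (0 : Space N) δ)
  have hc : 0 < c := measureReal_closedBall_pos hδ 0
  set V := (pairVol N r).real univ
  refine ⟨V / (c * c), fun β u hβ hu w => ?_⟩
  have huc := hu.continuous
  set m := ballOsc r u w
  have hZ : 0 < gibbsMass r β u w := gibbsMass_pos hr huc w
  have hlow : c * c * Real.exp (β * (m - ε)) ≤ gibbsMass r β u w := by
    obtain ⟨x, hx, y, hy, hxy⟩ := exists_eq_ballOsc hr.le huc w
    have ha : x - w ∈ closedBall (0 : Space N) r := by
      rwa [mem_closedBall_zero_iff, ← dist_eq_norm]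
    have hb : y - w ∈ closedBall (0 : Space N) r := by
      rwa [mem_closedBall_zero_iff, ← dist_eq_norm]
    have sa := smul_mem_and_closedBall_subset hr hδ.le hδr ha
    have sb := smul_mem_and_closedBall_subset hr hδ.le hδr hb
    set a' := (1 - δ / r) • (x - w)
    set b' := (1 - δ / r) • (y - w)
    set F : Space N × Space N → ℝ := fun p => Real.exp (β * (u (w + p.1) - u (w + p.2)))
    have hF : Continuous F := by fun_prop
    have hFi : IntegrableOn F (ballPair N r) volume := hF.continuousOn.integrableOn_compact
      ((isCompact_closedBall 0 r).prod (isCompact_closedBall 0 r))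
    have hsub : closedBall a' δ ×ˢ closedBall b' δ ⊆ ballPair N r :=
      prod_mono (sa.trans inter_subset_left) (sb.trans inter_subset_left)
    have h1 : gibbsMass r β u w = ∫ p in ballPair N r, F p := integral_pairVol F
    have h2 : volume.real (closedBall a' δ ×ˢ closedBall b' δ) = c * c := by
      rw [Measure.volume_eq_prod, measureReal_prod_prod, measureReal_closedBall_eq a' 0,
        measureReal_closedBall_eq b' 0]
    rw [h1, ← h2]
    refine le_trans ?_ (setIntegral_mono_set hFi (Eventually.of_forall fun p => (Real.exp_pos _).le)
      hsub.eventuallyLE)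
    rw [← smul_eq_mul, ← setIntegral_const]
    refine setIntegral_mono_on (integrableOn_const (measure_mono hsub |>.trans_lt
      ((isCompact_closedBall 0 r).prod (isCompact_closedBall 0 r)).measure_lt_top).ne)
      (hFi.mono_set hsub) (measurableSet_closedBall.prod measurableSet_closedBall) fun p hp => ?_
    refine Real.exp_le_exp.2 (mul_le_mul_of_nonneg_left ?_ hβ.le)
    have e1 := (hu.dist_le_mul x (w + p.1)).trans
      (mul_le_mul_of_nonneg_left (show dist x (w + p.1) ≤ 2 * δ by
        have := (sa hp.1).2
        rw [mem_closedBall, dist_comm, dist_eq_norm] at this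
        rwa [dist_eq_norm, ← sub_sub]) hL)
    have e2 := (hu.dist_le_mul (w + p.2) y).trans
      (mul_le_mul_of_nonneg_left (show dist (w + p.2) y ≤ 2 * δ by
        have := (sb hp.2).2
        rw [mem_closedBall, dist_comm, dist_eq_norm] at this
        rwa [dist_comm, dist_eq_norm, ← sub_sub]) hL)
    have e3 := (le_abs_self _).trans e1
    have e4 := (le_abs_self _).trans e2
    simp only [m]
    rw [← hxy]
    linarith
  have hcont : Continuous fun p : ballPair N r => m - pairDiff u w p :=
    continuous_const.sub (continuous_pairDiff_right huc w)
  -- The Gibbs weight cancels the exponential of the pair difference, so this exponential moment is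
  -- explicit; with the lower bound on the partition function, it is at most a constant times
  -- exp(βε).
  have havg : gibbsAvg r β u w (fun p => Real.exp (β * (m - pairDiff u w p))) =
      V * Real.exp (β * m) / gibbsMass r β u w := by
    have : ∀ p : ballPair N r, gibbsDensity r β u w p * Real.exp (β * (m - pairDiff u w p)) =
        Real.exp (β * m) / gibbsMass r β u w := by
      intro p
      rw [gibbsDensity, div_mul_eq_mul_div, ← Real.exp_add]
      ring_nf
    simp only [gibbsAvg, this]
    rw [integral_const, smul_eq_mul, mul_div_assoc]
  -- This is 1 + s ≤ exp(s) at s = β(m - pair difference) - βε, which converts the exponential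
  -- moment into a first moment.
  have hpt : ∀ p : ballPair N r, β * (m - pairDiff u w p) ≤
      Real.exp (-(β * ε)) * Real.exp (β * (m - pairDiff u w p)) + β * ε := by
    intro p
    have := Real.add_one_le_exp (-(β * ε) + β * (m - pairDiff u w p))
    rw [Real.exp_add] at this
    linarith
  have hmain : β * gibbsAvg r β u w (fun p => m - pairDiff u w p) ≤
      Real.exp (-(β * ε)) * (V * Real.exp (β * m) / gibbsMass r β u w) + β * ε := by
    have e := gibbsAvg_mono (β := β) hr huc w (f := fun p => β * (m - pairDiff u w p))
      (g := fun p => Real.exp (-(β * ε)) * Real.exp (β * (m - pairDiff u w p)) + β * ε)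
      (by fun_prop) (by fun_prop) hpt
    have l : gibbsAvg r β u w (fun p => β * (m - pairDiff u w p)) =
        β * gibbsAvg r β u w (fun p => m - pairDiff u w p) := by
      rw [gibbsAvg, gibbsAvg, ← integral_const_mul]
      congr 1 with p
      ring
    have l' : gibbsAvg r β u w (fun p => Real.exp (-(β * ε)) *
        Real.exp (β * (m - pairDiff u w p)) + β * ε) = Real.exp (-(β * ε)) *
        gibbsAvg r β u w (fun p => Real.exp (β * (m - pairDiff u w p))) + β * ε := by
      have k := gibbsAvg_const (β := β) hr huc w (β * ε)
      simp only [gibbsAvg, mul_add] at k ⊢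
      rw [integral_add, k, ← integral_const_mul]
      · congr 2 with p
        ring
      · exact integrable_gibbsDensity_mul hr huc w (by fun_prop)
      · exact integrable_gibbsDensity_mul hr huc w continuous_const
    rw [← l, ← havg]
    exact e.trans (le_of_eq l')
  have hfrac : Real.exp (-(β * ε)) * (V * Real.exp (β * m) / gibbsMass r β u w) ≤ V / (c * c) := by
    rw [mul_div_assoc', div_le_div_iff₀ hZ (by positivity)]
    have e : Real.exp (-(β * ε)) * (V * Real.exp (β * m)) = V * Real.exp (β * (m - ε)) := by
      rw [mul_left_comm, ← Real.exp_add]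
      ring_nf
    rw [e, mul_assoc]
    refine mul_le_mul_of_nonneg_left ?_ measureReal_nonneg
    linarith
  have : gibbsAvg r β u w (fun p => m - pairDiff u w p) ≤ (V / (c * c) + β * ε) / β := by
    rw [le_div_iff₀ hβ]
    linarith
  refine this.trans (le_of_eq ?_)
  field_simp
  ring

end NonlocalROF

end

/-! ### Weak compactness of Gibbs fields. -/

noncomputable section

namespace NonlocalROF

open Metric Set ProbabilityTheory

variable {N : ℕ} {r h β : ℝ} {L : ℝ≥0}

instance instStandardBorelSpaceBallPair : StandardBorelSpace (ballPair N r) :=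
  measurableSet_ballPair.standardBorel

/-- The Gibbs measures of the pair differences as a Markov kernel. -/
def gibbsKernel (r β : ℝ) (u : Space N → ℝ) : Kernel (Space N) (ballPair N r) :=
  Kernel.withDensity (Kernel.const _ (pairVol N r))
    fun w p => ENNReal.ofReal (gibbsDensity r β u w p)

theorem gibbsKernel_apply (hr : 0 < r) {u : Space N → ℝ} (hu : Continuous u) (w : Space N) :
    gibbsKernel r β u w =
      (pairVol N r).withDensity fun p => ENNReal.ofReal (gibbsDensity r β u w p) :=
  Kernel.withDensity_apply _ (continuous_gibbsDensity hr hu).measurable.ennreal_ofReal w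

theorem isMarkovKernel_gibbsKernel (hr : 0 < r) {u : Space N → ℝ} (hu : Continuous u) :
    IsMarkovKernel (gibbsKernel r β u) := by
  refine ⟨fun w => ⟨?_⟩⟩
  rw [gibbsKernel_apply hr hu, withDensity_apply _ MeasurableSet.univ, Measure.restrict_univ,
    ← ofReal_integral_eq_lintegral_ofReal
      (integrable_of_continuous_ballPair _ (continuous_gibbsDensity_right hr hu w))
      (Eventually.of_forall fun p => gibbsDensity_nonneg hr hu w p),
    integral_gibbsDensity hr hu, ENNReal.ofReal_one]

theorem integral_gibbsKernel (hr : 0 < r) {u : Space N → ℝ} (hu : Continuous u) (w : Space N)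
    (f : ballPair N r → ℝ) : ∫ p, f p ∂(gibbsKernel r β u w) = gibbsAvg r β u w f := by
  rw [gibbsKernel_apply hr hu, integral_withDensity_eq_integral_toReal_smul
    (continuous_gibbsDensity_right hr hu w).measurable.ennreal_ofReal
    (Eventually.of_forall fun _ => ENNReal.ofReal_lt_top)]
  simp only [ENNReal.toReal_ofReal (gibbsDensity_nonneg hr hu w _), smul_eq_mul]
  rfl

/-- There is a probability measure with a positive continuous density. -/
theorem exists_probability_density (N : ℕ) :
    ∃ ρ : Space N → ℝ, Continuous ρ ∧ (∀ x, 0 < ρ x) ∧ Integrable ρ volume ∧ ∫ x, ρ x = 1 := by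
  set ρ₀ : Space N → ℝ := fun x => (1 + ‖x‖) ^ (-((N : ℝ) + 1))
  have hi : Integrable ρ₀ volume := integrable_one_add_norm (by simp)
  have hpos : ∀ x, 0 < ρ₀ x := fun x => Real.rpow_pos_of_pos (by positivity) _
  have hc : Continuous ρ₀ := (by fun_prop : Continuous fun x : Space N => 1 + ‖x‖).rpow_const
    fun x => Or.inl (by positivity)
  have hI : 0 < ∫ x, ρ₀ x := by
    rw [integral_pos_iff_support_of_nonneg (fun x => (hpos x).le) hi]
    have : Function.support ρ₀ = univ := by
      ext x
      simpa using (hpos x).ne'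
    rw [this]
    exact isOpen_univ.measure_pos _ univ_nonempty
  refine ⟨fun x => ρ₀ x / ∫ x, ρ₀ x, hc.div_const _, fun x => div_pos (hpos x) hI,
    hi.div_const _, ?_⟩
  rw [integral_div, div_self hI.ne']

/-- Weak compactness of sequences of Gibbs fields. -/
theorem exists_limit_field (hr : 0 < r) (β : ℕ → ℝ) (u : ℕ → Space N → ℝ)
    (hu : ∀ n, Continuous (u n)) :
    ∃ z : Space N → FiniteMeasure (ballPair N r), IsBoundedField r z ∧ (∀ w, (z w).mass = 1) ∧
      ∀ F : Space N × ballPair N r → ℝ, Continuous F →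
        (∃ R, ∀ w ∉ closedBall (0 : Space N) R, ∀ p, F (w, p) = 0) →
        Tendsto (fun n => ∫ w, gibbsAvg r (β n) (u n) w fun p => F (w, p)) (hyperfilter ℕ)
          (𝓝 (∫ w, ∫ p, F (w, p) ∂(z w : Measure (ballPair N r)))) := by
  obtain ⟨ρ, hρc, hρ, hρi, hρ1⟩ := exists_probability_density N
  set ν : Measure (Space N) := volume.withDensity fun x => ENNReal.ofReal (ρ x) with hν
  have hνp : IsProbabilityMeasure ν := by
    refine ⟨?_⟩
    rw [hν, withDensity_apply _ MeasurableSet.univ, Measure.restrict_univ,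
      ← ofReal_integral_eq_lintegral_ofReal hρi (Eventually.of_forall fun x => (hρ x).le), hρ1,
      ENNReal.ofReal_one]
  have hνint : ∀ f : Space N → ℝ, ∫ x, f x ∂ν = ∫ x, ρ x * f x := fun f => by
    rw [hν, integral_withDensity_eq_integral_toReal_smul hρc.measurable.ennreal_ofReal
      (Eventually.of_forall fun _ => ENNReal.ofReal_lt_top)]
    simp only [ENNReal.toReal_ofReal (hρ _).le, smul_eq_mul]
  have hκ : ∀ n, IsMarkovKernel (gibbsKernel r (β n) (u n)) := fun n =>
    isMarkovKernel_gibbsKernel hr (hu n)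
  -- Lebesgue measure is replaced by an equivalent probability measure ν, so that fields become
  -- probability measures with fixed first marginal ν; with the compact second factor, they are
  -- tight.
  let P : ℕ → ProbabilityMeasure (Space N × ballPair N r) := fun n =>
    ⟨ν ⊗ₘ gibbsKernel r (β n) (u n), inferInstance⟩
  have hPfst : ∀ n, (P n : Measure (Space N × ballPair N r)).fst = ν := fun n =>
    Measure.fst_compProd _ _
  have htight : IsTightMeasureSet
      {((μ : ProbabilityMeasure (Space N × ballPair N r)) : Measure (Space N × ballPair N r)) |
        μ ∈ range P} := by
    rw [isTightMeasureSet_iff_exists_isCompact_measure_compl_le]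
    intro ε hε
    obtain ⟨K, hK, hKε⟩ := (isTightMeasureSet_iff_exists_isCompact_measure_compl_le.1
      (isTightMeasureSet_singleton (μ := ν))) ε hε
    refine ⟨K ×ˢ univ, hK.prod isCompact_univ, ?_⟩
    rintro _ ⟨_, ⟨n, rfl⟩, rfl⟩
    have : (K ×ˢ (univ : Set (ballPair N r)))ᶜ = Prod.fst ⁻¹' Kᶜ := by
      ext q
      simp
    rw [this, ← Measure.fst_apply hK.measurableSet.compl, hPfst]
    exact hKε ν rfl
  -- Prokhorov's theorem along an ultrafilter. Disintegrating Q over its first marginal, again ν,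
  -- gives the limit field.
  obtain ⟨Q, -, hQ⟩ := (isCompact_closure_of_isTightMeasureSet htight).ultrafilter_le_nhds
    ((hyperfilter ℕ).map P) (by
      rw [Ultrafilter.coe_map]
      exact (tendsto_principal.2 (Eventually.of_forall fun n => subset_closure (mem_range_self n))))
  have hlim : Tendsto P (hyperfilter ℕ) (𝓝 Q) := hQ
  have hQfst : (Q : Measure (Space N × ballPair N r)).fst = ν := by
    have h1 := ProbabilityMeasure.tendsto_map_of_tendsto_of_continuous P Q hlim
      (continuous_fst (X := Space N) (Y := ballPair N r))
    have h2 : ∀ n, (P n).map (continuous_fst.measurable.aemeasurable) =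
        (⟨ν, hνp⟩ : ProbabilityMeasure (Space N)) := fun n => Subtype.ext (hPfst n)
    simp only [h2] at h1
    have h3 := tendsto_nhds_unique h1 tendsto_const_nhds
    exact congrArg Subtype.val h3
  have hne : Nonempty (ballPair N r) :=
    ⟨⟨(0, 0), mem_closedBall_self hr.le, mem_closedBall_self hr.le⟩⟩
  set κ := (Q : Measure (Space N × ballPair N r)).condKernel with hκdef
  let z : Space N → FiniteMeasure (ballPair N r) := fun w => ⟨κ w, inferInstance⟩
  have hmass : ∀ w, (z w).mass = 1 := fun w => ENNReal.coe_injective (by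
    rw [FiniteMeasure.ennreal_mass]
    exact measure_univ (μ := κ w))
  refine ⟨z, ⟨fun f => ?_, ?_⟩, hmass, fun F hF ⟨R, hR⟩ => ?_⟩
  · exact ((map_continuous f).stronglyMeasurable.integral_kernel (κ := κ)).measurable.aemeasurable
  · simp only [hmass]
    exact memLp_top_const _
  -- Dividing the test function by ρ turns integrals against ν back into Lebesgue integrals.
  · have hG : Continuous fun q : Space N × ballPair N r => (ρ q.1)⁻¹ * F q :=
      ((hρc.comp continuous_fst).inv₀ fun q => (hρ q.1).ne').mul hF
    have hGs : HasCompactSupport fun q : Space N × ballPair N r => (ρ q.1)⁻¹ * F q :=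
      HasCompactSupport.intro ((isCompact_closedBall 0 R).prod isCompact_univ) fun q hq => by
        rw [show F q = 0 from hR q.1 (fun k => hq ⟨k, mem_univ _⟩) q.2, mul_zero]
    obtain ⟨C, hC⟩ := hG.bounded_above_of_compact_support hGs
    have hGi : ∀ μ : Measure (Space N × ballPair N r), IsFiniteMeasure μ →
        Integrable (fun q : Space N × ballPair N r => (ρ q.1)⁻¹ * F q) μ := fun μ _ =>
      Integrable.of_bound hG.aestronglyMeasurable C (Eventually.of_forall hC)
    have h1 := (ProbabilityMeasure.tendsto_iff_forall_integral_tendsto.1 hlim)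
      (BoundedContinuousFunction.ofNormedAddCommGroup _ hG C hC)
    simp only [BoundedContinuousFunction.coe_ofNormedAddCommGroup] at h1
    have h2 : ∀ n, ∫ q, (ρ q.1)⁻¹ * F q ∂(P n : Measure (Space N × ballPair N r)) =
        ∫ w, gibbsAvg r (β n) (u n) w fun p => F (w, p) := fun n => by
      refine (Measure.integral_compProd (hGi _ inferInstance)).trans ?_
      rw [hνint]
      congr 1 with w
      dsimp only
      rw [integral_const_mul, integral_gibbsKernel hr (hu n), mul_inv_cancel_left₀ (hρ w).ne']
    have h3 : ∫ q, (ρ q.1)⁻¹ * F q ∂(Q : Measure (Space N × ballPair N r)) =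
        ∫ w, ∫ p, F (w, p) ∂(κ w) := by
      rw [← Measure.integral_condKernel (hGi _ inferInstance), hQfst, hνint]
      congr 1 with w
      dsimp only
      rw [integral_const_mul, mul_inv_cancel_left₀ (hρ w).ne']
    rw [h3] at h1
    simp only [h2] at h1
    exact h1

end NonlocalROF

end

/-! ### Passage to the limit and conclusion. -/

noncomputable section

namespace NonlocalROF

open Metric Set

variable {N : ℕ} {r h β : ℝ} {L : ℝ≥0}

/-- Pointwise convergence of `L`-Lipschitz functions is uniform on balls. -/
theorem eventually_forall_closedBall_abs_sub_le {ι : Type*} {l : Filter ι}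
    {u : ι → Space N → ℝ} {v : Space N → ℝ} (hu : ∀ n, LipschitzWith L (u n))
    (hv : LipschitzWith L v) (hlim : ∀ x, Tendsto (fun n => u n x) l (𝓝 (v x))) (R : ℝ) {ε : ℝ}
    (hε : 0 < ε) : ∀ᶠ n in l, ∀ x ∈ closedBall (0 : Space N) R, |u n x - v x| ≤ ε := by
  have hL : (0 : ℝ) ≤ L := L.2
  set δ : ℝ := ε / (3 * (L + 1))
  have hδ : 0 < δ := by positivity
  have hLδ : L * δ ≤ ε / 3 := by
    have : δ * (L + 1) = ε / 3 := by
      simp only [δ]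
      field_simp
    nlinarith
  obtain ⟨t, -, htf, ht⟩ :=
    finite_cover_balls_of_compact (isCompact_closedBall (0 : Space N) R) hδ
  have hev : ∀ᶠ n in l, ∀ y ∈ t, |u n y - v y| < ε / 3 := by
    rw [htf.eventually_all]
    intro y _
    have := (tendsto_iff_dist_tendsto_zero.1 (hlim y)).eventually
      (gt_mem_nhds (show 0 < ε / 3 by positivity))
    simpa only [Real.dist_eq] using this
  filter_upwards [hev] with n hn x hx
  obtain ⟨y, hy, hxy⟩ := mem_iUnion₂.1 (ht hx)
  have hd : (L : ℝ) * dist x y ≤ ε / 3 :=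
    (mul_le_mul_of_nonneg_left (mem_ball.1 hxy).le hL).trans hLδ
  have e1 := abs_le.1 (((hu n).dist_le_mul x y).trans hd)
  have e2 := abs_le.1 ((hv.dist_le_mul x y).trans hd)
  have e3 := abs_lt.1 (hn y hy)
  exact abs_le.2 ⟨by linarith [e1.1, e2.2, e3.1], by linarith [e1.2, e2.1, e3.2]⟩

/-- A continuous cutoff function that equals one on the ball of radius `R`. -/
def cutoff (R : ℝ) (x : Space N) : ℝ := max 0 (min 1 (R + 1 - ‖x‖))

theorem continuous_cutoff (R : ℝ) : Continuous (cutoff R : Space N → ℝ) := by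
  unfold cutoff
  fun_prop

theorem cutoff_nonneg (R : ℝ) (x : Space N) : 0 ≤ cutoff R x := le_max_left _ _

theorem cutoff_le_one (R : ℝ) (x : Space N) : cutoff R x ≤ 1 :=
  max_le zero_le_one (min_le_left _ _)

theorem cutoff_eq_one {R : ℝ} {x : Space N} (hx : ‖x‖ ≤ R) : cutoff R x = 1 := by
  rw [cutoff, min_eq_left (by linarith), max_eq_right zero_le_one]

theorem cutoff_eq_zero {R : ℝ} {x : Space N} (hx : x ∉ closedBall (0 : Space N) (R + 1)) :
    cutoff R x = 0 := by
  rw [mem_closedBall_zero_iff, not_le] at hx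
  exact max_eq_left ((min_le_right _ _).trans (by linarith))

theorem hasCompactSupport_cutoff (R : ℝ) : HasCompactSupport (cutoff R : Space N → ℝ) :=
  HasCompactSupport.intro (isCompact_closedBall 0 (R + 1)) fun _ hx => cutoff_eq_zero hx

theorem tendsto_integral_mul_sub {ι : Type*} {l : Filter ι} {u : ι → Space N → ℝ}
    {g v φ : Space N → ℝ} (hu : ∀ n, LipschitzWith L (u n)) (hv : LipschitzWith L v)
    (hlim : ∀ x, Tendsto (fun n => u n x) l (𝓝 (v x))) (hg : Continuous g) (hφ : Continuous φ)
    (hc : HasCompactSupport φ) :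
    Tendsto (fun n => ∫ x, φ x * (g x - u n x)) l (𝓝 (∫ x, φ x * (g x - v x))) := by
  obtain ⟨R, hR⟩ := hc.isCompact.isBounded.subset_closedBall (0 : Space N)
  have hi : Integrable (fun x => |φ x|) volume := (hφ.integrable_of_hasCompactSupport hc).abs
  have hint : ∀ f : Space N → ℝ, Continuous f → Integrable (fun x => φ x * (g x - f x)) volume :=
    fun f hf => (hφ.mul (hg.sub hf)).integrable_of_hasCompactSupport hc.mul_right
  set I := ∫ x, |φ x|
  have hI : 0 ≤ I := integral_nonneg fun x => abs_nonneg _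
  rw [Metric.tendsto_nhds]
  intro ε hε
  have hε' : 0 < ε / (2 * (I + 1)) := by positivity
  filter_upwards [eventually_forall_closedBall_abs_sub_le hu hv hlim R hε'] with n hn
  rw [Real.dist_eq, ← integral_sub (hint _ (hu n).continuous) (hint _ hv.continuous)]
  have hle : ∀ x, ‖φ x * (g x - u n x) - φ x * (g x - v x)‖ ≤ |φ x| * (ε / (2 * (I + 1))) := by
    intro x
    rw [← mul_sub, Real.norm_eq_abs, abs_mul]
    by_cases hx : x ∈ closedBall (0 : Space N) R
    · refine mul_le_mul_of_nonneg_left ?_ (abs_nonneg _)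
      rw [show g x - u n x - (g x - v x) = -(u n x - v x) by ring, abs_neg]
      exact hn x hx
    · rw [image_eq_zero_of_notMem_tsupport fun k => hx (hR k)]
      simp
  refine lt_of_le_of_lt (norm_integral_le_of_norm_le (hi.mul_const _)
    (Eventually.of_forall hle)) ?_
  rw [integral_mul_const, ← mul_div_assoc, div_lt_iff₀ (by positivity)]
  nlinarith

/-- The defect between oscillation and action is nonnegative for a field of mass one. Its cut-off
integral is a limit of Gibbs averages, which concentration and the locally uniform convergence of
u_n to v make arbitrarily small. -/
theorem ae_fieldAction_eq_ballOsc_of_limit (hr : 0 < r) {u : ℕ → Space N → ℝ} {v : Space N → ℝ}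
    (hu : ∀ n, LipschitzWith L (u n)) (hv : LipschitzWith L v) {l : Filter ℕ} [l.NeBot]
    (hl : l ≤ atTop) (hlim : ∀ x, Tendsto (fun n => u n x) l (𝓝 (v x)))
    {z : Space N → FiniteMeasure (ballPair N r)} (hzb : IsBoundedField r z)
    (hzm : ∀ w, (z w).mass = 1)
    (hz : ∀ F : Space N × ballPair N r → ℝ, Continuous F →
      (∃ R, ∀ w ∉ closedBall (0 : Space N) R, ∀ p, F (w, p) = 0) →
      Tendsto (fun n : ℕ => ∫ w, gibbsAvg r ((n : ℝ) + 1) (u n) w fun p => F (w, p)) l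
        (𝓝 (∫ w, ∫ p, F (w, p) ∂(z w : Measure (ballPair N r))))) :
    ∀ᵐ w, fieldAction r z v w = ballOsc r v w := by
  have hvc := hv.continuous
  have hosc : Continuous (ballOsc r v) := continuous_ballOsc hr.le hv
  have hθ : ∀ w, 0 ≤ ballOsc r v w - fieldAction r z v w := fun w =>
    sub_nonneg.2 (fieldAction_le hr.le z hvc (hzm w).le)
  have key : ∀ R : ℕ, ∀ᵐ w, cutoff (R : ℝ) w * (ballOsc r v w - fieldAction r z v w) = 0 := by
    intro R
    set η : Space N → ℝ := cutoff (R : ℝ)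
    have hη : Continuous η := continuous_cutoff _
    have hηi : Integrable η volume := hη.integrable_of_hasCompactSupport (hasCompactSupport_cutoff _)
    set I := ∫ w, η w
    have hI : 0 ≤ I := integral_nonneg fun w => cutoff_nonneg _ w
    have hval : ∀ w, ∫ p, η w * (ballOsc r v w - pairDiff v w p) ∂(z w : Measure (ballPair N r)) =
        η w * (ballOsc r v w - fieldAction r z v w) := by
      intro w
      have h1 : (z w : Measure (ballPair N r)).real univ = 1 :=
        congrArg NNReal.toReal (hzm w)
      rw [integral_const_mul, integral_sub (integrable_const _)
        (integrable_of_continuous_ballPair _ (continuous_pairDiff_right hvc w)), integral_const, h1,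
        one_smul, fieldAction_eq]
    have hF := hz (fun q => η q.1 * (ballOsc r v q.1 - pairDiff v q.1 q.2))
      ((hη.comp continuous_fst).mul
        ((hosc.comp continuous_fst).sub (continuous_pairDiff hvc)))
      ⟨R + 1, fun w hw p => by rw [show η w = 0 from cutoff_eq_zero hw, zero_mul]⟩
    simp only [hval] at hF
    -- The constant 6 is 2 + 4: concentration gives ε + K/β ≤ 2ε for u_n, and replacing u_n by v
    -- costs 2ε in the oscillation and 2ε in the pair difference.
    have hle : ∀ ε : ℝ, 0 < ε →
        ∫ w, η w * (ballOsc r v w - fieldAction r z v w) ≤ 6 * ε * I := by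
      intro ε hε
      obtain ⟨K, hK⟩ := exists_gibbsAvg_le hr N L hε
      refine le_of_tendsto hF ?_
      have hβ : ∀ᶠ n : ℕ in l, K / ((n : ℝ) + 1) ≤ ε := by
        have h1 : Tendsto (fun n : ℕ => K / ((n : ℝ) + 1)) atTop (𝓝 0) :=
          tendsto_const_nhds.div_atTop
            (tendsto_atTop_add_const_right _ _ tendsto_natCast_atTop_atTop)
        exact hl (h1.eventually (ge_mem_nhds hε))
      filter_upwards [hβ, eventually_forall_closedBall_abs_sub_le hu hv hlim (R + 1 + r) hε]
        with n hn hun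
      rw [← integral_const_mul]
      have huc := (hu n).continuous
      have hcont : ∀ w, Continuous fun p : ballPair N r => ballOsc r v w - pairDiff v w p :=
        fun w => continuous_const.sub (continuous_pairDiff_right hvc w)
      have hmul : ∀ w, gibbsAvg r ((n : ℝ) + 1) (u n) w
          (fun p => η w * (ballOsc r v w - pairDiff v w p)) =
          η w * gibbsAvg r ((n : ℝ) + 1) (u n) w fun p => ballOsc r v w - pairDiff v w p := by
        intro w
        rw [gibbsAvg, gibbsAvg, ← integral_const_mul]
        congr 1 with p
        ring
      refine integral_mono_of_nonneg (Eventually.of_forall fun w => ?_) (hηi.const_mul _)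
        (Eventually.of_forall fun w => ?_)
      · exact integral_nonneg fun p => mul_nonneg (gibbsDensity_nonneg hr huc w p)
          (mul_nonneg (cutoff_nonneg _ w) (sub_nonneg.2 (pairDiff_le hvc w p)))
      · simp only
        rw [hmul, mul_comm]
        by_cases hw : w ∈ closedBall (0 : Space N) (R + 1)
        · refine mul_le_mul_of_nonneg_right ?_ (cutoff_nonneg _ w)
          have hclose : ∀ x ∈ closedBall w r, |u n x - v x| ≤ ε := fun x hx => hun x (by
            rw [mem_closedBall] at *
            linarith [dist_triangle x w 0])
          have ho : ballOsc r v w ≤ ballOsc r (u n) w + 2 * ε :=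
            ballOsc_le_add hr.le hvc huc fun x hx => by
              rw [abs_sub_comm]
              exact hclose x hx
          have hpt : ∀ p : ballPair N r, ballOsc r v w - pairDiff v w p ≤
              (ballOsc r (u n) w - pairDiff (u n) w p) + 4 * ε := by
            intro p
            have e1 := abs_le.1 (hclose _ (fst_mem w p))
            have e2 := abs_le.1 (hclose _ (snd_mem w p))
            simp only [pairDiff]
            linarith [e1.1, e1.2, e2.1, e2.2]
          have hcont' : Continuous fun p : ballPair N r =>
              ballOsc r (u n) w - pairDiff (u n) w p :=
            continuous_const.sub (continuous_pairDiff_right huc w)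
          have hg := gibbsAvg_mono (β := (n : ℝ) + 1)
            (g := fun p => (ballOsc r (u n) w - pairDiff (u n) w p) + 4 * ε) hr huc w (hcont w)
            (hcont'.add continuous_const) hpt
          have hs : gibbsAvg r ((n : ℝ) + 1) (u n) w
              (fun p => (ballOsc r (u n) w - pairDiff (u n) w p) + 4 * ε) =
              gibbsAvg r ((n : ℝ) + 1) (u n) w
                (fun p => ballOsc r (u n) w - pairDiff (u n) w p) + 4 * ε := by
            have k := gibbsAvg_const (β := (n : ℝ) + 1) hr huc w (4 * ε)
            simp only [gibbsAvg] at k ⊢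
            simp only [mul_add]
            rw [integral_add (integrable_gibbsDensity_mul hr huc w hcont')
              (integrable_gibbsDensity_mul hr huc w continuous_const), k]
          have hk := hK ((n : ℝ) + 1) (u n) (by positivity) (hu n) w
          rw [hs] at hg
          linarith
        · rw [show η w = 0 from cutoff_eq_zero hw, mul_zero, mul_zero]
    have hle0 : ∫ w, η w * (ballOsc r v w - fieldAction r z v w) ≤ 0 := by
      refine le_of_forall_pos_le_add fun δ hδ => ?_
      refine (hle (δ / (6 * (I + 1))) (by positivity)).trans ?_
      rw [zero_add, mul_div_assoc', div_mul_eq_mul_div, div_le_iff₀ (by positivity)]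
      nlinarith
    have hnn : ∀ w, 0 ≤ η w * (ballOsc r v w - fieldAction r z v w) := fun w =>
      mul_nonneg (cutoff_nonneg _ w) (hθ w)
    have hint : Integrable (fun w => η w * (ballOsc r v w - fieldAction r z v w)) volume := by
      have hO : ∀ w, ballOsc r v w ≤ L * (2 * r) := ballOsc_le_of_lipschitz hr.le hv
      refine integrable_of_bounded_of_zero (C := 2 * (L * (2 * r))) (R := R + 1)
        (hη.aemeasurable.mul (hosc.aemeasurable.sub
          (aemeasurable_fieldAction hzb hvc))).aestronglyMeasurable
        (Eventually.of_forall fun w => ?_)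
        fun w hw => by rw [show η w = 0 from cutoff_eq_zero hw, zero_mul]
      rw [abs_of_nonneg (hnn w)]
      have h1 := abs_fieldAction_le z (hzm w).le (ballOsc_nonneg hr.le hvc w)
        (abs_pairDiff_le hvc w)
      have h2 := (abs_le.1 h1).1
      refine (mul_le_of_le_one_left (hθ w) (cutoff_le_one _ w)).trans ?_
      linarith [hO w]
    have := (integral_eq_zero_iff_of_nonneg hnn hint).1
      (le_antisymm hle0 (integral_nonneg hnn))
    exact this
  rw [← ae_all_iff] at key
  filter_upwards [key] with w hw
  obtain ⟨R, hR⟩ := exists_nat_ge ‖w‖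
  have := hw R
  rw [cutoff_eq_one hR, one_mul] at this
  linarith

/-- Existence for the Euler-Lagrange system with a Lipschitz datum. -/
theorem exists_isSolution (hr : 0 < r) (hh : 0 < h) {g : Space N → ℝ} (hg : LipschitzWith L g) :
    ∃ u : Space N → ℝ, LipschitzWith L u ∧ (∃ C : ℝ, ∀ x, |g x - u x| ≤ C) ∧
      IsSolution r h g u := by
  obtain ⟨C, hC⟩ := exists_abs_sub_le hr hh N L
  choose u hu hs using fun n : ℕ =>
    exists_softOp_solution (β := (n : ℝ) + 1) hr hh (by positivity) hg
  have hub : ∀ n x, |g x - u n x| ≤ C := fun n x => hC _ g (u n) hg (hu n) (hs n) x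
  -- One ultrafilter gives pointwise limits at all points at once, and the same ultrafilter is used
  -- for the fields, so no subsequences have to be matched.
  have hlimex : ∀ x, ∃ a, Tendsto (fun n => u n x) (hyperfilter ℕ) (𝓝 a) := by
    intro x
    obtain ⟨a, -, ha⟩ := (isCompact_Icc (a := g x - C) (b := g x + C)).ultrafilter_le_nhds
      ((hyperfilter ℕ).map fun n => u n x) (by
        rw [Ultrafilter.coe_map]
        refine tendsto_principal.2 (Eventually.of_forall fun n => ?_)
        have := abs_le.1 (hub n x)
        exact ⟨by linarith [this.2], by linarith [this.1]⟩)
    exact ⟨a, ha⟩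
  choose v hv using hlimex
  have hvL : LipschitzWith L v := LipschitzWith.of_dist_le_mul fun x y =>
    le_of_tendsto ((hv x).dist (hv y)) (Eventually.of_forall fun n => (hu n).dist_le_mul x y)
  have hvC : ∀ x, |g x - v x| ≤ C := fun x =>
    le_of_tendsto (tendsto_const_nhds.sub (hv x)).abs (Eventually.of_forall fun n => hub n x)
  obtain ⟨z, hzb, hzm, hz⟩ := exists_limit_field hr (fun n : ℕ => (n : ℝ) + 1) u
    fun n => (hu n).continuous
  have hosc := ae_fieldAction_eq_ballOsc_of_limit hr hu hvL
    (Nat.hyperfilter_le_atTop) hv hzb hzm hz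
  refine ⟨v, hvL, ⟨C, hvC⟩, z, ⟨hzb, ?_⟩, fun φ hφ hc => ?_⟩
  · filter_upwards [hosc] with w hw
    exact ⟨(hzm w).le, by rw [hw, essOsc_ball_eq hr hvL.continuous]⟩
  · have h1 := hz (fun q => pairDiff φ q.1 q.2) (continuous_pairDiff hφ) (by
      obtain ⟨R, hR⟩ := exists_forall_eq_zero hc r
      exact ⟨R, fun w hw p => pairDiff_eq_zero (hR w hw) p⟩)
    have h2 := tendsto_integral_mul_sub hu hvL hv hg.continuous hφ hc
    have h3 : ∀ n : ℕ, h * (1 / (2 * r)) *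
        ∫ w, gibbsAvg r ((n : ℝ) + 1) (u n) w (fun p => pairDiff φ w p) =
        ∫ x, φ x * (g x - u n x) := fun n =>
      integral_gibbsAvg_pairDiff hr (hu n).continuous (hs n) hφ hc
    have h4 := h1.const_mul (h * (1 / (2 * r)))
    simp only [h3] at h4
    have h5 := tendsto_nhds_unique h4 h2
    have hiu : Integrable (fun w => φ w * v w) :=
      (hφ.mul hvL.continuous).integrable_of_hasCompactSupport hc.mul_right
    have hig : Integrable (fun w => φ w * g w) :=
      (hφ.mul hg.continuous).integrable_of_hasCompactSupport hc.mul_right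
    simp only [mul_sub] at h5
    rw [integral_sub hig hiu] at h5
    simp only [nonlocalDiv, fieldAction_eq]
    linarith

theorem exists_isSolution_lipPlus (hr : 0 < r) (hh : 0 < h) {g : Space N → ℝ}
    (hg : g ∈ LipPlus N) {K : ℝ≥0} (hK : LipschitzWith K g) :
    ∃ u ∈ LipPlus N, LipschitzWith K u ∧ IsSolution r h g u := by
  obtain ⟨u, hu, ⟨C, hC⟩, hs⟩ := exists_isSolution hr hh hK
  refine ⟨u, ⟨⟨K, hu⟩, ?_⟩, hu, hs⟩
  refine tendsto_atTop_mono (fun x => ?_) (tendsto_atTop_add_const_right _ (-C) hg.2)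
  linarith [(abs_le.1 (hC x)).2]

theorem exists_unique_solution_lipPlus (hr : 0 < r) (hh : 0 < h) {g : Space N → ℝ}
    (hg : g ∈ LipPlus N) :
    ∃ u ∈ LipPlus N, IsSolution r h g u ∧ (∀ v ∈ LipPlus N, IsSolution r h g v → v = u) ∧
      lipConst u ≤ lipConst g ∧ ∀ t : ℝ,
        IsMinimalMinimizer r h (fun w => g w - t) {w | u w < t} ∧
        IsMaximalMinimizer r h (fun w => g w - t) {w | u w ≤ t} := by
  have hgc := LipPlus.continuous hg
  obtain ⟨u, hu, -, hs⟩ := exists_isSolution_lipPlus hr hh hg hg.1.choose_spec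
  have huniq : ∀ v ∈ LipPlus N, IsSolution r h g v → v = u := fun v hv hsv => funext fun w =>
    le_antisymm (le_of_isSolution_of_lipPlus hr hh hgc hgc hv hu hsv hs (fun _ => le_rfl) w)
      (le_of_isSolution_of_lipPlus hr hh hgc hgc hu hv hs hsv (fun _ => le_rfl) w)
  refine ⟨u, hu, hs, huniq, ?_, isMinimalMinimizer_and_isMaximalMinimizer hr hh hg hu hs⟩
  -- The existence result yields a K-Lipschitz solution for each admissible K of g; by uniqueness
  -- all of these are u.
  refine le_iInf₂ fun K hK => ?_
  obtain ⟨v, hv, hvK, hsv⟩ := exists_isSolution_lipPlus hr hh hg hK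
  rw [huniq v hv hsv] at hvK
  exact iInf₂_le K hvK

theorem lipConst_neg (f : Space N → ℝ) : lipConst (fun x => -f x) = lipConst f := by
  have : ∀ K : ℝ≥0, LipschitzWith K (fun x => -f x) ↔ LipschitzWith K f := fun K =>
    ⟨fun k => LipschitzWith.of_dist_le_mul fun x y => by simpa using k.dist_le_mul x y,
      fun k => k.neg⟩
  simp only [lipConst, this]

/-- Apply the `LipPlus` case to -g: the sublevel sets of the reflected solution at height -t are the
superlevel sets at height t. -/
theorem exists_unique_solution_lipMinus (hr : 0 < r) (hh : 0 < h) {g : Space N → ℝ}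
    (hg : g ∈ LipMinus N) :
    ∃ u ∈ LipMinus N, IsSolution r h g u ∧ (∀ v ∈ LipMinus N, IsSolution r h g v → v = u) ∧
      lipConst u ≤ lipConst g ∧ ∀ t : ℝ,
        IsMinimalMinimizer r h (fun w => t - g w) {w | t < u w} ∧
        IsMaximalMinimizer r h (fun w => t - g w) {w | t ≤ u w} := by
  obtain ⟨u, hu, hs, huniq, hlip, hmin⟩ := exists_unique_solution_lipPlus hr hh (LipMinus.neg hg)
  refine ⟨fun x => -u x, LipPlus.neg hu, ?_, fun v hv hsv => ?_, ?_, fun t => ?_⟩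
  · simpa using isSolution_neg hr (LipPlus.continuous hu) hs
  · rw [← huniq _ (LipMinus.neg hv) (isSolution_neg hr (LipMinus.continuous hv) hsv)]
    simp
  · rwa [lipConst_neg, ← lipConst_neg g]
  · have h1 := hmin (-t)
    have e1 : (fun w => -g w - -t) = fun w => t - g w := by
      ext w
      ring
    have e2 : {w | u w < -t} = {w | t < -u w} := by
      ext w
      change u w < -t ↔ t < -u w
      exact lt_neg
    have e3 : {w | u w ≤ -t} = {w | t ≤ -u w} := by
      ext w
      change u w ≤ -t ↔ t ≤ -u w
      exact le_neg
    rwa [e1, e2, e3] at h1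

end NonlocalROF

end

theorem theorem3p2 (N : ℕ) (r h : ℝ) (hr : 0 < r) (hh : 0 < h) :
    (∀ g ∈ NonlocalROF.LipPlus N,
      ∃ u ∈ NonlocalROF.LipPlus N,
        NonlocalROF.IsSolution r h g u ∧
        (∀ v ∈ NonlocalROF.LipPlus N, NonlocalROF.IsSolution r h g v → v = u) ∧
        NonlocalROF.lipConst u ≤ NonlocalROF.lipConst g ∧
        ∀ t : ℝ,
          NonlocalROF.IsMinimalMinimizer r h (fun w => g w - t) {w | u w < t} ∧
          NonlocalROF.IsMaximalMinimizer r h (fun w => g w - t) {w | u w ≤ t}) ∧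
    (∀ g ∈ NonlocalROF.LipMinus N,
      ∃ u ∈ NonlocalROF.LipMinus N,
        NonlocalROF.IsSolution r h g u ∧
        (∀ v ∈ NonlocalROF.LipMinus N, NonlocalROF.IsSolution r h g v → v = u) ∧
        NonlocalROF.lipConst u ≤ NonlocalROF.lipConst g ∧
        ∀ t : ℝ,
          NonlocalROF.IsMinimalMinimizer r h (fun w => t - g w) {w | t < u w} ∧
          NonlocalROF.IsMaximalMinimizer r h (fun w => t - g w) {w | t ≤ u w}) ∧
    (∀ g₁ g₂ u₁ u₂ : NonlocalROF.Space N → ℝ,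
      ((g₁ ∈ NonlocalROF.LipPlus N ∧ u₁ ∈ NonlocalROF.LipPlus N) ∨
        (g₁ ∈ NonlocalROF.LipMinus N ∧ u₁ ∈ NonlocalROF.LipMinus N)) →
      ((g₂ ∈ NonlocalROF.LipPlus N ∧ u₂ ∈ NonlocalROF.LipPlus N) ∨
        (g₂ ∈ NonlocalROF.LipMinus N ∧ u₂ ∈ NonlocalROF.LipMinus N)) →
      NonlocalROF.IsSolution r h g₁ u₁ → NonlocalROF.IsSolution r h g₂ u₂ →
      (∀ w, g₁ w ≤ g₂ w) → ∀ w, u₁ w ≤ u₂ w) :=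
  ⟨fun _ hg => NonlocalROF.exists_unique_solution_lipPlus hr hh hg,
    fun _ hg => NonlocalROF.exists_unique_solution_lipMinus hr hh hg,
    fun _ _ _ _ h₁ h₂ hs₁ hs₂ hg w => NonlocalROF.le_of_isSolution hr hh h₁ h₂ hs₁ hs₂ hg w⟩
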